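/- Fix integers $d,n\ge 1$, corruption rates $\boldsymbol\lambda=(\lambda_1,\dots,\lambda_n)\in[0,1]^n$, a symmetric positive definite matrix $\Sigma\in\mathbb R^{d\times d}$ and $\sigma>0$. For $\beta\in\mathbb R^d$ let $P_\beta$ be the law of $(W,Y)\in\mathbb R^{d}\times\mathbb R$ with $W\sim\mathcal N(0,\Sigma)$ and $Y\mid W\sim\mathcal N(W^\top\beta,\sigma^2)$. A $\boldsymbol\lambda$-contaminated sample $\mathbf Z=(Z_1,\dots,Z_n)$ from $P_\beta$, written $\mathbf Z\sim_{\boldsymbol\lambda}P_\beta$, is $Z_i=(1-B_i)X_i+B_i\tilde X_i$, where $X_1,\dots,X_n$ are i.i.d. from $P_\beta$, the $B_i\sim\mathrm{Bern}(\lambda_i)$ are independent of each other and of the $X_i$, and the outliers $(\tilde X_1,\dots,\tilde X_n)\in(\mathbb R^{d}\times\mathbb R)^n$ are drawn from an arbitrary joint distribution (the adversary) conditionally on $(X_i)_{i\le n}$ and $(B_i)_{i\le n}$. Write $\|x\|_\Sigma^2=x^\top\Sigma x$ and $$L_{\mathsf{reg}}(\boldsymbol\lambda)=\inf\Big\{r\ge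 0:\ \inf_M\ \sup_{\beta,\ \text{adversary}}\ \Pr_{\mathbf Z\sim_{\boldsymbol\lambda}P_\beta}\big[\|M(\mathbf Z)-\beta\|_\Sigma^2>r\big]\le \tfrac15\Big\},$$ where $M$ ranges over all (measurable) estimators $(\mathbb R^d\times\mathbb R)^n\to\mathbb R^d$ and the supremum is over all $\beta\in\mathbb R^d$ and all adversaries. Let $N(t)=|\{i:\lambda_i\le t\}|$ and $$f(\boldsymbol\lambda,d)=\min_{t\in[0,1]}\Big(\frac d{N(t)}+t^2\Big),\qquad \frac d0:=\infty .$$ For $w\in\mathbb R_{\ge0}^n$ and data $Z_i=(\hat W_i,\hat Y_i)$ the weighted regression depth of $\eta\in\mathbb R^d$ is $$D_w(\eta,\mathbf Z)=\min_{\|v\|_2=1}\sum_{i=1}^n w_i\,\mathbb 1\{(\hat Y_i-\eta^\top\hat W_i)(v^\top\hat W_i)\ge 0\}.$$ **Theorem.** There are universal constants $c,C_1,C_2>0$ such that for all $d,n,\boldsymbol\lambda,\Sigma,\sigma$ as above with $f(\boldsymbol\lambda,d)\le c$, $$C_1\,\frac{\sigma^2}{\sqrt d}\,f(\boldsymbol\lambda,d)\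 \le\ L_{\mathsf{reg}}(\boldsymbol\lambda)\ \le\ C_2\,\sigma^2 f(\boldsymbol\lambda,d).$$ Moreover, the upper bound is achieved by the thresholded Tukey regression estimator: a minimizer $t^*\in[0,1]$ of $d/N(t)+t^2$ exists, and for every such $t^*$, with weights $w_i=\mathbb 1\{\lambda_i\le t^*\}/N(t^*)$, a measurable map $\hat\beta$ with $\hat\beta(\mathbf Z)\in\arg\max_{\eta\in\mathbb R^d}D_w(\eta,\mathbf Z)$ for all $\mathbf Z$ exists, and every map $\hat\beta$ with this argmax property satisfies, for all $\beta$ and all adversaries, $$\Pr_{\mathbf Z\sim_{\boldsymbol\lambda}P_\beta}\big[\|\hat\beta(\mathbf Z)-\beta\|_\Sigma^2>C_2\,\sigma^2 f(\boldsymbol\lambda,d)\big]\le\tfrac15$$ (outer probability if $\hat\beta$ is not measurable). -/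

import Mathlib

open MeasureTheory ProbabilityTheory
open scoped ENNReal NNReal

noncomputable section

namespace HeterogeneousRegression

/-- Space of one observation `(w, y)`: covariate in `ℝ^d` with the Euclidean structure, and
response. -/
abbrev Obs (d : ℕ) : Type := EuclideanSpace ℝ (Fin d) × ℝ

/-- A data set of `n` observations. -/
abbrev Dataset (d n : ℕ) : Type := Fin n → Obs d

/-- The conditional law of the response given the covariate: `w ↦ N(wᵀβ, σ²)`. -/
def responseKernel {d : ℕ} (β : EuclideanSpace ℝ (Fin d)) (σ : ℝ≥0) :
    Kernel (EuclideanSpace ℝ (Fin d)) ℝ where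
  toFun w := gaussianReal (inner ℝ w β) (σ ^ 2)
  measurable' :=
    measurable_gaussianReal.comp (f := fun w : EuclideanSpace ℝ (Fin d) =>
      ((inner ℝ w β : ℝ), σ ^ 2)) (by fun_prop)

instance {d : ℕ} (β : EuclideanSpace ℝ (Fin d)) (σ : ℝ≥0) :
    IsMarkovKernel (responseKernel β σ) :=
  ⟨fun w => inferInstanceAs (IsProbabilityMeasure (gaussianReal (inner ℝ w β) (σ ^ 2)))⟩

/-- The clean law `P_β` of one observation: `W ∼ N(0, S)` and, given `W`, `Y ∼ N(Wᵀβ, σ²)`. -/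
def cleanLaw {d : ℕ} (S : Matrix (Fin d) (Fin d) ℝ) (σ : ℝ≥0)
    (β : EuclideanSpace ℝ (Fin d)) : Measure (Obs d) :=
  (multivariateGaussian 0 S) ⊗ₘ (responseKernel β σ)

instance {d : ℕ} (S : Matrix (Fin d) (Fin d) ℝ) (σ : ℝ≥0) (β : EuclideanSpace ℝ (Fin d)) :
    IsProbabilityMeasure (cleanLaw S σ β) := by
  unfold cleanLaw; infer_instance

/-- An adversary: the joint conditional law of all outliers given all the clean samples and all
the corruption indicators. -/
abbrev Adversary (Z : Type) [MeasurableSpace Z] (n : ℕ) : Type :=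
  {κ : Kernel ((Fin n → Z) × (Fin n → Bool)) (Fin n → Z) // IsMarkovKernel κ}

/-- The observed sample: the outlier where the indicator is `true`, the clean point elsewhere. -/
def contaminate {Z : Type} {n : ℕ} (p : ((Fin n → Z) × (Fin n → Bool)) × (Fin n → Z)) :
    Fin n → Z :=
  fun i => if p.1.2 i then p.2 i else p.1.1 i

lemma measurable_contaminate {Z : Type} [MeasurableSpace Z] {n : ℕ} :
    Measurable (contaminate : ((Fin n → Z) × (Fin n → Bool)) × (Fin n → Z) → Fin n → Z) := by
  refine measurable_pi_lambda _ fun i => Measurable.ite ?_ (by fun_prop) (by fun_prop)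
  have h : Measurable fun p : ((Fin n → Z) × (Fin n → Bool)) × (Fin n → Z) => p.1.2 i := by
    fun_prop
  exact h (measurableSet_singleton true)

/-- The law of a `lam`-contaminated sample from `P` against the adversary `κ`: clean points i.i.d.
from `P`, independent indicators `B i ∼ Bern(lam i)` which are independent of the clean points,
outliers drawn from `κ` given both. -/
def contaminatedLaw {Z : Type} [MeasurableSpace Z] {n : ℕ} (lam : Fin n → unitInterval) (P : Measure Z)
    (κ : Adversary Z n) : Measure (Fin n → Z) :=
  (((Measure.pi fun _ : Fin n => P).prod
      (Measure.pi fun i => bernoulliMeasure true false (lam i))) ⊗ₘ κ.1).map contaminate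

instance {Z : Type} [MeasurableSpace Z] {n : ℕ} (lam : Fin n → unitInterval) (P : Measure Z)
    [IsProbabilityMeasure P] (κ : Adversary Z n) :
    IsProbabilityMeasure (contaminatedLaw lam P κ) := by
  have := κ.2
  exact Measure.isProbabilityMeasure_map measurable_contaminate.aemeasurable

/-- The squared error `‖b - β‖_S² = (b - β)ᵀ S (b - β)`. -/
def sqError {d : ℕ} (S : Matrix (Fin d) (Fin d) ℝ) (b β : EuclideanSpace ℝ (Fin d)) : ℝ :=
  (fun i => (b - β) i) ⬝ᵥ S.mulVec (fun i => (b - β) i)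

/-- The worst case, over the true coefficient vector and the adversary, of the probability that the
squared error of the estimator `M` exceeds `r`. -/
def worstFailure {d n : ℕ} (lam : Fin n → unitInterval) (S : Matrix (Fin d) (Fin d) ℝ) (σ : ℝ≥0)
    (M : Dataset d n → EuclideanSpace ℝ (Fin d)) (r : ℝ≥0∞) : ℝ≥0∞ :=
  ⨆ (β : EuclideanSpace ℝ (Fin d)) (κ : Adversary (Obs d) n),
    contaminatedLaw lam (cleanLaw S σ β) κ {z | r < ENNReal.ofReal (sqError S (M z) β)}

/-- The minimax PAC rate of the squared excess risk at failure probability `δ`; the infimum over `M`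
is over all measurable estimators. -/
def minimaxPACRate {d n : ℕ} (lam : Fin n → unitInterval) (S : Matrix (Fin d) (Fin d) ℝ) (σ : ℝ≥0)
    (δ : ℝ≥0∞) : ℝ≥0∞ :=
  sInf {r : ℝ≥0∞ |
    (⨅ M : {M : Dataset d n → EuclideanSpace ℝ (Fin d) // Measurable M},
      worstFailure lam S σ M.1 r) ≤ δ}

/-- `N(t) = #{i : lam i ≤ t}`. -/
def countLE {n : ℕ} (lam : Fin n → unitInterval) (t : unitInterval) : ℕ :=
  (Finset.univ.filter fun i => lam i ≤ t).card

/-- `d / N(t) + t²`; for `d ≥ 1` this is `∞` when `N(t) = 0`. -/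
def thresholdError {n : ℕ} (lam : Fin n → unitInterval) (d : ℕ) (t : unitInterval) : ℝ≥0∞ :=
  (d : ℝ≥0∞) / (countLE lam t : ℝ≥0∞) + ENNReal.ofReal ((t : ℝ) ^ 2)

/-- `min_{t ∈ [0,1]} (d / N(t) + t²)`. -/
def effectiveError {n : ℕ} (lam : Fin n → unitInterval) (d : ℕ) : ℝ≥0∞ :=
  ⨅ t : unitInterval, thresholdError lam d t

/-- `t` is a minimizer over `[0,1]` of `d / N(t) + t²`. -/
def IsOptimalThreshold {n : ℕ} (lam : Fin n → unitInterval) (d : ℕ) (t : unitInterval) : Prop :=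
  ∀ s : unitInterval, thresholdError lam d t ≤ thresholdError lam d s

/-- The weights `w(t)_i = 1{lam i ≤ t} / N(t)`. -/
def thresholdWeight {n : ℕ} (lam : Fin n → unitInterval) (t : unitInterval) (i : Fin n) : ℝ :=
  if lam i ≤ t then 1 / (countLE lam t : ℝ) else 0

open Classical in
/-- The weighted regression depth of `η`:
`min_{‖v‖ = 1} ∑ i, w i * 1{(y i - ηᵀ x i) (vᵀ x i) ≥ 0}` for observations `z i = (x i, y i)`. -/
def regressionDepth {d n : ℕ} (w : Fin n → ℝ) (η : EuclideanSpace ℝ (Fin d))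
    (z : Dataset d n) : ℝ :=
  ⨅ v : Metric.sphere (0 : EuclideanSpace ℝ (Fin d)) 1,
    ∑ i, w i *
      (if 0 ≤ ((z i).2 - inner ℝ η (z i).1) * inner ℝ (v : EuclideanSpace ℝ (Fin d)) (z i).1
        then 1 else 0)

/-- `M` is a weighted Tukey regression estimator: `M z` maximizes the weighted regression depth. -/
def IsTukeyRegression {d n : ℕ} (w : Fin n → ℝ)
    (M : Dataset d n → EuclideanSpace ℝ (Fin d)) : Prop :=
  ∀ (z : Dataset d n) (η : EuclideanSpace ℝ (Fin d)),
    regressionDepth w η z ≤ regressionDepth w (M z) z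

end HeterogeneousRegression

end

open HeterogeneousRegression

namespace HeterogeneousRegression

/-! Upper bound. Whitening writes a clean observation as W = Σ^{1/2}g, Y = Wᵀβ + σξ with g, ξ
independent standard Gaussians. For a unit vector u let T_s(u) = {s⟨u,g⟩² ≤ ξ⟨u,g⟩} (`tiltSet`); its
probability is at most 1/2 - s/900 for 0 ≤ s ≤ 1 (`tiltProb_le`). If ‖Σ^{1/2}(b-β)‖ > sσ, the
observations counted by the depth of b in direction b-β all lie in T_s(u), with u the normalized
Σ^{1/2}(b-β), while those not counted by the depth of β lie in some T_0(u). Hence only two families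
of sets, each indexed by the sphere, must be controlled. Chaining over nets of the sphere
(`uniform_deviation`) bounds the excess of their empirical frequencies by a multiple of √(d/N), with
no logarithm. Whatever the adversary does, corruption adds at most the number of corrupted points,
which is O(Nt) by Markov's inequality. So with s a large multiple of √(d/N + t²), the truth is
deeper than every b at distance more than sσ (`norm_le_of_no_deviation`).

Lower bound. Take hypotheses with coordinates ±δ in k whitened directions. All their regression
functions are dominated by one a(x) with E a(W)/σ ≤ δk/σ. If this is at most τ, the upper envelope
of all the densities has mass at most 1 + τ, so its normalization Q dominates (1-λ)P for every
hypothesis P and every λ ≥ τ (`exists_dominating_law`). The adversary can then replace each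
observation of rate above τ by a draw from Q (`exists_adversary_hiding`), leaving only N(τ)
informative ones. For τ² = f/15, minimality of f makes N(τ) at most of order d/f, and Hellinger
affinity with Assouad's lemma forces an error of order δ²k provided N(τ)δ² ≲ σ². The constraints δk
≤ στ and dδ² ≲ σ²f balance at k ≈ √d, giving σ²f/√d; the gap between the bounds comes from a(W)
growing linearly in k.

The measurable estimator comes from a selection theorem applied to the argmax of the depth, which is
upper semicontinuous and takes finitely many values. -/

/-! ### Exponential concentration for i.i.d. sums -/

/-- Tonelli's theorem for a product of functions of the separate coordinates. -/
lemma lintegral_pi_prod {α : Type*} [MeasurableSpace α] {n : ℕ} (μ : Fin n → Measure α)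
    [∀ i, SigmaFinite (μ i)] (f : Fin n → α → ℝ≥0∞) (hf : ∀ i, Measurable (f i)) :
    ∫⁻ x, ∏ i, f i (x i) ∂(Measure.pi μ) = ∏ i, ∫⁻ a, f i a ∂(μ i) := by
  induction n with
  | zero => simp
  | succ n ih =>
    rw [← ((measurePreserving_piFinSuccAbove μ 0).symm).lintegral_comp_emb
      (MeasurableEquiv.measurableEmbedding _)]
    simp_rw [MeasurableEquiv.piFinSuccAbove_symm_apply, Fin.insertNthEquiv,
      Fin.prod_univ_succ, Fin.insertNth_zero, Equiv.coe_fn_mk, Fin.cons_succ,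
      Fin.zero_succAbove, cast_eq, Fin.cons_zero]
    rw [← ih (fun i => μ i.succ) (fun i => f i.succ) fun i => hf _]
    exact lintegral_prod_mul (hf 0).aemeasurable
      (Finset.measurable_prod _ fun i _ => (hf _).comp (measurable_pi_apply i)).aemeasurable

variable {Ω : Type*} [MeasurableSpace Ω] {n : ℕ}

lemma lintegral_exp_sum (P : Measure Ω) [IsProbabilityMeasure P] (I : Finset (Fin n))
    {g : Ω → ℝ} (hg : Measurable g) :
    ∫⁻ x, ENNReal.ofReal (Real.exp (∑ i ∈ I, g (x i))) ∂(Measure.pi fun _ : Fin n => P)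
      = (∫⁻ a, ENNReal.ofReal (Real.exp (g a)) ∂P) ^ I.card := by
  have h1 : ∀ x : Fin n → Ω, ENNReal.ofReal (Real.exp (∑ i ∈ I, g (x i)))
      = ∏ i, (fun a => if i ∈ I then ENNReal.ofReal (Real.exp (g a)) else 1) (x i) := by
    intro x
    rw [Real.exp_sum, ENNReal.ofReal_prod_of_nonneg fun i _ => (Real.exp_pos _).le]
    simp
  simp_rw [h1]
  rw [lintegral_pi_prod (fun _ => P)
    (fun i a => if i ∈ I then ENNReal.ofReal (Real.exp (g a)) else 1)]
  · have : ∀ i : Fin n, ∫⁻ a, (if i ∈ I then ENNReal.ofReal (Real.exp (g a)) else 1) ∂P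
        = if i ∈ I then ∫⁻ a, ENNReal.ofReal (Real.exp (g a)) ∂P else 1 := by
      intro i; split_ifs <;> simp
    simp_rw [this]
    simp
  · intro i
    split_ifs <;> fun_prop

/-- Chernoff's bound for the sum of i.i.d. variables over a finite set of indices. -/
lemma chernoff (P : Measure Ω) [IsProbabilityMeasure P] (I : Finset (Fin n))
    {g : Ω → ℝ} (hg : Measurable g) {b : ℝ}
    (hb : ∫⁻ a, ENNReal.ofReal (Real.exp (g a)) ∂P ≤ ENNReal.ofReal (Real.exp b)) (a : ℝ) :
    (Measure.pi fun _ : Fin n => P) {x | I.card * b + a < ∑ i ∈ I, g (x i)}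
      ≤ ENNReal.ofReal (Real.exp (-a)) := by
  set F : (Fin n → Ω) → ℝ≥0∞ := fun x => ENNReal.ofReal (Real.exp (∑ i ∈ I, g (x i)))
  have hF : Measurable F := by
    have : ∀ i, Measurable fun x : Fin n → Ω => g (x i) := fun i => hg.comp (measurable_pi_apply i)
    fun_prop
  have hsub : {x : Fin n → Ω | I.card * b + a < ∑ i ∈ I, g (x i)}
      ⊆ {x | ENNReal.ofReal (Real.exp (I.card * b + a)) ≤ F x} := by
    intro x hx
    exact ENNReal.ofReal_le_ofReal (Real.exp_le_exp.2 (le_of_lt hx))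
  refine (measure_mono hsub).trans ?_
  have hpos : ENNReal.ofReal (Real.exp (I.card * b + a)) ≠ 0 := by
    simp [Real.exp_pos]
  refine (meas_ge_le_lintegral_div hF.aemeasurable hpos ENNReal.ofReal_ne_top).trans ?_
  rw [lintegral_exp_sum P I hg]
  refine ENNReal.div_le_of_le_mul ?_
  calc _ ≤ (ENNReal.ofReal (Real.exp b)) ^ I.card := by gcongr
    _ = ENNReal.ofReal (Real.exp (-a)) * ENNReal.ofReal (Real.exp (I.card * b + a)) := by
      rw [← ENNReal.ofReal_pow (Real.exp_pos _).le, ← ENNReal.ofReal_mul (Real.exp_pos _).le,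
        ← Real.exp_nat_mul, ← Real.exp_add]
      congr 2; ring

/-- A Bernstein-type bound with a free parameter `θ ∈ (0, 1]`. -/
lemma bernstein (P : Measure Ω) [IsProbabilityMeasure P] (I : Finset (Fin n))
    {g : Ω → ℝ} (hg : Measurable g) (hg1 : ∀ ω, |g ω| ≤ 1) {m v θ : ℝ} (hθ : 0 < θ) (hθ1 : θ ≤ 1)
    (hm : ∫ ω, g ω ∂P ≤ m) (hv : ∫ ω, g ω ^ 2 ∂P ≤ v) (a : ℝ) :
    (Measure.pi fun _ : Fin n => P) {x | I.card * (m + θ * v) + a / θ < ∑ i ∈ I, g (x i)}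
      ≤ ENNReal.ofReal (Real.exp (-a)) := by
  have hgi : Integrable g P := Integrable.of_bound hg.aestronglyMeasurable 1
    (Filter.Eventually.of_forall fun ω => by simpa using hg1 ω)
  have hg2i : Integrable (fun ω => g ω ^ 2) P := Integrable.of_bound
    (hg.pow_const 2).aestronglyMeasurable 1 (Filter.Eventually.of_forall fun ω => by
      rw [Real.norm_eq_abs, abs_pow]; exact pow_le_one₀ (abs_nonneg _) (hg1 ω))
  have hb : ∫⁻ ω, ENNReal.ofReal (Real.exp (θ * g ω)) ∂P
      ≤ ENNReal.ofReal (Real.exp (θ * (m + θ * v))) := by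
    -- The inequality exp x ≤ 1 + x + x² for |x| ≤ 1; this is where θ ≤ 1 is needed.
    have hpt : ∀ ω, Real.exp (θ * g ω) ≤ 1 + θ * g ω + θ ^ 2 * g ω ^ 2 := by
      intro ω
      have h1 : |θ * g ω| ≤ 1 := by
        rw [abs_mul, abs_of_pos hθ]
        exact mul_le_one₀ hθ1 (abs_nonneg _) (hg1 ω)
      have := Real.abs_exp_sub_one_sub_id_le h1
      have := (abs_le.1 this).2
      nlinarith
    have hI : Integrable (fun ω => 1 + θ * g ω + θ ^ 2 * g ω ^ 2) P := by
      fun_prop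
    calc _ ≤ ∫⁻ ω, ENNReal.ofReal (1 + θ * g ω + θ ^ 2 * g ω ^ 2) ∂P :=
          lintegral_mono fun ω => ENNReal.ofReal_le_ofReal (hpt ω)
      _ = ENNReal.ofReal (∫ ω, (1 + θ * g ω + θ ^ 2 * g ω ^ 2) ∂P) :=
          (ofReal_integral_eq_lintegral_ofReal hI (Filter.Eventually.of_forall fun ω =>
            (Real.exp_pos _).le.trans (hpt ω))).symm
      _ ≤ _ := by
          refine ENNReal.ofReal_le_ofReal ?_
          rw [integral_add (by fun_prop) (by fun_prop), integral_add (by fun_prop) (by fun_prop),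
            integral_const_mul, integral_const_mul]
          simp only [integral_const, probReal_univ, smul_eq_mul, mul_one]
          have := Real.add_one_le_exp (θ * (m + θ * v))
          nlinarith [mul_le_mul_of_nonneg_left hm hθ.le,
            mul_le_mul_of_nonneg_left hv (sq_nonneg θ)]
  refine le_trans (measure_mono ?_) (chernoff P I (hg.const_mul θ) hb a)
  intro x hx
  simp only [Set.mem_ofPred_eq] at hx ⊢
  rw [← Finset.mul_sum]
  have := mul_lt_mul_of_pos_left hx hθ
  have e : θ * (I.card * (m + θ * v) + a / θ) = I.card * (θ * (m + θ * v)) + a := by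
    field_simp
  linarith

end HeterogeneousRegression

namespace HeterogeneousRegression

/-! ### Standard Gaussian estimates -/

lemma gaussianPDFReal_std_le (x : ℝ) : gaussianPDFReal 0 1 x ≤ 1 / 2 := by
  rw [gaussianPDFReal]
  have h2 : (2 : ℝ) ≤ √(2 * Real.pi * (1 : ℝ≥0)) := by
    apply Real.le_sqrt_of_sq_le
    have := Real.pi_gt_three
    norm_num; linarith
  have h3 : Real.exp (-(x - 0) ^ 2 / (2 * (1 : ℝ≥0))) ≤ 1 :=
    Real.exp_le_one_iff.2 (by
      have : 0 ≤ (x - 0) ^ 2 := sq_nonneg _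
      norm_num at *; linarith)
  calc _ ≤ (2 : ℝ)⁻¹ * 1 := by gcongr
    _ = 1 / 2 := by norm_num

lemma le_gaussianPDFReal_std {x : ℝ} (hx : |x| ≤ 2) : 1 / 30 ≤ gaussianPDFReal 0 1 x := by
  rw [gaussianPDFReal]
  have h2 : √(2 * Real.pi * (1 : ℝ≥0)) ≤ 3 := by
    apply Real.sqrt_le_iff.2 ⟨by norm_num, ?_⟩
    have := Real.pi_lt_four
    norm_num; linarith
  have hpos : 0 < √(2 * Real.pi * (1 : ℝ≥0)) := by
    apply Real.sqrt_pos.2; have := Real.pi_pos; simp; positivity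
  have hx2 : x ^ 2 ≤ 4 := by
    have := abs_le.1 hx; nlinarith
  have he1 : Real.exp 1 < 3 := by have := Real.exp_one_lt_d9; linarith
  have h3 : (1 / 10 : ℝ) ≤ Real.exp (-(x - 0) ^ 2 / (2 * (1 : ℝ≥0))) := by
    have h4 : Real.exp (-2) ≤ Real.exp (-(x - 0) ^ 2 / (2 * (1 : ℝ≥0))) := by
      apply Real.exp_le_exp.2; norm_num; linarith
    refine le_trans ?_ h4
    rw [Real.exp_neg, show (2 : ℝ) = 1 + 1 by norm_num, Real.exp_add, one_div]
    apply inv_anti₀ (by positivity)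
    have := Real.exp_pos 1
    nlinarith
  have h5 : (3 : ℝ)⁻¹ ≤ (√(2 * Real.pi * (1 : ℝ≥0)))⁻¹ := inv_anti₀ hpos h2
  calc (1 / 30 : ℝ) = 3⁻¹ * (1 / 10) := by norm_num
    _ ≤ _ := by gcongr

lemma gaussianReal_Icc_le (a b : ℝ) :
    (gaussianReal 0 1) (Set.Icc a b) ≤ ENNReal.ofReal ((b - a) / 2) := by
  rw [gaussianReal_apply 0 one_ne_zero]
  calc _ ≤ ∫⁻ x in Set.Icc a b, ENNReal.ofReal (1 / 2) :=
        lintegral_mono fun x => ENNReal.ofReal_le_ofReal (gaussianPDFReal_std_le x)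
    _ = _ := by
      rw [setLIntegral_const, Real.volume_Icc, ← ENNReal.ofReal_mul (by norm_num)]
      congr 1; ring

lemma le_gaussianReal_Ioo {a b : ℝ} (ha : -2 ≤ a) (hb : b ≤ 2) :
    ENNReal.ofReal ((b - a) / 30) ≤ (gaussianReal 0 1) (Set.Ioo a b) := by
  rw [gaussianReal_apply 0 one_ne_zero]
  calc _ = ∫⁻ x in Set.Ioo a b, ENNReal.ofReal (1 / 30) := by
        rw [setLIntegral_const, Real.volume_Ioo, ← ENNReal.ofReal_mul (by norm_num)]
        congr 1; ring
    _ ≤ _ := by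
      refine setLIntegral_mono (measurable_gaussianPDF 0 1) fun x hx => ?_
      refine ENNReal.ofReal_le_ofReal (le_gaussianPDFReal_std ?_)
      exact abs_le.2 ⟨by linarith [hx.1], by linarith [hx.2]⟩

/-- The factor exp(x²/4) turns the density of variance 1 into √2 times that of variance 2, so the
integral is √2. This is the exponential moment behind the tail bound for sums of squares. -/
lemma lintegral_exp_sq_gaussianReal :
    ∫⁻ x, ENNReal.ofReal (Real.exp (x ^ 2 / 4)) ∂(gaussianReal 0 1)
      ≤ ENNReal.ofReal (Real.exp 1) := by
  rw [gaussianReal_of_var_ne_zero 0 one_ne_zero,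
    lintegral_withDensity_eq_lintegral_mul _ (measurable_gaussianPDF 0 1) (by fun_prop)]
  have h : ∀ x : ℝ, (gaussianPDF 0 1 * fun x => ENNReal.ofReal (Real.exp (x ^ 2 / 4))) x
      = ENNReal.ofReal (√2) * gaussianPDF 0 2 x := by
    intro x
    simp only [Pi.mul_apply, gaussianPDF]
    rw [← ENNReal.ofReal_mul (gaussianPDFReal_nonneg _ _ _), ← ENNReal.ofReal_mul (by positivity)]
    congr 1
    simp only [gaussianPDFReal]
    rw [mul_assoc, ← Real.exp_add]
    have e1 : √(2 * Real.pi * ((2 : ℝ≥0) : ℝ)) = √2 * √(2 * Real.pi * ((1 : ℝ≥0) : ℝ)) := by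
      rw [← Real.sqrt_mul (by norm_num)]; congr 1; push_cast; ring
    rw [e1, mul_inv, ← mul_assoc, ← mul_assoc, mul_inv_cancel₀ (by positivity), one_mul]
    congr 2
    push_cast; ring
  simp_rw [h]
  rw [lintegral_const_mul _ (measurable_gaussianPDF 0 2),
    lintegral_gaussianPDF_eq_one 0 two_ne_zero, mul_one]
  refine ENNReal.ofReal_le_ofReal ?_
  have : √2 ≤ 2 := by
    rw [Real.sqrt_le_left (by norm_num)]; norm_num
  have := Real.add_one_le_exp 1
  linarith

variable {d : ℕ}

lemma stdGaussian_map_inner (u : EuclideanSpace ℝ (Fin d)) :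
    (stdGaussian (EuclideanSpace ℝ (Fin d))).map (fun x => inner ℝ u x)
      = gaussianReal 0 (‖u‖₊ ^ 2) := by
  have h := IsGaussian.map_eq_gaussianReal (μ := stdGaussian (EuclideanSpace ℝ (Fin d)))
    (innerSL ℝ u)
  rw [variance_dual_stdGaussian, innerSL_apply_norm] at h
  have h0 : ∫ x, (innerSL ℝ u) x ∂(stdGaussian (EuclideanSpace ℝ (Fin d))) = 0 :=
    integral_strongDual_stdGaussian _
  rw [h0] at h
  have e : (‖u‖ ^ 2).toNNReal = ‖u‖₊ ^ 2 := by
    ext; simp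
  rw [e] at h
  exact h

/-- The law of a whitened observation: a standard Gaussian covariate and an independent standard
Gaussian noise. -/
noncomputable def stdObs (d : ℕ) : Measure (Obs d) :=
  (stdGaussian (EuclideanSpace ℝ (Fin d))).prod (gaussianReal 0 1)

instance : IsProbabilityMeasure (stdObs d) := by unfold stdObs; infer_instance

lemma stdObs_map_inner {u : EuclideanSpace ℝ (Fin d)} (hu : ‖u‖ = 1) :
    (stdObs d).map (fun z => ((inner ℝ u z.1 : ℝ), z.2))
      = (gaussianReal 0 1).prod (gaussianReal 0 1) := by
  have h := Measure.map_prod_map (stdGaussian (EuclideanSpace ℝ (Fin d))) (gaussianReal 0 1)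
    (f := fun x => (inner ℝ u x : ℝ)) (g := id) (by fun_prop) measurable_id
  rw [stdGaussian_map_inner, Measure.map_id] at h
  have hu' : ‖u‖₊ = 1 := by ext; simpa using hu
  rw [hu', one_pow] at h
  rw [h]; rfl

lemma stdObs_map_inner_fst (u : EuclideanSpace ℝ (Fin d)) :
    (stdObs d).map (fun z => (inner ℝ u z.1 : ℝ)) = gaussianReal 0 (‖u‖₊ ^ 2) := by
  rw [← stdGaussian_map_inner, show (fun z : Obs d => (inner ℝ u z.1 : ℝ))
    = (fun x => inner ℝ u x) ∘ Prod.fst from rfl, ← Measure.map_map (by fun_prop) (by fun_prop)]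
  congr 1
  exact Measure.fst_prod

lemma stdObs_abs_inner_gt_le (u : EuclideanSpace ℝ (Fin d)) {κ : ℝ} (hκ : 0 < κ) :
    (stdObs d).real {z | κ < |(inner ℝ u z.1 : ℝ)|} ≤ ‖u‖ ^ 2 / κ ^ 2 := by
  have h1 : (stdObs d) {z | κ < |(inner ℝ u z.1 : ℝ)|}
      = gaussianReal 0 (‖u‖₊ ^ 2) {x | κ < |x|} := by
    rw [← stdObs_map_inner_fst, Measure.map_apply (by fun_prop)]
    · rfl
    · exact measurableSet_lt measurable_const (by fun_prop)
  have h2 := meas_ge_le_variance_div_sq (μ := gaussianReal 0 (‖u‖₊ ^ 2)) (X := id)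
    (memLp_id_gaussianReal 2) hκ
  rw [Measure.real, h1]
  refine ENNReal.toReal_le_of_le_ofReal (by positivity) ?_
  refine (measure_mono ?_).trans (h2.trans_eq ?_)
  · intro x hx
    simp only [Set.mem_ofPred_eq, id, integral_id_gaussianReal] at hx ⊢
    rw [sub_zero]; exact hx.le
  · rw [variance_id_gaussianReal]; simp

/-! ### The regions counted by the regression depth -/

/-- The observations whose residual after moving the coefficients by `s` in the direction `u` has
the same sign as the covariate in that direction. -/
def tiltSet (s : ℝ) (u : EuclideanSpace ℝ (Fin d)) : Set (Obs d) :=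
  {z | s * (inner ℝ u z.1 : ℝ) ^ 2 ≤ z.2 * inner ℝ u z.1}

/-- A neighbourhood of width `κ` of the boundary of `tiltSet s u`. -/
def tiltBoundary (s κ : ℝ) (u : EuclideanSpace ℝ (Fin d)) : Set (Obs d) :=
  {z | |(inner ℝ u z.1 : ℝ)| ≤ κ ∨ |(|z.2| - s * |(inner ℝ u z.1 : ℝ)|)| ≤ s * κ}

lemma measurableSet_tiltSet (s : ℝ) (u : EuclideanSpace ℝ (Fin d)) :
    MeasurableSet (tiltSet s u) :=
  measurableSet_le (by fun_prop) (by fun_prop)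

lemma measurableSet_tiltBoundary (s κ : ℝ) (u : EuclideanSpace ℝ (Fin d)) :
    MeasurableSet (tiltBoundary s κ u) := by
  have h1 : MeasurableSet {z : Obs d | |(inner ℝ u z.1 : ℝ)| ≤ κ} :=
    measurableSet_le (by fun_prop) (by fun_prop)
  have h2 : MeasurableSet {z : Obs d | |(|z.2| - s * |(inner ℝ u z.1 : ℝ)|)| ≤ s * κ} :=
    measurableSet_le (by fun_prop) (by fun_prop)
  exact h1.union h2

/-- The probability of `tiltSet s u` for a unit vector `u`. -/
noncomputable def tiltProb (s : ℝ) : ℝ :=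
  ((gaussianReal 0 1).prod (gaussianReal 0 1)).real {q : ℝ × ℝ | s * q.1 ^ 2 ≤ q.2 * q.1}

lemma stdObs_tiltSet (s : ℝ) {u : EuclideanSpace ℝ (Fin d)} (hu : ‖u‖ = 1) :
    (stdObs d).real (tiltSet s u) = tiltProb s := by
  rw [tiltProb, ← stdObs_map_inner hu, Measure.real, Measure.real,
    Measure.map_apply (by fun_prop) (measurableSet_le (by fun_prop) (by fun_prop))]
  rfl

lemma tiltProb_le_one (s : ℝ) : tiltProb s ≤ 1 := measureReal_le_one

/-- The region and its mirror image under y ↦ -y have equal mass and a null intersection, and both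
miss the rectangle (1,2) × (-s,s). The rectangle has mass at least (1/30)(2s/30) = s/450, and half
of that is lost. -/
lemma tiltProb_le {s : ℝ} (hs : 0 ≤ s) (hs1 : s ≤ 1) : tiltProb s ≤ 1 / 2 - s / 900 := by
  set γ : Measure ℝ := gaussianReal 0 1
  set T : Set (ℝ × ℝ) := {q | s * q.1 ^ 2 ≤ q.2 * q.1}
  set T' : Set (ℝ × ℝ) := {q | s * q.1 ^ 2 ≤ -q.2 * q.1}
  set R : Set (ℝ × ℝ) := Set.Ioo 1 2 ×ˢ Set.Ioo (-s) s
  have hT : MeasurableSet T := measurableSet_le (by fun_prop) (by fun_prop)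
  have hT' : MeasurableSet T' := measurableSet_le (by fun_prop) (by fun_prop)
  have hR : MeasurableSet R := measurableSet_Ioo.prod measurableSet_Ioo
  have hsymm : (γ.prod γ).real T' = (γ.prod γ).real T := by
    have h := Measure.map_prod_map γ γ (f := id) (g := fun x : ℝ => -x) measurable_id measurable_neg
    rw [Measure.map_id, gaussianReal_map_neg, neg_zero] at h
    have : (γ.prod γ) T = (γ.prod γ) T' := by
      conv_lhs => rw [show (γ.prod γ) = γ.prod (gaussianReal 0 1) from rfl, h]
      rw [Measure.map_apply (by fun_prop) hT]
      rfl
    rw [Measure.real, Measure.real, this]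
  have hna : NullSingletonClass γ := nullSingletonClass_gaussianReal one_ne_zero
  have hnull : (γ.prod γ) (T ∩ T') = 0 := by
    have hsub : T ∩ T' ⊆ ({0} ×ˢ Set.univ) ∪ (Set.univ ×ˢ {0}) := by
      rintro ⟨a, b⟩ ⟨h1, h2⟩
      simp only [T, T', Set.mem_ofPred_eq] at h1 h2
      have h3 : 0 ≤ s * a ^ 2 := by positivity
      have h4 : b * a = 0 := by linarith
      rcases mul_eq_zero.1 h4 with h | h <;> simp [h]
    refine measure_mono_null hsub (measure_union_null ?_ ?_) <;> simp
  have hRm : s / 450 ≤ (γ.prod γ).real R := by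
    have h1 := le_gaussianReal_Ioo (a := 1) (b := 2) (by norm_num) (by norm_num)
    have h2 := le_gaussianReal_Ioo (a := -s) (b := s) (by linarith) (by linarith)
    rw [measureReal_prod_prod]
    have h1' : (1 : ℝ) / 30 ≤ γ.real (Set.Ioo 1 2) := by
      have := ENNReal.toReal_mono (measure_ne_top _ _) h1
      rw [ENNReal.toReal_ofReal (by norm_num)] at this
      norm_num at this ⊢; exact this
    have h2' : s / 15 ≤ γ.real (Set.Ioo (-s) s) := by
      have := ENNReal.toReal_mono (measure_ne_top _ _) h2
      rw [ENNReal.toReal_ofReal (by linarith)] at this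
      refine le_trans (le_of_eq ?_) this
      ring
    calc s / 450 = 1 / 30 * (s / 15) := by ring
      _ ≤ _ := by gcongr
  have hdis : Disjoint (T ∪ T') R := by
    rw [Set.disjoint_left]
    rintro ⟨a, b⟩ h ⟨h1, h2⟩
    simp only [Set.mem_Ioo] at h1 h2
    have h3 : s ≤ s * a := by nlinarith
    rcases h with h | h <;> simp only [T, T', Set.mem_ofPred_eq] at h
    · have : s * a ≤ b := le_of_mul_le_mul_right (by linarith [sq a]) (by linarith : 0 < a)
      linarith
    · have : s * a ≤ -b := le_of_mul_le_mul_right (by linarith [sq a]) (by linarith : 0 < a)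
      linarith
  have h1 : (γ.prod γ).real (T ∪ T') + (γ.prod γ).real R ≤ 1 := by
    rw [← measureReal_union hdis hR]; exact measureReal_le_one
  have h2 : (γ.prod γ).real (T ∪ T') + (γ.prod γ).real (T ∩ T')
      = (γ.prod γ).real T + (γ.prod γ).real T' := measureReal_union_add_inter hT'
  have h3 : (γ.prod γ).real (T ∩ T') = 0 := by rw [Measure.real, hnull]; rfl
  change (γ.prod γ).real T ≤ _
  linarith

/-- The Gaussian density is at most 1/2. The slab has width 2κ and costs κ; for a fixed covariate
the second condition puts the noise in two intervals of length 2sκ, costing 2sκ ≤ 2κ. -/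
lemma stdObs_tiltBoundary_le {s κ : ℝ} (hs : 0 ≤ s) (hs1 : s ≤ 1) (hκ : 0 ≤ κ)
    {u : EuclideanSpace ℝ (Fin d)} (hu : ‖u‖ = 1) :
    (stdObs d).real (tiltBoundary s κ u) ≤ 3 * κ := by
  set γ : Measure ℝ := gaussianReal 0 1
  set B1 : Set (ℝ × ℝ) := {q | |q.1| ≤ κ}
  set B2 : Set (ℝ × ℝ) := {q | |(|q.2| - s * |q.1|)| ≤ s * κ}
  have hB1 : MeasurableSet B1 := measurableSet_le (by fun_prop) (by fun_prop)
  have hB2 : MeasurableSet B2 := measurableSet_le (by fun_prop) (by fun_prop)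
  have h1 : (γ.prod γ) B1 ≤ ENNReal.ofReal κ := by
    have : B1 = Set.Icc (-κ) κ ×ˢ Set.univ := by ext q; simp [B1, abs_le]
    rw [this, Measure.prod_prod, measure_univ, mul_one]
    refine (gaussianReal_Icc_le _ _).trans_eq ?_
    congr 1; ring
  have h2 : (γ.prod γ) B2 ≤ ENNReal.ofReal (2 * κ) := by
    rw [Measure.prod_apply hB2]
    calc _ ≤ ∫⁻ _ : ℝ, ENNReal.ofReal (2 * κ) ∂γ := by
          refine lintegral_mono fun a => ?_
          have hsub : Prod.mk a ⁻¹' B2 ⊆ Set.Icc (s * |a| - s * κ) (s * |a| + s * κ)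
              ∪ Set.Icc (-(s * |a|) - s * κ) (-(s * |a|) + s * κ) := by
            intro b hb
            simp only [B2, Set.mem_preimage, Set.mem_ofPred_eq] at hb
            have := abs_le.1 hb
            rcases abs_cases b with h | h
            · left; constructor <;> linarith
            · right; constructor <;> linarith
          refine (measure_mono hsub).trans ((measure_union_le _ _).trans ?_)
          refine (add_le_add (gaussianReal_Icc_le _ _) (gaussianReal_Icc_le _ _)).trans ?_
          have hsκ : s * κ ≤ κ := by nlinarith
          have : 0 ≤ s * κ := by positivity
          rw [← ENNReal.ofReal_add (by linarith) (by linarith)]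
          exact ENNReal.ofReal_le_ofReal (by linarith)
      _ = _ := by simp
  have h3 : (stdObs d) (tiltBoundary s κ u) = (γ.prod γ) (B1 ∪ B2) := by
    rw [← stdObs_map_inner hu, Measure.map_apply (by fun_prop) (hB1.union hB2)]
    rfl
  rw [Measure.real, h3]
  refine ENNReal.toReal_le_of_le_ofReal (by positivity) ?_
  refine (measure_union_le _ _).trans ((add_le_add h1 h2).trans_eq ?_)
  rw [← ENNReal.ofReal_add hκ (by positivity)]
  congr 1; ring

/-- Outside the slab |⟨u₀,x⟩| ≤ κ, the numbers ⟨u,x⟩ and ⟨u₀,x⟩ have the same sign. After division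
by them (and up to a common sign) membership says s⟨u,x⟩ ≤ y and non-membership y < s⟨u₀,x⟩, so y
lies within sκ of s⟨u₀,x⟩. -/
lemma mem_tiltBoundary {s κ : ℝ} (hs : 0 ≤ s) {u u₀ : EuclideanSpace ℝ (Fin d)} {z : Obs d}
    (hz : z ∈ tiltSet s u) (hz₀ : z ∉ tiltSet s u₀) (h : |(inner ℝ (u - u₀) z.1 : ℝ)| ≤ κ) :
    z ∈ tiltBoundary s κ u₀ := by
  simp only [tiltSet, tiltBoundary, Set.mem_ofPred_eq, inner_sub_left, not_le] at *
  set a : ℝ := inner ℝ u z.1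
  set a₀ : ℝ := inner ℝ u₀ z.1
  set y := z.2
  by_cases hκ : |a₀| ≤ κ
  · exact Or.inl hκ
  right
  push Not at hκ
  have hab := abs_le.1 h
  rcases abs_cases a₀ with ⟨e, h0⟩ | ⟨e, h0⟩
  · rw [e] at hκ ⊢
    have ha : 0 < a := by linarith
    have ha₀ : 0 < a₀ := by linarith
    have h1 : s * a ≤ y := by
      have : s * a * a ≤ y * a := by nlinarith
      exact le_of_mul_le_mul_right this ha
    have h2 : y < s * a₀ := by
      have : y * a₀ < s * a₀ * a₀ := by nlinarith
      exact lt_of_mul_lt_mul_right this ha₀.le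
    have hy : 0 ≤ y := le_trans (by positivity) h1
    rw [abs_of_nonneg hy, abs_le]
    constructor <;> nlinarith
  · rw [e] at hκ ⊢
    have ha : 0 < -a := by linarith
    have ha₀ : 0 < -a₀ := by linarith
    have h1 : s * (-a) ≤ -y := by
      have : s * (-a) * (-a) ≤ (-y) * (-a) := by nlinarith
      exact le_of_mul_le_mul_right this ha
    have h2 : -y < s * (-a₀) := by
      have : (-y) * (-a₀) < s * (-a₀) * (-a₀) := by nlinarith
      exact lt_of_mul_lt_mul_right this ha₀.le
    have hy : y ≤ 0 := by
      have : 0 ≤ s * (-a) := by positivity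
      linarith
    rw [abs_of_nonpos hy, abs_le]
    constructor <;> nlinarith

/-- A point that changes sides is near the boundary, or else u - u₀ moves its inner product by more
than κ, which Chebyshev's inequality makes rare. -/
lemma stdObs_tiltSet_diff_le {s κ ε : ℝ} (hs : 0 ≤ s) (hs1 : s ≤ 1) (hκ : 0 < κ)
    {u u₀ : EuclideanSpace ℝ (Fin d)} (hu₀ : ‖u₀‖ = 1) (hε : ‖u - u₀‖ ≤ ε) :
    (stdObs d).real (tiltSet s u \ tiltSet s u₀) ≤ 3 * κ + ε ^ 2 / κ ^ 2 := by
  have hsub : tiltSet s u \ tiltSet s u₀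
      ⊆ tiltBoundary s κ u₀ ∪ {z | κ < |(inner ℝ (u - u₀) z.1 : ℝ)|} := by
    rintro z ⟨h1, h2⟩
    by_cases h : |(inner ℝ (u - u₀) z.1 : ℝ)| ≤ κ
    · exact Or.inl (mem_tiltBoundary hs h1 h2 h)
    · exact Or.inr (not_le.1 h)
  refine (measureReal_mono hsub).trans ((measureReal_union_le _ _).trans ?_)
  refine add_le_add (stdObs_tiltBoundary_le hs hs1 hκ.le hu₀) ?_
  refine (stdObs_abs_inner_gt_le _ hκ).trans ?_
  gcongr

lemma integral_sq_indicator_sub_le {s κ ε : ℝ} (hs : 0 ≤ s) (hs1 : s ≤ 1) (hκ : 0 < κ)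
    {u u₀ : EuclideanSpace ℝ (Fin d)} (hu : ‖u‖ = 1) (hu₀ : ‖u₀‖ = 1) (hε : ‖u - u₀‖ ≤ ε) :
    ∫ z, ((tiltSet s u).indicator 1 z - (tiltSet s u₀).indicator 1 z : ℝ) ^ 2 ∂(stdObs d)
      ≤ 2 * (3 * κ + ε ^ 2 / κ ^ 2) := by
  have h1 := stdObs_tiltSet_diff_le hs hs1 hκ hu₀ hε
  have h2 := stdObs_tiltSet_diff_le hs hs1 hκ hu (u := u₀) (ε := ε) (by rwa [norm_sub_rev])
  have hm1 := (measurableSet_tiltSet s u).diff (measurableSet_tiltSet s u₀)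
  have hm2 := (measurableSet_tiltSet s u₀).diff (measurableSet_tiltSet s u)
  have e : ∀ z, ((tiltSet s u).indicator 1 z - (tiltSet s u₀).indicator 1 z : ℝ) ^ 2
      = (tiltSet s u \ tiltSet s u₀).indicator 1 z + (tiltSet s u₀ \ tiltSet s u).indicator 1 z := by
    intro z
    by_cases a : z ∈ tiltSet s u <;> by_cases b : z ∈ tiltSet s u₀ <;> simp [a, b]
  simp_rw [e]
  rw [integral_add, integral_indicator_one hm1, integral_indicator_one hm2]
  · linarith
  · exact (integrable_const (1 : ℝ)).indicator hm1
  · exact (integrable_const (1 : ℝ)).indicator hm2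

end HeterogeneousRegression

namespace HeterogeneousRegression

/-! ### Nets of the unit sphere -/

section Nets

variable {E : Type*} [NormedAddCommGroup E] [NormedSpace ℝ E] [FiniteDimensional ℝ E]

/-- Volume comparison: the balls of radius ε/2 about the points are disjoint and lie in the ball of
radius 1 + ε/2. -/
lemma card_le_of_separated_sphere {ε : ℝ} (hε : 0 < ε) (T : Finset E) (hT : ∀ u ∈ T, ‖u‖ = 1)
    (hsep : ∀ u ∈ T, ∀ v ∈ T, u ≠ v → ε ≤ ‖u - v‖) :
    (T.card : ℝ) ≤ (1 + 2 / ε) ^ Module.finrank ℝ E := by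
  borelize E
  let μ : Measure E := Measure.addHaar
  have hδ : 0 < ε / 2 := by positivity
  have hρ : 0 < 1 + ε / 2 := by positivity
  have D : Set.Pairwise (T : Set E) (Function.onFun Disjoint fun c => Metric.ball (c : E) (ε / 2)) := by
    rintro c hc e he hce
    apply Metric.ball_disjoint_ball
    rw [dist_eq_norm]
    have := hsep c hc e he hce
    linarith
  have hsub : (⋃ c ∈ T, Metric.ball (c : E) (ε / 2)) ⊆ Metric.ball (0 : E) (1 + ε / 2) := by
    refine Set.iUnion₂_subset fun x hx => ?_
    apply Metric.ball_subset_ball'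
    rw [dist_zero_right, hT x hx]; linarith
  have hvol : (T.card : ℝ≥0∞) * ENNReal.ofReal ((ε / 2) ^ Module.finrank ℝ E) * μ (Metric.ball 0 1)
      ≤ ENNReal.ofReal ((1 + ε / 2) ^ Module.finrank ℝ E) * μ (Metric.ball 0 1) :=
    calc _ = μ (⋃ c ∈ T, Metric.ball (c : E) (ε / 2)) := by
          rw [measure_biUnion_finset D fun c _ => measurableSet_ball]
          simp only [μ.addHaar_ball_of_pos _ hδ, Finset.sum_const, nsmul_eq_mul, mul_assoc]
      _ ≤ μ (Metric.ball (0 : E) (1 + ε / 2)) := measure_mono hsub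
      _ = _ := by simp only [μ.addHaar_ball_of_pos _ hρ]
  have hle := (ENNReal.mul_le_mul_iff_left
    (Metric.measure_ball_pos _ _ zero_lt_one).ne' measure_ball_lt_top.ne).1 hvol
  have h := ENNReal.toReal_le_of_le_ofReal (pow_nonneg hρ.le _) hle
  rw [ENNReal.toReal_mul, ENNReal.toReal_natCast, ENNReal.toReal_ofReal (by positivity)] at h
  have hpos : 0 < (ε / 2) ^ Module.finrank ℝ E := by positivity
  rw [← le_div_iff₀ hpos, ← div_pow] at h
  refine h.trans_eq ?_
  congr 1
  field_simp
  ring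

/-- The unit sphere has an `ε`-net of cardinality at most `(3 / ε) ^ dim`. -/
lemma exists_net_sphere (E : Type*) [NormedAddCommGroup E] [NormedSpace ℝ E]
    [FiniteDimensional ℝ E] {ε : ℝ} (hε : 0 < ε) (hε1 : ε ≤ 1) :
    ∃ T : Finset E, (∀ u ∈ T, ‖u‖ = 1) ∧ (∀ u, ‖u‖ = 1 → ∃ v ∈ T, ‖u - v‖ ≤ ε) ∧
      (T.card : ℝ) ≤ (3 / ε) ^ Module.finrank ℝ E := by
  classical
  set A : Set ℕ := {m | ∃ T : Finset E, T.card = m ∧ (∀ u ∈ T, ‖u‖ = 1) ∧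
    ∀ u ∈ T, ∀ v ∈ T, u ≠ v → ε ≤ ‖u - v‖}
  have hne : A.Nonempty := ⟨0, ∅, by simp⟩
  have hbdd : BddAbove A := by
    refine ⟨⌊(1 + 2 / ε) ^ Module.finrank ℝ E⌋₊, ?_⟩
    rintro m ⟨T, rfl, h1, h2⟩
    exact Nat.le_floor (card_le_of_separated_sphere hε T h1 h2)
  -- A separated set of largest cardinality is a net: an uncovered point could be added to it.
  obtain ⟨T, hc, h1, h2⟩ := Nat.sSup_mem hne hbdd
  refine ⟨T, h1, fun u hu => ?_, (card_le_of_separated_sphere hε T h1 h2).trans ?_⟩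
  · by_contra! hcon
    have huT : u ∉ T := fun h => by
      have := hcon u h
      simp at this; linarith
    have : T.card + 1 ∈ A := by
      refine ⟨insert u T, Finset.card_insert_of_notMem huT, ?_, ?_⟩
      · intro v hv
        rcases Finset.mem_insert.1 hv with rfl | hv
        exacts [hu, h1 v hv]
      · intro a ha b hb hab
        rcases Finset.mem_insert.1 ha with ha | ha <;> rcases Finset.mem_insert.1 hb with hb | hb
        · exact absurd (ha.trans hb.symm) hab
        · rw [ha]; exact (hcon b hb).le
        · rw [hb, norm_sub_rev]; exact (hcon a ha).le
        · exact h2 a ha b hb hab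
    have := le_csSup hbdd this
    omega
  · gcongr
    rw [le_div_iff₀ hε, add_mul, div_mul_cancel₀ _ hε.ne']
    linarith

end Nets

lemma measure_exists_mem_le {Ω ι : Type*} [MeasurableSpace Ω] (μ : Measure Ω) (T : Finset ι)
    (F : ι → Set Ω) {a b : ℝ} (hF : ∀ u ∈ T, μ (F u) ≤ ENNReal.ofReal (Real.exp (-a)))
    (hT : (T.card : ℝ) ≤ Real.exp b) :
    μ {x | ∃ u ∈ T, x ∈ F u} ≤ ENNReal.ofReal (Real.exp (b - a)) := by
  have e : {x | ∃ u ∈ T, x ∈ F u} = ⋃ u ∈ T, F u := by ext; simp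
  rw [e]
  refine (measure_biUnion_finset_le T F).trans ((Finset.sum_le_sum hF).trans ?_)
  rw [Finset.sum_const, nsmul_eq_mul, sub_eq_add_neg, Real.exp_add,
    ENNReal.ofReal_mul (Real.exp_pos _).le]
  gcongr
  rw [← ENNReal.ofReal_natCast]
  exact ENNReal.ofReal_le_ofReal hT

variable {d n : ℕ}

/-- A family of nets of the unit sphere, of radius `8⁻ᵏ`. -/
lemma exists_nets (d : ℕ) : ∃ T : ℕ → Finset (EuclideanSpace ℝ (Fin d)),
    (∀ k, ∀ u ∈ T k, ‖u‖ = 1) ∧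
    (∀ k u, ‖u‖ = 1 → ∃ v ∈ T k, ‖u - v‖ ≤ ((8 : ℝ) ^ k)⁻¹) ∧
    ∀ k, ((T k).card : ℝ) ≤ Real.exp (d * (3 * k + 2)) := by
  have h : ∀ k : ℕ, ∃ T : Finset (EuclideanSpace ℝ (Fin d)), (∀ u ∈ T, ‖u‖ = 1) ∧
      (∀ u, ‖u‖ = 1 → ∃ v ∈ T, ‖u - v‖ ≤ ((8 : ℝ) ^ k)⁻¹) ∧
      (T.card : ℝ) ≤ Real.exp (d * (3 * k + 2)) := by
    intro k
    obtain ⟨T, h1, h2, h3⟩ := exists_net_sphere (EuclideanSpace ℝ (Fin d))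
      (ε := ((8 : ℝ) ^ k)⁻¹) (by positivity) (inv_le_one_of_one_le₀ (one_le_pow₀ (by norm_num)))
    refine ⟨T, h1, h2, h3.trans ?_⟩
    rw [finrank_euclideanSpace_fin, mul_comm (d : ℝ), Real.exp_mul, Real.rpow_natCast]
    gcongr
    -- What remains is 3 · 8ᵏ ≤ exp(3k + 2), from 3 ≤ e² and 8 ≤ e³.
    rw [div_inv_eq_mul, Real.exp_add, mul_comm (3 : ℝ) (k : ℝ), Real.exp_nat_mul, mul_comm]
    have e1 := Real.add_one_le_exp (2 : ℝ)
    have e2 : (8 : ℝ) ≤ Real.exp 3 := by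
      have h1 : (2.7 : ℝ) ≤ Real.exp 1 := by have := Real.exp_one_gt_d9; linarith
      have h2 : Real.exp 3 = Real.exp 1 ^ 3 := by rw [← Real.exp_nat_mul]; norm_num
      rw [h2]
      calc (8 : ℝ) ≤ 2.7 ^ 3 := by norm_num
        _ ≤ _ := by gcongr
    gcongr
    linarith
  choose T hT using h
  exact ⟨T, fun k => (hT k).1, fun k => (hT k).2.1, fun k => (hT k).2.2⟩

/-! ### The operator norm of the empirical second moment -/

/-- At a maximizer m of the quadratic form q on the sphere and a net point u near it, q(m) ≤ 2q(u) +
2q(m-u) ≤ 2N + q(m)/32, and the last term is absorbed. -/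
lemma sum_inner_sq_le_of_net {N : ℝ} (I : Finset (Fin n)) (x : Dataset d n)
    (T : Finset (EuclideanSpace ℝ (Fin d)))
    (hT : ∀ u, ‖u‖ = 1 → ∃ v ∈ T, ‖u - v‖ ≤ 1 / 8)
    (h : ∀ u ∈ T, ∑ i ∈ I, (inner ℝ u (x i).1 : ℝ) ^ 2 ≤ N) (v : EuclideanSpace ℝ (Fin d)) :
    ∑ i ∈ I, (inner ℝ v (x i).1 : ℝ) ^ 2 ≤ 4 * N * ‖v‖ ^ 2 := by
  set q : EuclideanSpace ℝ (Fin d) → ℝ := fun v => ∑ i ∈ I, (inner ℝ v (x i).1 : ℝ) ^ 2 with hq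
  have hqc : Continuous q := by fun_prop
  have hsmul : ∀ (c : ℝ) v, q (c • v) = c ^ 2 * q v := by
    intro c v
    simp only [hq, real_inner_smul_left, mul_pow, Finset.mul_sum]
  have hadd : ∀ a b, q (a + b) ≤ 2 * q a + 2 * q b := by
    intro a b
    simp only [hq, Finset.mul_sum, ← Finset.sum_add_distrib]
    refine Finset.sum_le_sum fun i _ => ?_
    rw [inner_add_left]
    nlinarith [sq_nonneg ((inner ℝ a (x i).1 : ℝ) - inner ℝ b (x i).1)]
  have hq0 : ∀ v, 0 ≤ q v := fun v => Finset.sum_nonneg fun i _ => sq_nonneg _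
  rcases eq_or_ne v 0 with rfl | hv
  · simp
  have hvn : 0 < ‖v‖ := norm_pos_iff.2 hv
  have hunit : ‖(‖v‖⁻¹ • v)‖ = 1 := by
    rw [norm_smul, norm_inv, norm_norm, inv_mul_cancel₀ hvn.ne']
  obtain ⟨m, hm, hmax⟩ := (isCompact_sphere (0 : EuclideanSpace ℝ (Fin d)) 1).exists_isMaxOn
    ⟨_, mem_sphere_zero_iff_norm.2 hunit⟩ hqc.continuousOn
  have hm1 : ‖m‖ = 1 := mem_sphere_zero_iff_norm.1 hm
  have hscale : ∀ w, q w ≤ ‖w‖ ^ 2 * q m := by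
    intro w
    rcases eq_or_ne w 0 with rfl | hw
    · simp [hq]
    have hwn : 0 < ‖w‖ := norm_pos_iff.2 hw
    have h1 : ‖(‖w‖⁻¹ • w)‖ = 1 := by
      rw [norm_smul, norm_inv, norm_norm, inv_mul_cancel₀ hwn.ne']
    have h2 : q (‖w‖⁻¹ • w) ≤ q m := hmax (mem_sphere_zero_iff_norm.2 h1)
    calc q w = q (‖w‖ • (‖w‖⁻¹ • w)) := by rw [smul_smul, mul_inv_cancel₀ hwn.ne', one_smul]
      _ = ‖w‖ ^ 2 * q (‖w‖⁻¹ • w) := hsmul _ _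
      _ ≤ _ := by gcongr
  obtain ⟨u, hu, hmu⟩ := hT m hm1
  have h1 : q m ≤ 2 * q u + 2 * q (m - u) := by
    simpa using hadd u (m - u)
  have h2 : q (m - u) ≤ (1 / 8) ^ 2 * q m := (hscale _).trans (by gcongr)
  have h3 : q u ≤ N := h u hu
  have h4 : q m ≤ 4 * N := by nlinarith [hq0 u]
  calc q v ≤ ‖v‖ ^ 2 * q m := hscale v
    _ ≤ ‖v‖ ^ 2 * (4 * N) := by gcongr
    _ = _ := by ring

/-- Chernoff's bound for ⟨u,x⟩²/4 with exponent 1 per observation and deviation 10 per observation;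
44 = 4(1 + 10). -/
lemma sum_inner_sq_tail (I : Finset (Fin n)) {u : EuclideanSpace ℝ (Fin d)} (hu : ‖u‖ = 1) :
    (Measure.pi fun _ : Fin n => stdObs d)
      {x | 44 * (I.card : ℝ) < ∑ i ∈ I, (inner ℝ u (x i).1 : ℝ) ^ 2}
      ≤ ENNReal.ofReal (Real.exp (-(10 * I.card))) := by
  have hb : ∫⁻ z, ENNReal.ofReal (Real.exp ((inner ℝ u z.1 : ℝ) ^ 2 / 4)) ∂(stdObs d)
      ≤ ENNReal.ofReal (Real.exp 1) := by
    have hu' : ‖u‖₊ = 1 := by ext; simpa using hu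
    have h := lintegral_exp_sq_gaussianReal
    have h1 := stdObs_map_inner_fst u
    rw [hu', one_pow] at h1
    rw [← h1, lintegral_map (by fun_prop) (by fun_prop)] at h
    exact h
  refine le_trans (measure_mono ?_) (chernoff (stdObs d) I (by fun_prop) hb (10 * I.card))
  intro x hx
  simp only [Set.mem_ofPred_eq, ← Finset.sum_div] at hx ⊢
  linarith

end HeterogeneousRegression

namespace HeterogeneousRegression

/-! ### Chaining -/

variable {d n : ℕ}

/-- The number of observations with index in `I` that lie in `A`. -/
noncomputable def hits {Z : Type*} (I : Finset (Fin n)) (A : Set Z) (x : Fin n → Z) : ℝ :=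
  ∑ i ∈ I, A.indicator 1 (x i)

lemma hits_mono {Z : Type*} (I : Finset (Fin n)) {A B : Set Z} (h : A ⊆ B) (x : Fin n → Z) :
    hits I A x ≤ hits I B x :=
  Finset.sum_le_sum fun _ _ => Set.indicator_le_indicator_of_subset h (fun _ => zero_le_one) _

lemma hits_union_le {Z : Type*} (I : Finset (Fin n)) (A B : Set Z) (x : Fin n → Z) :
    hits I (A ∪ B) x ≤ hits I A x + hits I B x := by
  rw [hits, hits, hits, ← Finset.sum_add_distrib]
  refine Finset.sum_le_sum fun i _ => ?_
  by_cases h : x i ∈ A <;> by_cases h' : x i ∈ B <;> simp [h, h']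

/-- Chebyshev's inequality for the empirical measure. With the operator norm bound it controls the
last link of the chain for every direction at once, without a net. -/
lemma hits_abs_inner_le (I : Finset (Fin n)) (v : EuclideanSpace ℝ (Fin d)) {κ : ℝ} (hκ : 0 < κ)
    (x : Dataset d n) :
    hits I {z : Obs d | κ < |(inner ℝ v z.1 : ℝ)|} x
      ≤ (∑ i ∈ I, (inner ℝ v (x i).1 : ℝ) ^ 2) / κ ^ 2 := by
  rw [hits, Finset.sum_div]
  refine Finset.sum_le_sum fun i _ => ?_
  by_cases h : x i ∈ {z : Obs d | κ < |(inner ℝ v z.1 : ℝ)|}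
  · rw [Set.indicator_of_mem h, Pi.one_apply, le_div_iff₀ (by positivity), one_mul,
      ← sq_abs (inner ℝ v (x i).1 : ℝ)]
    have : κ < |(inner ℝ v (x i).1 : ℝ)| := h
    gcongr
  · rw [Set.indicator_of_notMem h]; positivity

lemma bernstein_indicator {Ω : Type*} [MeasurableSpace Ω] (P : Measure Ω) [IsProbabilityMeasure P]
    (I : Finset (Fin n)) {A : Set Ω} (hA : MeasurableSet A) {p θ : ℝ} (hp : P.real A ≤ p)
    (hθ : 0 < θ) (hθ1 : θ ≤ 1) (a : ℝ) :
    (Measure.pi fun _ : Fin n => P) {x | I.card * (p + θ * p) + a / θ < hits I A x}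
      ≤ ENNReal.ofReal (Real.exp (-a)) := by
  refine bernstein P I (g := A.indicator 1) (measurable_one.indicator hA) ?_ hθ hθ1 ?_ ?_ a
  · intro ω
    by_cases h : ω ∈ A <;> simp [h]
  · rwa [integral_indicator_one hA]
  · have : ∀ ω, (A.indicator 1 ω : ℝ) ^ 2 = A.indicator 1 ω := by
      intro ω; by_cases h : ω ∈ A <;> simp [h]
    simp_rw [this]
    rwa [integral_indicator_one hA]

section Levels

variable (I : Finset (Fin n)) {s θ a : ℝ}

lemma coarse_tail (hθ : 0 < θ) (hθ1 : θ ≤ 1)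
    {u : EuclideanSpace ℝ (Fin d)} (hu : ‖u‖ = 1) :
    (Measure.pi fun _ : Fin n => stdObs d)
      {x | I.card * (tiltProb s + θ) + a / θ < hits I (tiltSet s u) x}
      ≤ ENNReal.ofReal (Real.exp (-a)) := by
  refine le_trans (measure_mono fun x hx => ?_)
    (bernstein_indicator (stdObs d) I (measurableSet_tiltSet s u) (stdObs_tiltSet s hu).le hθ hθ1 a)
  simp only [Set.mem_ofPred_eq] at hx ⊢
  refine lt_of_le_of_lt ?_ hx
  gcongr
  have := tiltProb_le_one s
  nlinarith

/-- Both sets have the same probability, so the increment is centred. Taking κ = 4⁻ᵏ against the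
step ε = 2 · 8⁻ᵏ bounds its second moment by 2(3κ + ε²/κ²) = 14 · 4⁻ᵏ; the net radii are powers of
1/8 so that this decays like 4⁻ᵏ. -/
lemma increment_tail (hs : 0 ≤ s) (hs1 : s ≤ 1) (hθ : 0 < θ) (hθ1 : θ ≤ 1) (k : ℕ)
    {u u' : EuclideanSpace ℝ (Fin d)} (hu : ‖u‖ = 1) (hu' : ‖u'‖ = 1)
    (h : ‖u' - u‖ ≤ 2 * ((8 : ℝ) ^ k)⁻¹) :
    (Measure.pi fun _ : Fin n => stdObs d)
      {x | I.card * (θ * (14 * ((4 : ℝ) ^ k)⁻¹)) + a / θ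
        < hits I (tiltSet s u') x - hits I (tiltSet s u) x}
      ≤ ENNReal.ofReal (Real.exp (-a)) := by
  have hmeas : Measurable fun z =>
      ((tiltSet s u').indicator 1 z - (tiltSet s u).indicator 1 z : ℝ) :=
    (measurable_one.indicator (measurableSet_tiltSet s u')).sub
      (measurable_one.indicator (measurableSet_tiltSet s u))
  have hb := bernstein (stdObs d) I hmeas (m := 0) (v := 14 * ((4 : ℝ) ^ k)⁻¹) ?_ hθ hθ1 ?_ ?_ a
  · simpa only [hits, Finset.sum_sub_distrib, zero_add] using hb
  · intro z
    by_cases h1 : z ∈ tiltSet s u' <;> by_cases h2 : z ∈ tiltSet s u <;> simp [h1, h2]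
  · rw [integral_sub, integral_indicator_one (measurableSet_tiltSet s u'),
      integral_indicator_one (measurableSet_tiltSet s u), stdObs_tiltSet s hu, stdObs_tiltSet s hu',
      sub_self]
    · exact (integrable_const (1 : ℝ)).indicator (measurableSet_tiltSet s u')
    · exact (integrable_const (1 : ℝ)).indicator (measurableSet_tiltSet s u)
  · refine (integral_sq_indicator_sub_le hs hs1 (κ := ((4 : ℝ) ^ k)⁻¹) (by positivity) hu' hu
      h).trans (le_of_eq ?_)
    have e : (8 : ℝ) ^ k * 8 ^ k = 4 ^ k * 4 ^ k * 4 ^ k := by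
      rw [← mul_pow, ← mul_pow, ← mul_pow]; norm_num
    have h8 : ((8 : ℝ) ^ k)⁻¹ ^ 2 = ((4 : ℝ) ^ k)⁻¹ ^ 3 := by
      rw [inv_pow, inv_pow, sq, e]; ring_nf
    rw [mul_pow, h8]
    field_simp
    ring

end Levels

/-- Deterministic chaining step: control along the nets gives control over the whole sphere. -/
lemma hits_tiltSet_le_of_nets {s : ℝ} (hs : 0 ≤ s) (I : Finset (Fin n)) (x : Dataset d n)
    {T : ℕ → Finset (EuclideanSpace ℝ (Fin d))} (K : ℕ)
    (hcov : ∀ k u, ‖u‖ = 1 → ∃ v ∈ T k, ‖u - v‖ ≤ ((8 : ℝ) ^ k)⁻¹)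
    {m₀ mB mop : ℝ} {m : ℕ → ℝ}
    (h0 : ∀ u ∈ T 0, hits I (tiltSet s u) x ≤ m₀)
    (hk : ∀ k < K, ∀ u ∈ T k, ∀ u' ∈ T (k + 1), ‖u' - u‖ ≤ 2 * ((8 : ℝ) ^ k)⁻¹ →
      hits I (tiltSet s u') x - hits I (tiltSet s u) x ≤ m k)
    (hB : ∀ u ∈ T K, hits I (tiltBoundary s ((4 : ℝ) ^ K)⁻¹ u) x ≤ mB)
    (hop : ∀ v : EuclideanSpace ℝ (Fin d),
      ∑ i ∈ I, (inner ℝ v (x i).1 : ℝ) ^ 2 ≤ mop * ‖v‖ ^ 2) (hmop : 0 ≤ mop)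
    {u : EuclideanSpace ℝ (Fin d)} (hu : ‖u‖ = 1) :
    hits I (tiltSet s u) x
      ≤ m₀ + ∑ k ∈ Finset.range K, m k + mB + mop * ((4 : ℝ) ^ K)⁻¹ := by
  choose! v hv hvu using fun k => hcov k u hu
  have hchain : ∀ j ≤ K, hits I (tiltSet s (v j)) x ≤ m₀ + ∑ k ∈ Finset.range j, m k := by
    intro j
    induction j with
    | zero => intro _; simpa using h0 _ (hv 0)
    | succ j ih =>
      intro hj
      rw [Finset.sum_range_succ]
      have h1 := ih (by omega)
      have h2 := hk j (by omega) _ (hv j) _ (hv (j + 1)) (by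
        have e : v (j + 1) - v j = (u - v j) - (u - v (j + 1)) := by abel
        rw [e]
        refine (norm_sub_le _ _).trans ?_
        have h8 : ((8 : ℝ) ^ (j + 1))⁻¹ ≤ ((8 : ℝ) ^ j)⁻¹ := by
          apply inv_anti₀ (by positivity)
          exact pow_le_pow_right₀ (by norm_num) (by omega)
        have := hvu j
        have := hvu (j + 1)
        linarith)
      linarith
  -- The last link passes from the net point to u itself. Only an upper bound is needed, so one
  -- inclusion suffices.
  have hsub : tiltSet s u ⊆ tiltSet s (v K) ∪ (tiltBoundary s ((4 : ℝ) ^ K)⁻¹ (v K)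
      ∪ {z | ((4 : ℝ) ^ K)⁻¹ < |(inner ℝ (u - v K) z.1 : ℝ)|}) := by
    intro z hz
    by_cases h1 : z ∈ tiltSet s (v K)
    · exact Or.inl h1
    by_cases h2 : |(inner ℝ (u - v K) z.1 : ℝ)| ≤ ((4 : ℝ) ^ K)⁻¹
    · exact Or.inr (Or.inl (mem_tiltBoundary hs hz h1 h2))
    · exact Or.inr (Or.inr (not_le.1 h2))
  have h1 := hits_mono I hsub x
  have h2 := hits_union_le I (tiltSet s (v K)) (tiltBoundary s ((4 : ℝ) ^ K)⁻¹ (v K)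
      ∪ {z | ((4 : ℝ) ^ K)⁻¹ < |(inner ℝ (u - v K) z.1 : ℝ)|}) x
  have h3 := hits_union_le I (tiltBoundary s ((4 : ℝ) ^ K)⁻¹ (v K))
    {z | ((4 : ℝ) ^ K)⁻¹ < |(inner ℝ (u - v K) z.1 : ℝ)|} x
  have h4 : hits I {z : Obs d | ((4 : ℝ) ^ K)⁻¹ < |(inner ℝ (u - v K) z.1 : ℝ)|} x
      ≤ mop * ((4 : ℝ) ^ K)⁻¹ := by
    refine (hits_abs_inner_le I _ (by positivity) x).trans ?_
    rw [div_le_iff₀ (by positivity)]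
    refine (hop _).trans ?_
    rw [mul_assoc]
    gcongr
    calc ‖u - v K‖ ^ 2 ≤ (((8 : ℝ) ^ K)⁻¹) ^ 2 := by gcongr; exact hvu K
      _ = ((4 : ℝ) ^ K)⁻¹ * (((4 : ℝ) ^ K)⁻¹) ^ 2 := by
        rw [← inv_pow, ← inv_pow, ← pow_mul, ← pow_mul, mul_comm K 2, pow_mul, pow_mul, ← mul_pow]
        norm_num
  have h5 := hchain K le_rfl
  have h6 := hB _ (hv K)
  linarith

lemma sum_chaining_weights (K : ℕ) :
    ∑ k ∈ Finset.range K, (7 * (k : ℝ) + 26) * ((2 : ℝ) ^ k)⁻¹ ≤ 66 := by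
  have h : ∑ k ∈ Finset.range K, (7 * (k : ℝ) + 26) * ((2 : ℝ) ^ k)⁻¹
      = 66 - (14 * K + 66) * ((2 : ℝ) ^ K)⁻¹ := by
    induction K with
    | zero => simp
    | succ K ih =>
      rw [Finset.sum_range_succ, ih, pow_succ]
      push_cast
      field_simp
      ring
  rw [h]
  have : 0 ≤ (14 * (K : ℝ) + 66) * ((2 : ℝ) ^ K)⁻¹ := by positivity
  linarith

lemma sum_exp_neg_le (K : ℕ) :
    ∑ k ∈ Finset.range K, Real.exp (-(k + 5 : ℝ)) ≤ 2 * Real.exp (-5) := by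
  have h : ∑ k ∈ Finset.range K, Real.exp (-(k + 5 : ℝ))
      ≤ 2 * Real.exp (-5) - 2 * Real.exp (-(K + 5 : ℝ)) := by
    induction K with
    | zero => simp
    | succ K ih =>
      rw [Finset.sum_range_succ]
      push_cast
      have e : Real.exp (-(K + 1 + 5 : ℝ)) * 2 ≤ Real.exp (-(K + 5 : ℝ)) := by
        have : Real.exp (-(K + 5 : ℝ)) = Real.exp (-(K + 1 + 5 : ℝ)) * Real.exp 1 := by
          rw [← Real.exp_add]; congr 1; ring
        rw [this]
        have := Real.add_one_le_exp (1 : ℝ)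
        gcongr
        linarith
      linarith
  have := Real.exp_pos (-(K + 5 : ℝ))
  linarith

/-- Uniformly over the directions `u`, the empirical frequency of `tiltSet s u` exceeds its
probability by at most a multiple of `√(d / N)`. -/
theorem uniform_deviation (hd : 1 ≤ d) (I : Finset (Fin n)) (hI : d ≤ I.card) {s : ℝ}
    (hs : 0 ≤ s) (hs1 : s ≤ 1) :
    (Measure.pi fun _ : Fin n => stdObs d)
      {x | ∃ u : EuclideanSpace ℝ (Fin d), ‖u‖ = 1 ∧
        I.card * tiltProb s + 900 * √(d * I.card) < hits I (tiltSet s u) x}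
      ≤ ENNReal.ofReal (1 / 20) := by
  obtain ⟨T, hT1, hTcov, hTcard⟩ := exists_nets d
  set N : ℝ := ((I.card : ℕ) : ℝ) with hN
  have hd0 : (1 : ℝ) ≤ d := by exact_mod_cast hd
  have hdN : (d : ℝ) ≤ N := Nat.cast_le.2 hI
  have hN0 : 0 < N := by linarith
  -- Depth of the chain: the first inequality keeps the Bernstein parameter 2ᵏ√(d/N) at most 1 up to
  -- level K; the second makes the remainder N · 4⁻ᴷ at most 4d.
  obtain ⟨K, hK1, hK2⟩ : ∃ K : ℕ, (4 : ℝ) ^ K * d ≤ N ∧ N < 4 ^ (K + 1) * d := by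
    obtain ⟨K, h1, h2⟩ := exists_nat_pow_near (x := N / d) (y := 4)
      (by rw [le_div_iff₀ (by linarith)]; linarith) (by norm_num)
    exact ⟨K, by rwa [le_div_iff₀ (by linarith)] at h1, by rwa [div_lt_iff₀ (by linarith)] at h2⟩
  set R : ℝ := √(d * N) with hR
  have hR0 : 0 < R := Real.sqrt_pos.2 (by positivity)
  have hRR : R * R = d * N := Real.mul_self_sqrt (by positivity)
  have hdR : (d : ℝ) ≤ R := Real.le_sqrt_of_sq_le (by nlinarith)
  set ρ : ℝ := R / N with hρ
  have hρ0 : 0 < ρ := by positivity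
  have hNρ : N * ρ = R := by rw [hρ]; field_simp
  have hdρ : (d : ℝ) / ρ = R := by
    rw [hρ, div_div_eq_mul_div, div_eq_iff hR0.ne', hRR]
  have hρK : ∀ k ≤ K, (2 : ℝ) ^ k * ρ ≤ 1 := by
    intro k hk
    rw [hρ, mul_div_assoc', div_le_one hN0]
    refine le_of_sq_le_sq ?_ hN0.le
    calc ((2 : ℝ) ^ k * R) ^ 2 = 4 ^ k * d * N := by
          rw [mul_pow, sq R, hRR, ← pow_mul, mul_comm k 2, pow_mul]; norm_num; ring
      _ ≤ 4 ^ K * d * N := by gcongr; norm_num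
      _ ≤ N * N := by gcongr
      _ = N ^ 2 := by ring
  -- the levels of the chain
  set a : ℕ → ℝ := fun k => d * (7 * k + 12) with ha
  set m₀ : ℝ := N * (tiltProb s + ρ) + a 0 / ρ with hm₀
  set m : ℕ → ℝ := fun k =>
    N * ((2 : ℝ) ^ k * ρ * (14 * ((4 : ℝ) ^ k)⁻¹)) + a k / ((2 : ℝ) ^ k * ρ) with hm
  set mB : ℝ := N * (3 * ((4 : ℝ) ^ K)⁻¹ + (2 : ℝ) ^ K * ρ * (3 * ((4 : ℝ) ^ K)⁻¹))
    + a K / ((2 : ℝ) ^ K * ρ) with hmB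
  set μ : Measure (Dataset d n) := Measure.pi fun _ : Fin n => stdObs d with hμ
  set F0 : Set (Dataset d n) := {x | ∃ u ∈ T 0, x ∈ {x | m₀ < hits I (tiltSet s u) x}}
  set F : ℕ → Set (Dataset d n) := fun k => {x | ∃ w ∈ (T k ×ˢ T (k + 1)).filter
    (fun w => ‖w.2 - w.1‖ ≤ 2 * ((8 : ℝ) ^ k)⁻¹),
      x ∈ {x | m k < hits I (tiltSet s w.2) x - hits I (tiltSet s w.1) x}}
  set FB : Set (Dataset d n) := {x | ∃ u ∈ T K,
    x ∈ {x | mB < hits I (tiltBoundary s ((4 : ℝ) ^ K)⁻¹ u) x}}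
  set Fop : Set (Dataset d n) := {x | ∃ u ∈ T 1,
    x ∈ {x | 44 * N < ∑ i ∈ I, (inner ℝ u (x i).1 : ℝ) ^ 2}}
  have hF0 : μ F0 ≤ ENNReal.ofReal (Real.exp (-10)) := by
    refine (measure_exists_mem_le μ (T 0) _ (a := a 0) (fun u hu =>
      coarse_tail I hρ0 (by simpa using hρK 0 (Nat.zero_le _)) (hT1 0 u hu)) (hTcard 0)).trans ?_
    refine ENNReal.ofReal_le_ofReal (Real.exp_le_exp.2 ?_)
    simp only [ha]; push_cast; nlinarith
  have hF : ∀ k < K, μ (F k) ≤ ENNReal.ofReal (Real.exp (-(k + 5 : ℝ))) := by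
    intro k hk
    refine (measure_exists_mem_le μ _ _ (a := a k) (b := d * (3 * k + 2) + d * (3 * (k + 1) + 2))
      (fun w hw => ?_) ?_).trans ?_
    · rw [Finset.mem_filter, Finset.mem_product] at hw
      exact increment_tail I hs hs1 (by positivity) (hρK k hk.le) k (hT1 k _ hw.1.1)
        (hT1 (k + 1) _ hw.1.2) hw.2
    · rw [Real.exp_add]
      have h1 : (((T k ×ˢ T (k + 1)).filter
          (fun w => ‖w.2 - w.1‖ ≤ 2 * ((8 : ℝ) ^ k)⁻¹)).card : ℝ)
          ≤ (T k).card * (T (k + 1)).card := by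
        rw [← Nat.cast_mul, ← Finset.card_product]
        exact_mod_cast Finset.card_filter_le _ _
      refine h1.trans ?_
      have h2 := hTcard (k + 1)
      push_cast at h2
      exact mul_le_mul (hTcard k) h2 (by positivity) (Real.exp_pos _).le
    · refine ENNReal.ofReal_le_ofReal (Real.exp_le_exp.2 ?_)
      simp only [ha]
      have : (0 : ℝ) ≤ k := by positivity
      nlinarith
  have hFB : μ FB ≤ ENNReal.ofReal (Real.exp (-10)) := by
    refine (measure_exists_mem_le μ (T K) _ (a := a K) (fun u hu =>
      bernstein_indicator (stdObs d) I (measurableSet_tiltBoundary s _ u)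
        (stdObs_tiltBoundary_le hs hs1 (by positivity) (hT1 K u hu)) (by positivity)
        (hρK K le_rfl) _) (hTcard K)).trans ?_
    refine ENNReal.ofReal_le_ofReal (Real.exp_le_exp.2 ?_)
    simp only [ha]
    have : (0 : ℝ) ≤ K := by positivity
    nlinarith
  have hFop : μ Fop ≤ ENNReal.ofReal (Real.exp (-5)) := by
    refine (measure_exists_mem_le μ (T 1) _ (fun u hu => sum_inner_sq_tail I (hT1 1 u hu))
      (hTcard 1)).trans ?_
    refine ENNReal.ofReal_le_ofReal (Real.exp_le_exp.2 ?_)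
    push_cast
    linarith
  -- the sum of the bounds along the chain
  have hsum : m₀ + ∑ k ∈ Finset.range K, m k + mB + 4 * (44 * N) * ((4 : ℝ) ^ K)⁻¹
      ≤ N * tiltProb s + 900 * R := by
    have hN4 : N * ((4 : ℝ) ^ K)⁻¹ ≤ 4 * R := by
      rw [← div_eq_mul_inv, div_le_iff₀ (by positivity)]
      rw [pow_succ] at hK2
      have : (0 : ℝ) < 4 ^ K := by positivity
      nlinarith
    have e0 : m₀ = N * tiltProb s + 13 * R := by
      have : a 0 / ρ = 12 * R := by simp only [ha, ← hdρ]; push_cast; ring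
      rw [hm₀, this, mul_add, hNρ]; ring
    have ea : ∀ k : ℕ, a k / ((2 : ℝ) ^ k * ρ) = (7 * k + 12) * ((2 : ℝ) ^ k)⁻¹ * R := by
      intro k
      rw [← hdρ]; simp only [ha]; field_simp
    have em : ∀ k, m k = (7 * (k : ℝ) + 26) * ((2 : ℝ) ^ k)⁻¹ * R := by
      intro k
      simp only [hm]
      rw [ea k, ← hNρ]
      have h4 : (4 : ℝ) ^ k = 2 ^ k * 2 ^ k := by rw [← mul_pow]; norm_num
      rw [h4]
      field_simp
      ring
    have hs' : ∑ k ∈ Finset.range K, m k ≤ 66 * R := by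
      simp_rw [em, ← Finset.sum_mul]
      gcongr
      exact sum_chaining_weights K
    have eB : mB ≤ 36 * R := by
      have h1 := hρK K le_rfl
      have h2 : N * (3 * ((4 : ℝ) ^ K)⁻¹ + (2 : ℝ) ^ K * ρ * (3 * ((4 : ℝ) ^ K)⁻¹)) ≤ 24 * R := by
        have h3 : (2 : ℝ) ^ K * ρ * (3 * ((4 : ℝ) ^ K)⁻¹) ≤ 1 * (3 * ((4 : ℝ) ^ K)⁻¹) := by gcongr
        calc _ ≤ N * (3 * ((4 : ℝ) ^ K)⁻¹ + 1 * (3 * ((4 : ℝ) ^ K)⁻¹)) := by gcongr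
          _ = 6 * (N * ((4 : ℝ) ^ K)⁻¹) := by ring
          _ ≤ _ := by linarith
      have h3 : (7 * (K : ℝ) + 12) * ((2 : ℝ) ^ K)⁻¹ ≤ 12 := by
        rw [← div_eq_mul_inv, div_le_iff₀ (by positivity)]
        have := one_add_mul_le_pow (a := (1 : ℝ)) (by norm_num) K
        norm_num at this
        have : (0 : ℝ) ≤ K := by positivity
        linarith
      rw [hmB, ea K]
      nlinarith
    -- In units of R, the coarse level, the increments, the boundary term and the operator norm term
    -- give 13 + 66 + 36 + 4 · 44 · 4 = 819.
    linarith
  have hsub : {x | ∃ u : EuclideanSpace ℝ (Fin d), ‖u‖ = 1 ∧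
        N * tiltProb s + 900 * R < hits I (tiltSet s u) x}
      ⊆ F0 ∪ (⋃ k ∈ Finset.range K, F k) ∪ FB ∪ Fop := by
    rintro x ⟨u, hu, hx⟩
    by_contra hcon
    simp only [Set.mem_union, not_or] at hcon
    obtain ⟨⟨⟨c0, ck⟩, cB⟩, cop⟩ := hcon
    have := hits_tiltSet_le_of_nets hs I x K hTcov (m₀ := m₀) (mB := mB) (mop := 4 * (44 * N))
      (m := m) (fun v hv => ?_) (fun k hk v hv w hw hvw => ?_) (fun v hv => ?_) ?_ (by positivity) hu
    · linarith
    · by_contra h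
      exact c0 ⟨v, hv, not_le.1 h⟩
    · by_contra h
      refine ck (Set.mem_biUnion (Finset.mem_coe.2 (Finset.mem_range.2 hk)) ⟨(v, w), ?_, not_le.1 h⟩)
      exact Finset.mem_filter.2 ⟨Finset.mem_product.2 ⟨hv, hw⟩, hvw⟩
    · by_contra h
      exact cB ⟨v, hv, not_le.1 h⟩
    · refine sum_inner_sq_le_of_net I x (T 1) (fun v hv => ?_) fun v hv => ?_
      · simpa using hTcov 1 v hv
      · by_contra h
        exact cop ⟨v, hv, not_le.1 h⟩
  refine (measure_mono hsub).trans ?_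
  have hU : μ (⋃ k ∈ Finset.range K, F k) ≤ ENNReal.ofReal (2 * Real.exp (-5)) := by
    refine (measure_biUnion_finset_le _ _).trans ((Finset.sum_le_sum fun k hk =>
      hF k (Finset.mem_range.1 hk)).trans ?_)
    rw [← ENNReal.ofReal_sum_of_nonneg fun k _ => (Real.exp_pos _).le]
    exact ENNReal.ofReal_le_ofReal (sum_exp_neg_le K)
  refine (measure_union_le _ _).trans ((add_le_add ((measure_union_le _ _).trans
    (add_le_add ((measure_union_le _ _).trans (add_le_add hF0 hU)) hFB)) hFop).trans ?_)
  rw [← ENNReal.ofReal_add (by positivity) (by positivity),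
    ← ENNReal.ofReal_add (by positivity) (by positivity),
    ← ENNReal.ofReal_add (by positivity) (by positivity)]
  refine ENNReal.ofReal_le_ofReal ?_
  -- The total failure probability 2e⁻¹⁰ + 3e⁻⁵ is at most 5e⁻⁵ ≤ 5/100.
  have h10 : Real.exp (-10) ≤ Real.exp (-5) := Real.exp_le_exp.2 (by norm_num)
  have h5 : Real.exp (-5) ≤ 1 / 100 := by
    rw [Real.exp_neg, one_div]
    apply inv_anti₀ (by norm_num)
    have h1 : (2.7 : ℝ) ≤ Real.exp 1 := by have := Real.exp_one_gt_d9; linarith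
    have h2 : Real.exp 5 = Real.exp 1 ^ 5 := by rw [← Real.exp_nat_mul]; norm_num
    rw [h2]
    calc (100 : ℝ) ≤ 2.7 ^ 5 := by norm_num
      _ ≤ _ := by gcongr
  linarith

end HeterogeneousRegression

namespace HeterogeneousRegression

/-! ### Measurable selection -/

/-- A measurable selection theorem for closed-valued multifunctions that hit every closed ball on a
measurable set. -/
theorem exists_measurable_selection {Z E : Type*} [MeasurableSpace Z] [MetricSpace E]
    [CompleteSpace E] [SecondCountableTopology E] [MeasurableSpace E] [BorelSpace E] [Nonempty E]
    (F : Z → Set E) (hclosed : ∀ z, IsClosed (F z)) (hne : ∀ z, (F z).Nonempty)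
    (hmeas : ∀ q r, MeasurableSet {z | ∃ x ∈ Metric.closedBall q r, x ∈ F z}) :
    ∃ M : Z → E, Measurable M ∧ ∀ z, M z ∈ F z := by
  classical
  set q : ℕ → E := TopologicalSpace.denseSeq E
  have hq : DenseRange q := TopologicalSpace.denseRange_denseSeq E
  set H : ℕ → ℕ → Set Z := fun k j => {z | ∃ x ∈ Metric.closedBall (q j) ((1 / 2) ^ k), x ∈ F z}
  have hH : ∀ k j, MeasurableSet (H k j) := fun k j => hmeas _ _
  -- Stage k is a measurable choice of a dense point within 2⁻ᵏ of F z. Successive stages are kept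
  -- close, so the choices converge, and closedness puts the limit in F z.
  let A : ℕ → Type _ := fun k => {f : Z → ℕ // Measurable f ∧ ∀ z, z ∈ H k (f z)}
  have hnear : ∀ (x : E) (k : ℕ), ∃ j, dist x (q j) < (1 / 2) ^ k := fun x k =>
    hq.exists_dist_lt x (by positivity)
  have base : Nonempty (A 0) := by
    have hex : ∀ z, ∃ j, z ∈ H 0 j := fun z => by
      obtain ⟨x, hx⟩ := hne z
      obtain ⟨j, hj⟩ := hnear x 0
      exact ⟨j, x, Metric.mem_closedBall.2 hj.le, hx⟩
    exact ⟨⟨fun z => Nat.find (hex z), measurable_find hex fun j => hH 0 j,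
      fun z => Nat.find_spec (hex z)⟩⟩
  have step : ∀ (k : ℕ) (f : A k), ∃ g : A (k + 1),
      ∀ z, dist (q (f.1 z)) (q (g.1 z)) ≤ 2 * (1 / 2) ^ k := by
    rintro k ⟨f, hf, hfH⟩
    have hex : ∀ z, ∃ j, z ∈ H (k + 1) j ∧ dist (q (f z)) (q j) ≤ 2 * (1 / 2) ^ k := fun z => by
      obtain ⟨x, hx, hxF⟩ := hfH z
      obtain ⟨j, hj⟩ := hnear x (k + 1)
      refine ⟨j, ⟨x, Metric.mem_closedBall.2 hj.le, hxF⟩, ?_⟩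
      have h1 := Metric.mem_closedBall'.1 hx
      have h2 := dist_triangle (q (f z)) x (q j)
      have h3 : (1 / 2 : ℝ) ^ (k + 1) ≤ (1 / 2) ^ k :=
        pow_le_pow_of_le_one (by norm_num) (by norm_num) (by omega)
      linarith
    refine ⟨⟨fun z => Nat.find (hex z), measurable_find hex fun j => ?_,
      fun z => (Nat.find_spec (hex z)).1⟩, fun z => (Nat.find_spec (hex z)).2⟩
    exact (hH (k + 1) j).inter (hf (t := {i | dist (q i) (q j) ≤ 2 * (1 / 2) ^ k})
      (MeasurableSet.of_discrete))
  choose g hg using step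
  let f : ∀ k, A k := fun k => Nat.rec base.some g k
  have hfs : ∀ k z, dist (q ((f k).1 z)) (q ((f (k + 1)).1 z)) ≤ 2 * (1 / 2) ^ k :=
    fun k z => hg k (f k) z
  have hcauchy : ∀ z, CauchySeq fun k => q ((f k).1 z) := fun z =>
    cauchySeq_of_le_geometric (1 / 2) 2 (by norm_num) fun k => hfs k z
  choose M hM using fun z => cauchySeq_tendsto_of_complete (hcauchy z)
  refine ⟨M, ?_, fun z => ?_⟩
  · refine measurable_of_tendsto_metrizable (f := fun k z => q ((f k).1 z)) (fun k => ?_)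
      (tendsto_pi_nhds.2 hM)
    exact (measurable_of_countable q).comp (f k).2.1
  · choose x hx hxF using fun k => (f k).2.2 z
    refine (hclosed z).mem_of_tendsto (f := x) (b := Filter.atTop) ?_ (Filter.Eventually.of_forall hxF)
    refine (tendsto_iff_of_dist ?_).1 (hM z)
    refine squeeze_zero (fun _ => dist_nonneg) (fun k => Metric.mem_closedBall'.1 (hx k)) ?_
    exact tendsto_pow_atTop_nhds_zero_of_lt_one (by norm_num) (by norm_num)

/-- Projection along a compact factor is a closed map. This gives measurability of conditions
quantified over a sphere or a closed ball. -/
lemma isClosed_exists_mem {X Z : Type*} [TopologicalSpace X] [TopologicalSpace Z] {K : Set X}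
    (hK : IsCompact K) {C : Set (X × Z)} (hC : IsClosed C) :
    IsClosed {z | ∃ x ∈ K, (x, z) ∈ C} := by
  have := isCompact_iff_compactSpace.1 hK
  have h : IsClosed ((fun p : K × Z => (p.1.1, p.2)) ⁻¹' C) := hC.preimage (by fun_prop)
  convert isClosedMap_snd_of_compactSpace _ h using 1
  ext z
  simp

/-! ### The depth function -/

variable {d n : ℕ}

open Classical in
/-- The weighted count whose infimum over the directions `v` is the regression depth. -/
noncomputable def directionalDepth (w : Fin n → ℝ) (η : EuclideanSpace ℝ (Fin d))
    (z : Dataset d n) (v : EuclideanSpace ℝ (Fin d)) : ℝ :=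
  ∑ i, w i * (if 0 ≤ ((z i).2 - inner ℝ η (z i).1) * inner ℝ v (z i).1 then 1 else 0)

lemma regressionDepth_eq (w : Fin n → ℝ) (η : EuclideanSpace ℝ (Fin d)) (z : Dataset d n) :
    regressionDepth w η z = ⨅ v : Metric.sphere (0 : EuclideanSpace ℝ (Fin d)) 1,
      directionalDepth w η z v := rfl

/-- The finitely many values of the regression depth. -/
noncomputable def depthValues (w : Fin n → ℝ) : Finset ℝ :=
  Finset.univ.image fun J : Finset (Fin n) => ∑ i ∈ J, w i

lemma directionalDepth_mem (w : Fin n → ℝ) (η : EuclideanSpace ℝ (Fin d)) (z : Dataset d n)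
    (v : EuclideanSpace ℝ (Fin d)) : directionalDepth w η z v ∈ depthValues w := by
  classical
  refine Finset.mem_image.2 ⟨Finset.univ.filter fun i =>
    0 ≤ ((z i).2 - inner ℝ η (z i).1) * inner ℝ v (z i).1, Finset.mem_univ _, ?_⟩
  rw [directionalDepth, Finset.sum_filter]
  refine Finset.sum_congr rfl fun i _ => ?_
  split_ifs <;> simp

lemma nonempty_sphere (hd : 1 ≤ d) :
    Nonempty (Metric.sphere (0 : EuclideanSpace ℝ (Fin d)) 1) := by
  refine ⟨⟨EuclideanSpace.single ⟨0, hd⟩ 1, ?_⟩⟩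
  simp

lemma finite_range_directionalDepth (w : Fin n → ℝ) (η : EuclideanSpace ℝ (Fin d))
    (z : Dataset d n) : (Set.range fun v : Metric.sphere (0 : EuclideanSpace ℝ (Fin d)) 1 =>
      directionalDepth w η z v).Finite :=
  (depthValues w).finite_toSet.subset (by
    rintro _ ⟨v, rfl⟩; exact directionalDepth_mem w η z v)

lemma regressionDepth_mem (hd : 1 ≤ d) (w : Fin n → ℝ) (η : EuclideanSpace ℝ (Fin d))
    (z : Dataset d n) : regressionDepth w η z ∈ depthValues w := by
  have := nonempty_sphere hd
  obtain ⟨v, hv⟩ := (Set.range_nonempty _).csInf_mem (finite_range_directionalDepth w η z)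
  rw [regressionDepth_eq, iInf, ← hv]
  exact directionalDepth_mem w η z v

/-- In dimension zero the sphere is empty and the real infimum takes its default value 0, whence d ≥
1. -/
lemma le_regressionDepth_iff (hd : 1 ≤ d) {w : Fin n → ℝ} {η : EuclideanSpace ℝ (Fin d)}
    {z : Dataset d n} {a : ℝ} :
    a ≤ regressionDepth w η z ↔
      ∀ v : Metric.sphere (0 : EuclideanSpace ℝ (Fin d)) 1, a ≤ directionalDepth w η z v := by
  have := nonempty_sphere hd
  exact le_ciInf_iff (finite_range_directionalDepth w η z).bddBelow

/-- Because the inequality in the depth is not strict and the weights are nonnegative, each summand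
is upper semicontinuous jointly in the parameter and the data; sums and infima preserve this. -/
lemma isClosed_le_regressionDepth (hd : 1 ≤ d) {w : Fin n → ℝ} (hw : ∀ i, 0 ≤ w i) (a : ℝ) :
    IsClosed {p : EuclideanSpace ℝ (Fin d) × Dataset d n | a ≤ regressionDepth w p.1 p.2} := by
  classical
  simp_rw [le_regressionDepth_iff hd, Set.ofPred_forall]
  refine isClosed_iInter fun v => ?_
  have husc : UpperSemicontinuous fun p : EuclideanSpace ℝ (Fin d) × Dataset d n =>
      directionalDepth w p.1 p.2 v := by
    unfold directionalDepth
    refine upperSemicontinuous_sum fun i _ => ?_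
    have hcl : IsClosed {p : EuclideanSpace ℝ (Fin d) × Dataset d n |
        0 ≤ ((p.2 i).2 - inner ℝ p.1 (p.2 i).1) * inner ℝ v.1 (p.2 i).1} :=
      isClosed_le (by fun_prop) (by fun_prop)
    have h := hcl.upperSemicontinuous_indicator (hw i)
    have e : (fun p : EuclideanSpace ℝ (Fin d) × Dataset d n => w i *
        (if 0 ≤ ((p.2 i).2 - inner ℝ p.1 (p.2 i).1) * inner ℝ v.1 (p.2 i).1 then 1 else 0 : ℝ))
        = {p : EuclideanSpace ℝ (Fin d) × Dataset d n |
          0 ≤ ((p.2 i).2 - inner ℝ p.1 (p.2 i).1) * inner ℝ v.1 (p.2 i).1}.indicator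
            fun _ => w i := by
      ext p
      simp [Set.indicator_apply]
    rw [e]
    exact h
  exact upperSemicontinuous_iff_isClosed_preimage.1 husc a

/-- A measurable maximizer of the regression depth exists. -/
theorem exists_measurable_isTukeyRegression (hd : 1 ≤ d) {w : Fin n → ℝ} (hw : ∀ i, 0 ≤ w i) :
    ∃ M : Dataset d n → EuclideanSpace ℝ (Fin d), Measurable M ∧ IsTukeyRegression w M := by
  have hball : ∀ q r a, MeasurableSet {z : Dataset d n |
      ∃ η ∈ Metric.closedBall (q : EuclideanSpace ℝ (Fin d)) r, a ≤ regressionDepth w η z} :=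
    fun q r a => (isClosed_exists_mem (isCompact_closedBall q r)
      (isClosed_le_regressionDepth hd hw a)).measurableSet
  have hex : ∀ a, MeasurableSet {z : Dataset d n |
      ∃ η : EuclideanSpace ℝ (Fin d), a ≤ regressionDepth w η z} := by
    intro a
    have e : {z : Dataset d n | ∃ η : EuclideanSpace ℝ (Fin d), a ≤ regressionDepth w η z}
        = ⋃ m : ℕ, {z : Dataset d n |
          ∃ η ∈ Metric.closedBall (0 : EuclideanSpace ℝ (Fin d)) m, a ≤ regressionDepth w η z} := by
      ext z
      simp only [Set.mem_ofPred_eq, Set.mem_iUnion, mem_closedBall_zero_iff]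
      constructor
      · rintro ⟨η, h⟩
        obtain ⟨m, hm⟩ := exists_nat_ge ‖η‖
        exact ⟨m, η, hm, h⟩
      · rintro ⟨m, η, _, h⟩
        exact ⟨η, h⟩
    rw [e]
    exact MeasurableSet.iUnion fun m => hball _ _ _
  -- The maximum over the noncompact parameter space is attained because the depth has finitely many
  -- values.
  have hmax : ∀ z : Dataset d n, ∃ η : EuclideanSpace ℝ (Fin d),
      ∀ η', regressionDepth w η' z ≤ regressionDepth w η z := by
    intro z
    have hfin : (Set.range fun η : EuclideanSpace ℝ (Fin d) => regressionDepth w η z).Finite :=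
      (depthValues w).finite_toSet.subset (by
        rintro _ ⟨η, rfl⟩; exact regressionDepth_mem hd w η z)
    obtain ⟨_, ⟨⟨η, rfl⟩, hη⟩⟩ := Set.exists_max_image _ id hfin (Set.range_nonempty _)
    exact ⟨η, fun η' => hη _ ⟨η', rfl⟩⟩
  have hle : ∀ a, MeasurableSet {z : Dataset d n |
      ∀ η : EuclideanSpace ℝ (Fin d), regressionDepth w η z ≤ a} := by
    intro a
    have e : {z : Dataset d n | ∀ η : EuclideanSpace ℝ (Fin d), regressionDepth w η z ≤ a}
        = (⋃ b ∈ (depthValues w).filter (a < ·), {z : Dataset d n |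
          ∃ η : EuclideanSpace ℝ (Fin d), b ≤ regressionDepth w η z})ᶜ := by
      ext z
      simp only [Set.mem_ofPred_eq, Set.mem_compl_iff, Set.mem_iUnion, not_exists, Finset.mem_filter]
      constructor
      · rintro h b ⟨_, hb⟩ η hη
        exact absurd (hη.trans (h η)) (not_le.2 hb)
      · intro h η
        by_contra hcon
        exact h _ ⟨regressionDepth_mem hd w η z, not_le.1 hcon⟩ η le_rfl
    rw [e]
    exact (Finset.measurableSet_biUnion _ fun b _ => hex b).compl
  set F : Dataset d n → Set (EuclideanSpace ℝ (Fin d)) := fun z =>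
    {η | ∀ η', regressionDepth w η' z ≤ regressionDepth w η z}
  have hclosed : ∀ z, IsClosed (F z) := by
    intro z
    simp only [F, Set.ofPred_forall]
    refine isClosed_iInter fun η' => ?_
    exact (isClosed_le_regressionDepth hd hw (regressionDepth w η' z)).preimage
      (f := fun η => (η, z)) (by fun_prop)
  refine exists_measurable_selection F hclosed hmax fun q r => ?_
  -- Splitting by the maximal value a: the ball contains a maximizer exactly when a is reached in
  -- the ball and exceeded nowhere.
  have e : {z : Dataset d n | ∃ η ∈ Metric.closedBall q r, η ∈ F z}
      = ⋃ a ∈ depthValues w, ({z : Dataset d n | ∃ η ∈ Metric.closedBall q r,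
        a ≤ regressionDepth w η z} ∩ {z | ∀ η, regressionDepth w η z ≤ a}) := by
    ext z
    simp only [F, Set.mem_ofPred_eq, Set.mem_iUnion, Set.mem_inter_iff, exists_prop]
    constructor
    · rintro ⟨η, hη, h⟩
      exact ⟨_, regressionDepth_mem hd w η z, ⟨η, hη, le_rfl⟩, h⟩
    · rintro ⟨a, _, ⟨η, hη, h1⟩, h2⟩
      exact ⟨η, hη, fun η' => (h2 η').trans h1⟩
  rw [e]
  exact Finset.measurableSet_biUnion _ fun a _ => (hball q r a).inter (hle a)

end HeterogeneousRegression

namespace HeterogeneousRegression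

open scoped MatrixOrder

/-! ### Whitening -/

variable {d n : ℕ}

/-- The square root of the covariance, as an operator on `ℝ^d`. -/
noncomputable def sqrtCov (S : Matrix (Fin d) (Fin d) ℝ) :
    EuclideanSpace ℝ (Fin d) →L[ℝ] EuclideanSpace ℝ (Fin d) :=
  Matrix.toEuclideanCLM (𝕜 := ℝ) (CFC.sqrt S)

lemma inner_sqrtCov (S : Matrix (Fin d) (Fin d) ℝ) (x y : EuclideanSpace ℝ (Fin d)) :
    (inner ℝ (sqrtCov S x) y : ℝ) = inner ℝ x (sqrtCov S y) := by
  have h : IsSelfAdjoint (sqrtCov S) := (CFC.sqrt_nonneg S).isSelfAdjoint.map _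
  conv_lhs => rw [← h.adjoint_eq]
  rw [ContinuousLinearMap.adjoint_inner_left]

lemma norm_sqrtCov_sq {S : Matrix (Fin d) (Fin d) ℝ} (hS : S.PosDef)
    (x : EuclideanSpace ℝ (Fin d)) :
    ‖sqrtCov S x‖ ^ 2 = (fun i => x i) ⬝ᵥ S.mulVec (fun i => x i) := by
  rw [← real_inner_self_eq_norm_sq, inner_sqrtCov, sqrtCov, ← ContinuousLinearMap.comp_apply,
    ← ContinuousLinearMap.mul_def, ← map_mul, CFC.sqrt_mul_sqrt_self _ hS.posSemidef.nonneg,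
    Matrix.inner_toEuclideanCLM]

lemma sqError_eq {S : Matrix (Fin d) (Fin d) ℝ} (hS : S.PosDef) (b β : EuclideanSpace ℝ (Fin d)) :
    sqError S b β = ‖sqrtCov S (b - β)‖ ^ 2 := (norm_sqrtCov_sq hS _).symm

lemma sqrtCov_injective {S : Matrix (Fin d) (Fin d) ℝ} (hS : S.PosDef) :
    Function.Injective (sqrtCov S) := by
  refine (injective_iff_map_eq_zero _).2 fun x hx => ?_
  by_contra hne
  have hne' : (fun i => x i) ≠ 0 := fun h => hne (by ext i; exact congrFun h i)
  have h1 := hS.dotProduct_mulVec_pos hne'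
  have h2 := norm_sqrtCov_sq hS x
  rw [hx, norm_zero] at h2
  simp only [star_trivial] at h1
  simp at h2
  linarith

/-- The square root of the covariance, as a linear equivalence. -/
noncomputable def sqrtCovEquiv {S : Matrix (Fin d) (Fin d) ℝ} (hS : S.PosDef) :
    EuclideanSpace ℝ (Fin d) ≃L[ℝ] EuclideanSpace ℝ (Fin d) :=
  (LinearEquiv.ofInjectiveEndo (sqrtCov S).toLinearMap (sqrtCov_injective hS)).toContinuousLinearEquiv

@[simp]
lemma sqrtCovEquiv_apply {S : Matrix (Fin d) (Fin d) ℝ} (hS : S.PosDef)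
    (x : EuclideanSpace ℝ (Fin d)) : sqrtCovEquiv hS x = sqrtCov S x := rfl

/-- The observation generated by a standard Gaussian covariate and a standard Gaussian noise. -/
noncomputable def observe (S : Matrix (Fin d) (Fin d) ℝ) (σ : ℝ≥0) (β : EuclideanSpace ℝ (Fin d))
    (z : Obs d) : Obs d :=
  (sqrtCov S z.1, inner ℝ (sqrtCov S z.1) β + σ * z.2)

lemma measurable_observe (S : Matrix (Fin d) (Fin d) ℝ) (σ : ℝ≥0) (β : EuclideanSpace ℝ (Fin d)) :
    Measurable (observe S σ β) := by unfold observe; fun_prop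

lemma gaussianReal_eq_map (m : ℝ) (σ : ℝ≥0) :
    gaussianReal m (σ ^ 2) = (gaussianReal 0 1).map fun x => m + σ * x := by
  have h : (fun x : ℝ => m + σ * x) = (fun x => m + x) ∘ fun x => σ * x := rfl
  rw [h, ← Measure.map_map (by fun_prop) (by fun_prop), gaussianReal_map_const_mul,
    gaussianReal_map_const_add]
  congr 1
  · simp
  · ext; simp

/-- This transfers all probabilities to `stdObs`, which does not involve β, S or σ. -/
lemma cleanLaw_eq_map (S : Matrix (Fin d) (Fin d) ℝ) (σ : ℝ≥0) (β : EuclideanSpace ℝ (Fin d)) :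
    cleanLaw S σ β = (stdObs d).map (observe S σ β) := by
  have hG : multivariateGaussian 0 S
      = (stdGaussian (EuclideanSpace ℝ (Fin d))).map (sqrtCov S) := by
    rw [multivariateGaussian]; simp only [zero_add]; rfl
  ext s hs
  rw [cleanLaw, Measure.compProd_apply hs, hG, lintegral_map
    (Kernel.measurable_kernel_prodMk_left hs) (by fun_prop),
    Measure.map_apply (measurable_observe S σ β) hs, stdObs,
    Measure.prod_apply (measurable_observe S σ β hs)]
  refine lintegral_congr fun g => ?_
  change gaussianReal _ _ _ = _
  rw [gaussianReal_eq_map, Measure.map_apply (by fun_prop) (measurable_prodMk_left hs)]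
  rfl

/-- The inverse of `observe`. -/
noncomputable def unobserve {S : Matrix (Fin d) (Fin d) ℝ} (hS : S.PosDef) (σ : ℝ≥0)
    (β : EuclideanSpace ℝ (Fin d)) (z : Obs d) : Obs d :=
  ((sqrtCovEquiv hS).symm z.1, (z.2 - inner ℝ z.1 β) / σ)

lemma measurable_unobserve {S : Matrix (Fin d) (Fin d) ℝ} (hS : S.PosDef) (σ : ℝ≥0)
    (β : EuclideanSpace ℝ (Fin d)) : Measurable (unobserve hS σ β) := by
  unfold unobserve; fun_prop

lemma unobserve_observe {S : Matrix (Fin d) (Fin d) ℝ} (hS : S.PosDef) {σ : ℝ≥0} (hσ : 0 < σ)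
    (β : EuclideanSpace ℝ (Fin d)) (z : Obs d) : unobserve hS σ β (observe S σ β z) = z := by
  have hσ' : (σ : ℝ) ≠ 0 := by exact_mod_cast hσ.ne'
  ext1
  · simp only [unobserve, observe]
    rw [← sqrtCovEquiv_apply hS, ContinuousLinearEquiv.symm_apply_apply]
  · simp only [unobserve, observe]
    field_simp
    ring

lemma pi_cleanLaw {S : Matrix (Fin d) (Fin d) ℝ} (σ : ℝ≥0) (β : EuclideanSpace ℝ (Fin d)) :
    (Measure.pi fun _ : Fin n => cleanLaw S σ β)
      = (Measure.pi fun _ : Fin n => stdObs d).map fun x i => observe S σ β (x i) := by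
  have hsf : ∀ _ : Fin n, SigmaFinite ((stdObs d).map (observe S σ β)) := fun _ => by
    rw [← cleanLaw_eq_map]; infer_instance
  simp_rw [cleanLaw_eq_map]
  exact (Measure.pi_map_pi (μ := fun _ : Fin n => stdObs d)
    fun _ => (measurable_observe S σ β).aemeasurable).symm

end HeterogeneousRegression

namespace HeterogeneousRegression

/-! ### The upper bound -/

variable {d n : ℕ}

open Classical in
lemma hits_eq_card {Z : Type*} (I : Finset (Fin n)) (A : Set Z) (x : Fin n → Z) :
    hits I A x = ((I.filter fun i => x i ∈ A).card : ℝ) := by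
  rw [hits, Finset.card_filter]
  push_cast
  exact Finset.sum_congr rfl fun i _ => by simp [Set.indicator_apply]

/-- The union over directions is uncountable. Fixing the finite set J of observations that are hit
leaves a closed condition projected along the compact sphere. -/
lemma measurableSet_exists_hits_gt (I : Finset (Fin n)) (s c : ℝ) :
    MeasurableSet {x : Dataset d n | ∃ u : EuclideanSpace ℝ (Fin d), ‖u‖ = 1 ∧
      c < hits I (tiltSet s u) x} := by
  classical
  have e : {x : Dataset d n | ∃ u : EuclideanSpace ℝ (Fin d), ‖u‖ = 1 ∧
      c < hits I (tiltSet s u) x}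
      = ⋃ J ∈ I.powerset.filter (fun J => c < (J.card : ℝ)),
        {x : Dataset d n | ∃ u ∈ Metric.sphere (0 : EuclideanSpace ℝ (Fin d)) 1,
          (u, x) ∈ {p : EuclideanSpace ℝ (Fin d) × Dataset d n |
            ∀ i ∈ J, p.2 i ∈ tiltSet s p.1}} := by
    ext x
    simp only [Set.mem_ofPred_eq, Set.mem_iUnion, Finset.mem_filter, Finset.mem_powerset,
      mem_sphere_zero_iff_norm, exists_prop]
    constructor
    · rintro ⟨u, hu, h⟩
      rw [hits_eq_card] at h
      exact ⟨_, ⟨Finset.filter_subset _ _, h⟩, u, hu, fun i hi => (Finset.mem_filter.1 hi).2⟩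
    · rintro ⟨J, ⟨hJ, hc⟩, u, hu, h⟩
      refine ⟨u, hu, hc.trans_le ?_⟩
      rw [hits_eq_card]
      exact_mod_cast Finset.card_le_card fun i hi => Finset.mem_filter.2 ⟨hJ hi, h i hi⟩
  rw [e]
  refine Finset.measurableSet_biUnion _ fun J _ => IsClosed.measurableSet ?_
  refine isClosed_exists_mem (isCompact_sphere _ _) ?_
  simp only [Set.ofPred_forall]
  refine isClosed_iInter fun i => isClosed_iInter fun _ => ?_
  have h1 : Continuous fun p : EuclideanSpace ℝ (Fin d) × Dataset d n =>
      s * (inner ℝ p.1 (p.2 i).1 : ℝ) ^ 2 := by fun_prop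
  have h2 : Continuous fun p : EuclideanSpace ℝ (Fin d) × Dataset d n =>
      (p.2 i).2 * (inner ℝ p.1 (p.2 i).1 : ℝ) := by fun_prop
  exact isClosed_le h1 h2

lemma clean_deviation (hd : 1 ≤ d) (I : Finset (Fin n)) (hI : d ≤ I.card) {s : ℝ}
    (hs : 0 ≤ s) (hs1 : s ≤ 1) {S : Matrix (Fin d) (Fin d) ℝ} (hS : S.PosDef) {σ : ℝ≥0}
    (hσ : 0 < σ) (β : EuclideanSpace ℝ (Fin d)) :
    (Measure.pi fun _ : Fin n => cleanLaw S σ β)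
      {x | ∃ u : EuclideanSpace ℝ (Fin d), ‖u‖ = 1 ∧ I.card * tiltProb s + 900 * √(d * I.card)
        < hits I (tiltSet s u) fun i => unobserve hS σ β (x i)} ≤ ENNReal.ofReal (1 / 20) := by
  have hm1 : Measurable fun (x : Dataset d n) i => unobserve hS σ β (x i) :=
    measurable_pi_lambda _ fun i => (measurable_unobserve hS σ β).comp (measurable_pi_apply i)
  have hm2 : Measurable fun (x : Dataset d n) i => observe S σ β (x i) :=
    measurable_pi_lambda _ fun i => (measurable_observe S σ β).comp (measurable_pi_apply i)
  have hms := hm1 (measurableSet_exists_hits_gt (d := d) I s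
    (I.card * tiltProb s + 900 * √(d * I.card)))
  rw [Set.preimage_ofPred_eq] at hms
  rw [pi_cleanLaw, Measure.map_apply hm2 hms]
  refine (measure_mono ?_).trans (uniform_deviation hd I hI hs hs1)
  intro x hx
  simpa only [Set.mem_preimage, Set.mem_ofPred_eq, unobserve_observe hS hσ] using hx

/-- Markov's inequality for the number of corrupted observations. -/
lemma corruption_tail (lam : Fin n → unitInterval) (I : Finset (Fin n)) {t a : ℝ}
    (hI : ∀ i ∈ I, (lam i : ℝ) ≤ t) (ha : 20 * (I.card * t) ≤ a) (ha0 : 0 < a) :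
    (Measure.pi fun i => bernoulliMeasure true false (lam i))
      {b : Fin n → Bool | a < hits I {true} b} ≤ ENNReal.ofReal (1 / 20) := by
  classical
  set μ : Measure (Fin n → Bool) := Measure.pi fun i => bernoulliMeasure true false (lam i)
  have hsingle : ∀ i, ∫⁻ b : Fin n → Bool, ENNReal.ofReal (({true} : Set Bool).indicator 1 (b i)) ∂μ
      = ENNReal.ofReal (lam i) := by
    intro i
    have h1 : ∀ b : Fin n → Bool, ENNReal.ofReal (({true} : Set Bool).indicator 1 (b i))
        = ((fun b : Fin n → Bool => b i) ⁻¹' {true}).indicator 1 b := by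
      intro b; by_cases h : b i = true <;> simp [h]
    simp_rw [h1]
    rw [lintegral_indicator_one (measurable_pi_apply i (measurableSet_singleton true)),
      (measurePreserving_eval (fun i => bernoulliMeasure true false (lam i)) i).measure_preimage
        (measurableSet_singleton true).nullMeasurableSet,
      bernoulliMeasure_apply _ (measurableSet_singleton true)]
    simp only [Set.mem_singleton_iff, if_true]
    rw [if_neg (by simp), ENNReal.ofReal]
    congr 1
    ext; simp [(lam i).2.1]
  have hlin : ∫⁻ b : Fin n → Bool, ENNReal.ofReal (hits I {true} b) ∂μ
      ≤ ENNReal.ofReal (I.card * t) := by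
    have h1 : ∀ b : Fin n → Bool, ENNReal.ofReal (hits I {true} b)
        = ∑ i ∈ I, ENNReal.ofReal (({true} : Set Bool).indicator 1 (b i)) := by
      intro b
      rw [hits, ENNReal.ofReal_sum_of_nonneg]
      intro i _
      exact Set.indicator_nonneg (fun _ _ => zero_le_one) _
    simp_rw [h1]
    rw [lintegral_finsetSum _ fun i _ => by fun_prop]
    simp_rw [hsingle]
    rw [← ENNReal.ofReal_sum_of_nonneg fun i _ => (lam i).2.1]
    refine ENNReal.ofReal_le_ofReal ((Finset.sum_le_sum hI).trans_eq ?_)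
    rw [Finset.sum_const, nsmul_eq_mul]
  have hsub : {b : Fin n → Bool | a < hits I {true} b}
      ⊆ {b | ENNReal.ofReal a ≤ ENNReal.ofReal (hits I {true} b)} := fun b hb =>
    ENNReal.ofReal_le_ofReal (le_of_lt hb)
  refine (measure_mono hsub).trans ?_
  refine (meas_ge_le_lintegral_div (measurable_of_countable _).aemeasurable
    (by simpa using ha0) ENNReal.ofReal_ne_top).trans ?_
  refine ENNReal.div_le_of_le_mul (hlin.trans ?_)
  rw [← ENNReal.ofReal_mul (by norm_num)]
  exact ENNReal.ofReal_le_ofReal (by linarith)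

/-- An uncorrupted index contributes the same hit, a corrupted one at most 1, whatever the outlier
is. -/
lemma hits_contaminate_le {Z Z' : Type} (I : Finset (Fin n)) (A : Set Z') (g : Z → Z')
    (p : ((Fin n → Z) × (Fin n → Bool)) × (Fin n → Z)) :
    hits I A (fun i => g (contaminate p i))
      ≤ hits I A (fun i => g (p.1.1 i)) + hits I {true} p.1.2 := by
  rw [hits, hits, hits, ← Finset.sum_add_distrib]
  refine Finset.sum_le_sum fun i _ => ?_
  have h0 : (0 : ℝ) ≤ A.indicator 1 (g (p.1.1 i)) := Set.indicator_nonneg (fun _ _ => zero_le_one) _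
  rcases h : p.1.2 i with _ | _
  · simp [contaminate, h]
  · have h1 : (A.indicator 1 (g (contaminate p i)) : ℝ) ≤ 1 := by
      by_cases hA : g (contaminate p i) ∈ A <;> simp [hA]
    simpa using by linarith

/-- A contaminated sample is bad with at most the probability of bad clean points or too many
corruptions. -/
lemma contaminatedLaw_le {Z : Type} [MeasurableSpace Z] (lam : Fin n → unitInterval)
    (P : Measure Z) [IsProbabilityMeasure P] (κ : Adversary Z n) {E : Set (Fin n → Z)}
    (hE : MeasurableSet E) (A : Set (Fin n → Z)) (B : Set (Fin n → Bool))
    (h : ∀ p, contaminate p ∈ E → p.1.1 ∈ A ∨ p.1.2 ∈ B) :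
    contaminatedLaw lam P κ E ≤ (Measure.pi fun _ : Fin n => P) A
      + (Measure.pi fun i => bernoulliMeasure true false (lam i)) B := by
  have := κ.2
  set ν := (Measure.pi fun _ : Fin n => P).prod
      (Measure.pi fun i => bernoulliMeasure true false (lam i))
  rw [contaminatedLaw, Measure.map_apply measurable_contaminate hE]
  have hsub : contaminate ⁻¹' E ⊆ Prod.fst ⁻¹' (Prod.fst ⁻¹' A ∪ Prod.snd ⁻¹' B) := h
  refine (measure_mono hsub).trans ?_
  have h1 := Measure.le_map_apply (μ := ν ⊗ₘ κ.1) measurable_fst.aemeasurable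
    (Prod.fst ⁻¹' A ∪ Prod.snd ⁻¹' B)
  -- Clean points and indicators have a joint law that does not depend on the adversary, even an
  -- adaptive one.
  have h2 : (ν ⊗ₘ κ.1).map Prod.fst = ν := Measure.fst_compProd ν κ.1
  rw [h2] at h1
  refine h1.trans ((measure_union_le _ _).trans (add_le_add ?_ ?_))
  · have h3 := Measure.le_map_apply (μ := ν) measurable_fst.aemeasurable A
    rwa [show ν.map Prod.fst = _ from Measure.fst_prod] at h3
  · have h3 := Measure.le_map_apply (μ := ν) measurable_snd.aemeasurable B
    rwa [show ν.map Prod.snd = _ from Measure.snd_prod] at h3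

/-- The indices of corruption rate at most `t`. -/
noncomputable def lowRate (lam : Fin n → unitInterval) (t : unitInterval) : Finset (Fin n) :=
  Finset.univ.filter fun i => lam i ≤ t

lemma directionalDepth_thresholdWeight (lam : Fin n → unitInterval) (t : unitInterval)
    (η v : EuclideanSpace ℝ (Fin d)) (z : Dataset d n) :
    directionalDepth (thresholdWeight lam t) η z v
      = hits (lowRate lam t) {o : Obs d | 0 ≤ (o.2 - inner ℝ η o.1) * inner ℝ v o.1} z
        / countLE lam t := by
  classical
  rw [directionalDepth, hits, lowRate, Finset.sum_filter, Finset.sum_div]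
  refine Finset.sum_congr rfl fun i _ => ?_
  simp only [thresholdWeight, Set.indicator_apply, Set.mem_ofPred_eq, Pi.one_apply]
  split_ifs <;> simp

lemma hits_add_hits_compl {Z : Type*} (I : Finset (Fin n)) (A : Set Z) (x : Fin n → Z) :
    hits I A x + hits I Aᶜ x = I.card := by
  rw [hits, hits, ← Finset.sum_add_distrib, Finset.card_eq_sum_ones]
  push_cast
  refine Finset.sum_congr rfl fun i _ => ?_
  by_cases h : x i ∈ A <;> simp [h]

lemma hits_preimage {Z Z' : Type*} (I : Finset (Fin n)) (A : Set Z') (g : Z → Z') (x : Fin n → Z) :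
    hits I (g ⁻¹' A) x = hits I A fun i => g (x i) := by
  simp only [hits]
  exact Finset.sum_congr rfl fun i _ => rfl

/-- On a data set without deviations, every maximizer of the depth is close to the truth. -/
lemma norm_le_of_no_deviation (hd : 1 ≤ d) {lam : Fin n → unitInterval} {t : unitInterval}
    (hN : 0 < countLE lam t)
    {S : Matrix (Fin d) (Fin d) ℝ} (hS : S.PosDef) {σ : ℝ≥0} (hσ : 0 < σ)
    (β b : EuclideanSpace ℝ (Fin d)) {z : Dataset d n} {s e : ℝ} (hs : 0 < s) (hs1 : s ≤ 1)
    (hse : 1800 * e < s * countLE lam t)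
    (h0 : ∀ u : EuclideanSpace ℝ (Fin d), ‖u‖ = 1 → hits (lowRate lam t) (tiltSet 0 u)
      (fun i => unobserve hS σ β (z i)) ≤ countLE lam t * tiltProb 0 + e)
    (h1 : ∀ u : EuclideanSpace ℝ (Fin d), ‖u‖ = 1 → hits (lowRate lam t) (tiltSet s u)
      (fun i => unobserve hS σ β (z i)) ≤ countLE lam t * tiltProb s + e)
    (hb : regressionDepth (thresholdWeight lam t) β z
      ≤ regressionDepth (thresholdWeight lam t) b z) :
    ‖sqrtCov S (b - β)‖ ≤ s * σ := by
  by_contra hcon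
  push Not at hcon
  have hσ' : (0 : ℝ) < σ := by exact_mod_cast hσ
  set N : ℝ := ((countLE lam t : ℕ) : ℝ) with hNdef
  have hN0 : 0 < N := Nat.cast_pos.2 hN
  have hcard : ((lowRate lam t).card : ℝ) = N := rfl
  have hinner : ∀ (v : EuclideanSpace ℝ (Fin d)) (o : Obs d),
      (inner ℝ v o.1 : ℝ) = inner ℝ (sqrtCov S v) (unobserve hS σ β o).1 := by
    intro v o
    rw [inner_sqrtCov, ← sqrtCovEquiv_apply hS]
    simp [unobserve]
  have hres : ∀ o : Obs d, o.2 - inner ℝ β o.1 = σ * (unobserve hS σ β o).2 := by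
    intro o
    simp only [unobserve]
    rw [real_inner_comm]
    field_simp
  -- the depth of the truth
  have hβ : 1 / 2 - e / N ≤ regressionDepth (thresholdWeight lam t) β z := by
    rw [le_regressionDepth_iff hd]
    rintro ⟨v, hv⟩
    have hv0 : v ≠ 0 := by
      rintro rfl; simp at hv
    have hw0 : sqrtCov S v ≠ 0 := fun h => hv0 (sqrtCov_injective hS (by rw [h, map_zero]))
    have hwn : 0 < ‖sqrtCov S v‖ := norm_pos_iff.2 hw0
    set u : EuclideanSpace ℝ (Fin d) := -(‖sqrtCov S v‖⁻¹ • sqrtCov S v) with hu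
    have hu1 : ‖u‖ = 1 := by
      rw [hu, norm_neg, norm_smul, norm_inv, norm_norm, inv_mul_cancel₀ hwn.ne']
    -- An uncounted observation has residual and covariate of strictly opposite signs along v, so it
    -- is hit in the opposite direction; an upper bound on hits of `tiltSet 0` thus bounds the depth
    -- of β from below.
    have hsub : {o : Obs d | 0 ≤ (o.2 - inner ℝ β o.1) * inner ℝ v o.1}ᶜ
        ⊆ unobserve hS σ β ⁻¹' tiltSet 0 u := by
      intro o ho
      simp only [Set.mem_compl_iff, Set.mem_ofPred_eq, not_le, Set.mem_preimage, tiltSet] at ho ⊢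
      rw [hres, hinner] at ho
      rw [hu, inner_neg_left, real_inner_smul_left, zero_mul]
      set h : ℝ := inner ℝ (sqrtCov S v) (unobserve hS σ β o).1
      set ξ := (unobserve hS σ β o).2
      have h2 : ξ * h < 0 := by
        by_contra hc
        have := mul_nonneg hσ'.le (not_lt.1 hc)
        linarith
      have h3 : 0 < ‖sqrtCov S v‖⁻¹ := inv_pos.2 hwn
      nlinarith
    have h2 := hits_mono (lowRate lam t) hsub z
    rw [hits_preimage] at h2
    have h3 := hits_add_hits_compl (lowRate lam t)
      {o : Obs d | 0 ≤ (o.2 - inner ℝ β o.1) * inner ℝ v o.1} z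
    rw [hcard] at h3
    have h4 := h0 u hu1
    have h5 := tiltProb_le (s := 0) le_rfl zero_le_one
    have h6 : N * tiltProb 0 ≤ N * (1 / 2) := by
      apply mul_le_mul_of_nonneg_left _ hN0.le
      linarith
    rw [directionalDepth_thresholdWeight, le_div_iff₀ hN0, sub_mul, div_mul_cancel₀ _ hN0.ne']
    linarith
  -- the depth of a distant point
  set w := sqrtCov S (b - β) with hw
  have hwn : 0 < ‖w‖ := lt_trans (by positivity) hcon
  have hbβ : b - β ≠ 0 := fun h => by rw [hw, h, map_zero, norm_zero] at hwn; exact hwn.false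
  have hbn : 0 < ‖b - β‖ := norm_pos_iff.2 hbβ
  set u : EuclideanSpace ℝ (Fin d) := ‖w‖⁻¹ • w with hu
  have hu1 : ‖u‖ = 1 := by
    rw [hu, norm_smul, norm_inv, norm_norm, inv_mul_cancel₀ hwn.ne']
  have hfar : regressionDepth (thresholdWeight lam t) b z ≤ 1 / 2 - s / 900 + e / N := by
    have hv : ‖b - β‖⁻¹ • (b - β) ∈ Metric.sphere (0 : EuclideanSpace ℝ (Fin d)) 1 := by
      rw [mem_sphere_zero_iff_norm, norm_smul, norm_inv, norm_norm, inv_mul_cancel₀ hbn.ne']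
    have h2 := (le_regressionDepth_iff hd).1
      (le_refl (regressionDepth (thresholdWeight lam t) b z)) ⟨_, hv⟩
    refine h2.trans ?_
    rw [directionalDepth_thresholdWeight, div_le_iff₀ hN0]
    -- With h = ⟨w,g⟩ the residual at b is σξ - h, so being counted means h² ≤ σξh. Since ‖w‖ > sσ,
    -- this implies s‖w‖⁻¹h² ≤ ξh, the tilt condition for u = w/‖w‖.
    have hsub : {o : Obs d | 0 ≤ (o.2 - inner ℝ b o.1) * inner ℝ (‖b - β‖⁻¹ • (b - β)) o.1}
        ⊆ unobserve hS σ β ⁻¹' tiltSet s u := by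
      intro o ho
      simp only [Set.mem_ofPred_eq, Set.mem_preimage, tiltSet] at ho ⊢
      have e1 : o.2 - inner ℝ b o.1 = (o.2 - inner ℝ β o.1) - inner ℝ (b - β) o.1 := by
        rw [inner_sub_left]; ring
      rw [e1, real_inner_smul_left, hres, hinner] at ho
      rw [hu, real_inner_smul_left]
      change 0 ≤ (σ * (unobserve hS σ β o).2 - inner ℝ w (unobserve hS σ β o).1)
        * (‖b - β‖⁻¹ * inner ℝ w (unobserve hS σ β o).1) at ho
      set h : ℝ := inner ℝ w (unobserve hS σ β o).1
      set ξ := (unobserve hS σ β o).2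
      have h3 : 0 ≤ (σ * ξ - h) * h := by
        have h4 : 0 ≤ ‖b - β‖⁻¹ * ((σ * ξ - h) * h) := by linarith
        exact (mul_nonneg_iff_of_pos_left (inv_pos.2 hbn)).1 h4
      have hpos : 0 < ‖w‖⁻¹ := inv_pos.2 hwn
      have h5 : s * σ * ‖w‖⁻¹ ≤ 1 := by
        rw [← div_eq_mul_inv, div_le_one hwn]; exact hcon.le
      have h6 : s * ‖w‖⁻¹ * h ^ 2 ≤ ξ * h := by
        have h7 : s * σ * ‖w‖⁻¹ * h ^ 2 ≤ 1 * h ^ 2 := by gcongr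
        have h8 : σ * (s * ‖w‖⁻¹ * h ^ 2) ≤ σ * (ξ * h) := by nlinarith
        exact le_of_mul_le_mul_left h8 hσ'
      have h9 := mul_le_mul_of_nonneg_left h6 hpos.le
      linarith
    have h3 := hits_mono (lowRate lam t) hsub z
    rw [hits_preimage] at h3
    have h4 := h1 u hu1
    have h6 : N * tiltProb s ≤ N * (1 / 2 - s / 900) :=
      mul_le_mul_of_nonneg_left (tiltProb_le hs.le hs1) hN0.le
    have e2 : (1 / 2 - s / 900 + e / N) * N = N * (1 / 2 - s / 900) + e := by field_simp
    rw [e2]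
    linarith
  have hfin : s / 900 ≤ 2 * (e / N) := by linarith
  rw [mul_div_assoc', le_div_iff₀ hN0] at hfin
  linarith

end HeterogeneousRegression

/-! ### Risk of the thresholded Tukey estimator and existence of optimal thresholds -/

namespace HeterogeneousRegression

variable {d n : ℕ}

/-- The thresholded Tukey regression estimator has error of order `σ² (d / N(t) + t²)`. -/
theorem worstFailure_tukey_le (hd : 1 ≤ d) {lam : Fin n → unitInterval} {t : unitInterval}
    {S : Matrix (Fin d) (Fin d) ℝ} (hS : S.PosDef) {σ : ℝ≥0} (hσ : 0 < σ) {f : ℝ}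
    (hN : 0 < countLE lam t) (hf : f = d / countLE lam t + (t : ℝ) ^ 2)
    (hfc : 1660000 ^ 2 * f ≤ 1)
    {M : Dataset d n → EuclideanSpace ℝ (Fin d)} (hM : IsTukeyRegression (thresholdWeight lam t) M) :
    worstFailure lam S σ M (ENNReal.ofReal (1660000 ^ 2 * σ ^ 2 * f)) ≤ 1 / 5 := by
  set N : ℝ := ((countLE lam t : ℕ) : ℝ) with hNdef
  have hN0 : 0 < N := Nat.cast_pos.2 hN
  have hd0 : (1 : ℝ) ≤ d := by exact_mod_cast hd
  have hdN0 : 0 < (d : ℝ) / N := by positivity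
  have hf0 : 0 < f := by rw [hf]; positivity
  have hdNf : (d : ℝ) / N ≤ f := by rw [hf]; nlinarith [sq_nonneg (t : ℝ)]
  have htf : (t : ℝ) ^ 2 ≤ f := by rw [hf]; linarith
  have hdN : d ≤ countLE lam t := by
    have h1 : (d : ℝ) / N ≤ 1 := by linarith
    rw [div_le_one hN0] at h1
    exact Nat.cast_le.1 h1
  set r : ℝ := √f with hr
  have hr0 : 0 < r := Real.sqrt_pos.2 hf0
  have hrr : r ^ 2 = f := Real.sq_sqrt hf0.le
  have ht : (t : ℝ) ≤ r := Real.le_sqrt_of_sq_le htf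
  have ht0 : 0 ≤ (t : ℝ) := t.2.1
  set R : ℝ := √(d * N) with hR
  have hR0 : 0 < R := Real.sqrt_pos.2 (by positivity)
  have hRr : R ≤ N * r := by
    refine Real.sqrt_le_iff.2 ⟨by positivity, ?_⟩
    rw [mul_pow, hrr]
    rw [div_le_iff₀ hN0] at hdNf
    nlinarith
  set s : ℝ := 1660000 * r with hs
  have hs0 : 0 < s := by positivity
  have hs1 : s ≤ 1 := by
    have : s ^ 2 ≤ 1 := by rw [hs, mul_pow, hrr]; exact hfc
    nlinarith
  -- Markov's inequality at level 1/20 gives the factor 20; adding R keeps the bound positive when t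
  -- = 0. In total e ≤ 921 N r, and 1800 · 921 = 1657800 < 1660000.
  set a : ℝ := 20 * (N * t) + R with ha
  set e : ℝ := 900 * R + a with he
  have hse : 1800 * e < s * N := by
    have h1 : N * t ≤ N * r := by gcongr
    have h2 : 0 < N * r := by positivity
    rw [he, ha, hs]
    nlinarith
  refine iSup₂_le fun β κ => ?_
  set E : ℝ → Set (Dataset d n) := fun s' => {z | ∃ u : EuclideanSpace ℝ (Fin d), ‖u‖ = 1 ∧
    N * tiltProb s' + e < hits (lowRate lam t) (tiltSet s' u) fun i => unobserve hS σ β (z i)}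
  have hm1 : Measurable fun (x : Dataset d n) i => unobserve hS σ β (x i) :=
    measurable_pi_lambda _ fun i => (measurable_unobserve hS σ β).comp (measurable_pi_apply i)
  have hE : ∀ s', MeasurableSet (E s') := fun s' =>
    hm1 (measurableSet_exists_hits_gt (lowRate lam t) s' (N * tiltProb s' + e))
  set A : ℝ → Set (Dataset d n) := fun s' => {x | ∃ u : EuclideanSpace ℝ (Fin d), ‖u‖ = 1 ∧
    N * tiltProb s' + 900 * R < hits (lowRate lam t) (tiltSet s' u) fun i => unobserve hS σ β (x i)}
  -- The failure event sits inside a measurable set independent of M, so M need not be measurable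
  -- and the bound holds for outer measure.
  have hsub : {z | ENNReal.ofReal (1660000 ^ 2 * σ ^ 2 * f) < ENNReal.ofReal (sqError S (M z) β)}
      ⊆ E 0 ∪ E s := by
    intro z hz
    by_contra hcon
    simp only [E, Set.mem_union, Set.mem_ofPred_eq, not_or, not_exists, not_and, not_lt] at hcon
    have h := norm_le_of_no_deviation hd hN hS hσ β (M z) hs0 hs1 hse hcon.1 hcon.2 (hM z β)
    refine absurd hz (not_lt.2 (ENNReal.ofReal_le_ofReal ?_))
    rw [sqError_eq hS]
    calc ‖sqrtCov S (M z - β)‖ ^ 2 ≤ (s * σ) ^ 2 := by gcongr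
      _ = _ := by rw [hs, mul_pow, mul_pow, hrr]; ring
  have hA : ∀ s', 0 ≤ s' → s' ≤ 1 →
      (Measure.pi fun _ : Fin n => cleanLaw S σ β) (A s') ≤ ENNReal.ofReal (1 / 20) :=
    fun s' h0 h1 => clean_deviation hd (lowRate lam t) hdN h0 h1 hS hσ β
  refine (measure_mono hsub).trans ((contaminatedLaw_le lam (cleanLaw S σ β) κ
    ((hE 0).union (hE s)) (A 0 ∪ A s) {b | a < hits (lowRate lam t) {true} b} ?_).trans ?_)
  · intro p hp
    by_contra hcon
    simp only [A, Set.mem_union, Set.mem_ofPred_eq, not_or, not_exists, not_and, not_lt] at hcon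
    obtain ⟨⟨c0, c1⟩, c2⟩ := hcon
    rcases hp with ⟨u, hu, hp⟩ | ⟨u, hu, hp⟩
    · have h1 := hits_contaminate_le (lowRate lam t) (tiltSet 0 u) (unobserve hS σ β) p
      have h2 := c0 u hu
      linarith
    · have h1 := hits_contaminate_le (lowRate lam t) (tiltSet s u) (unobserve hS σ β) p
      have h2 := c1 u hu
      linarith
  · have hc := corruption_tail lam (lowRate lam t) (t := (t : ℝ)) (a := a)
      (fun i hi => (Finset.mem_filter.1 hi).2) (by rw [ha]; change 20 * (N * t) ≤ _; linarith)
      (by positivity)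
    refine (add_le_add ((measure_union_le _ _).trans (add_le_add (hA 0 le_rfl zero_le_one)
      (hA s hs0.le hs1))) hc).trans ?_
    rw [← ENNReal.ofReal_add (by norm_num) (by norm_num),
      ← ENNReal.ofReal_add (by norm_num) (by norm_num)]
    have : (1 / 5 : ℝ≥0∞) = ENNReal.ofReal (1 / 5) := by
      rw [ENNReal.ofReal_div_of_pos (by norm_num)]; simp
    rw [this]
    exact ENNReal.ofReal_le_ofReal (by norm_num)

/-! ### Optimal thresholds -/

/-- Lowering s to the largest rate not exceeding it keeps N(s) and decreases s², so only the
finitely many rates matter. The candidate 1 covers N(s) = 0, where the error is infinite. -/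
lemma exists_isOptimalThreshold (hd : 1 ≤ d) (lam : Fin n → unitInterval) :
    ∃ t : unitInterval, IsOptimalThreshold lam d t := by
  classical
  set A : Finset unitInterval := insert 1 (Finset.univ.image lam) with hA
  have hred : ∀ s, ∃ t ∈ A, thresholdError lam d t ≤ thresholdError lam d s := by
    intro s
    by_cases h : countLE lam s = 0
    · refine ⟨1, Finset.mem_insert_self _ _, ?_⟩
      have : thresholdError lam d s = ⊤ := by
        rw [thresholdError, h, Nat.cast_zero, ENNReal.div_zero (by exact_mod_cast (by omega : d ≠ 0)),
          top_add]
      rw [this]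
      exact le_top
    · have hne : (lowRate lam s).Nonempty := Finset.card_pos.1 (Nat.pos_of_ne_zero h)
      obtain ⟨i, hi, hmax⟩ := (lowRate lam s).exists_max_image lam hne
      have his : lam i ≤ s := (Finset.mem_filter.1 hi).2
      refine ⟨lam i, Finset.mem_insert_of_mem (Finset.mem_image_of_mem _ (Finset.mem_univ i)), ?_⟩
      have hc : countLE lam (lam i) = countLE lam s := by
        refine congrArg Finset.card (Finset.filter_congr fun j _ => ⟨fun hj => hj.trans his,
          fun hj => hmax j (Finset.mem_filter.2 ⟨Finset.mem_univ j, hj⟩)⟩)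
      rw [thresholdError, thresholdError, hc]
      gcongr
      · exact (lam i).2.1
  obtain ⟨t, -, ht⟩ := A.exists_min_image (thresholdError lam d) ⟨1, Finset.mem_insert_self _ _⟩
  refine ⟨t, fun s => ?_⟩
  obtain ⟨t', ht', h⟩ := hred s
  exact (ht t' ht').trans h

lemma effectiveError_eq {lam : Fin n → unitInterval} {t : unitInterval}
    (ht : IsOptimalThreshold lam d t) : effectiveError lam d = thresholdError lam d t :=
  le_antisymm (iInf_le _ t) (le_iInf ht)

lemma thresholdError_eq_ofReal {lam : Fin n → unitInterval} {t : unitInterval}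
    (hN : 0 < countLE lam t) :
    thresholdError lam d t = ENNReal.ofReal (d / countLE lam t + (t : ℝ) ^ 2) := by
  rw [thresholdError, ENNReal.ofReal_add (by positivity) (by positivity),
    ENNReal.ofReal_div_of_pos (by exact_mod_cast hN), ENNReal.ofReal_natCast,
    ENNReal.ofReal_natCast]

lemma countLE_pos_of_thresholdError_ne_top (hd : 1 ≤ d) {lam : Fin n → unitInterval}
    {t : unitInterval} (h : thresholdError lam d t ≠ ⊤) : 0 < countLE lam t := by
  refine Nat.pos_of_ne_zero fun h0 => h ?_
  rw [thresholdError, h0, Nat.cast_zero, ENNReal.div_zero (by exact_mod_cast (by omega : d ≠ 0)),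
    top_add]

end HeterogeneousRegression

namespace HeterogeneousRegression

/-! ### An adversary that hides the clean law -/

section Adversary

variable {Z : Type} [MeasurableSpace Z] {n : ℕ}

lemma lintegral_bernoulliMeasure_bool (p : unitInterval) (f : Bool → ℝ≥0∞) :
    ∫⁻ b, f b ∂(bernoulliMeasure true false p)
      = ENNReal.ofReal p * f true + ENNReal.ofReal (1 - p) * f false := by
  have h1 : ((unitInterval.toNNReal p : ℝ≥0) : ℝ≥0∞) = ENNReal.ofReal p := by
    rw [ENNReal.ofReal]; congr 1; ext; simp [p.2.1]
  have h2 : ((unitInterval.toNNReal (unitInterval.symm p) : ℝ≥0) : ℝ≥0∞)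
      = ENNReal.ofReal (1 - p) := by
    rw [ENNReal.ofReal]; congr 1; ext; simp [p.2.2]
  rw [bernoulliMeasure_def, lintegral_add_measure, lintegral_smul_measure, lintegral_smul_measure,
    lintegral_dirac, lintegral_dirac, ← h1, ← h2]
  rfl

/-- The law of the mixture of a point from `P` and an outlier from `R`. -/
lemma map_mixture (P R : Measure Z) [IsProbabilityMeasure P] [IsProbabilityMeasure R]
    (p : unitInterval) :
    ((P.prod (bernoulliMeasure true false p)).prod R).map
      (fun q : (Z × Bool) × Z => if q.1.2 then q.2 else q.1.1)
      = ENNReal.ofReal p • R + ENNReal.ofReal (1 - p) • P := by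
  have hm : Measurable fun q : (Z × Bool) × Z => if q.1.2 then q.2 else q.1.1 := by
    refine Measurable.ite ?_ (by fun_prop) (by fun_prop)
    have h : Measurable fun q : (Z × Bool) × Z => q.1.2 := by fun_prop
    exact h (measurableSet_singleton true)
  ext s hs
  rw [Measure.map_apply hm hs, Measure.prod_apply (hm hs), lintegral_prod _
    (measurable_measure_prodMk_left (hm hs)).aemeasurable]
  simp_rw [lintegral_bernoulliMeasure_bool]
  have h1 : ∀ x : Z, R (Prod.mk (x, true) ⁻¹' ((fun q : (Z × Bool) × Z =>
      if q.1.2 then q.2 else q.1.1) ⁻¹' s)) = R s := fun x => rfl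
  have h2 : ∀ x : Z, R (Prod.mk (x, false) ⁻¹' ((fun q : (Z × Bool) × Z =>
      if q.1.2 then q.2 else q.1.1) ⁻¹' s)) = s.indicator 1 x := by
    intro x
    by_cases h : x ∈ s <;> simp [Set.preimage, h]
  simp_rw [h1, h2]
  rw [lintegral_add_left measurable_const, lintegral_const_mul _ (measurable_one.indicator hs),
    lintegral_indicator_one hs]
  simp

/-- If `Q` dominates `(1 - lam i) P` for all corruption rates above `t`, some adversary turns those
observations into independent draws from `Q` and leaves the others clean. -/
theorem exists_adversary_hiding (lam : Fin n → unitInterval) (t : unitInterval) (P Q : Measure Z)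
    [IsProbabilityMeasure P] [IsProbabilityMeasure Q]
    (hQ : ∀ i, t < lam i → ENNReal.ofReal (1 - lam i) • P ≤ Q) :
    ∃ κ : Adversary Z n, contaminatedLaw lam P κ
      = Measure.pi fun i => if lam i ≤ t then P else Q := by
  classical
  -- The outlier law at a high rate is (Q - (1 - λᵢ)P)/λᵢ, so that the mixture with the clean law is
  -- exactly Q.
  have hR : ∀ i, ∃ R : Measure Z, IsProbabilityMeasure R ∧
      (t < lam i → ENNReal.ofReal (lam i) • R + ENNReal.ofReal (1 - lam i) • P = Q) := by
    intro i
    by_cases h : t < lam i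
    · have hl : 0 < (lam i : ℝ) := lt_of_le_of_lt t.2.1 h
      have hl0 : ENNReal.ofReal (lam i) ≠ 0 := by simpa using hl
      have hsum : ENNReal.ofReal (lam i) + ENNReal.ofReal (1 - lam i) = 1 := by
        rw [← ENNReal.ofReal_add hl.le (by linarith [(lam i).2.2])]; simp
      set ν := ENNReal.ofReal (1 - lam i) • P
      have hν : IsFiniteMeasure ν := by
        refine ⟨?_⟩
        simp [ν]
      have hsub : Q - ν + ν = Q := Measure.sub_add_cancel_of_le (hQ i h)
      have huniv : (Q - ν) Set.univ = ENNReal.ofReal (lam i) := by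
        have h1 : (Q - ν) Set.univ + ν Set.univ = 1 := by
          rw [← Measure.add_apply, hsub]; exact measure_univ
        have h2 : ν Set.univ = ENNReal.ofReal (1 - lam i) := by simp [ν]
        rw [h2] at h1
        exact (ENNReal.add_left_inj ENNReal.ofReal_ne_top).1 (h1.trans hsum.symm)
      refine ⟨(ENNReal.ofReal (lam i))⁻¹ • (Q - ν), ⟨?_⟩, fun _ => ?_⟩
      · rw [Measure.smul_apply, huniv, smul_eq_mul,
          ENNReal.inv_mul_cancel hl0 ENNReal.ofReal_ne_top]
      · rw [smul_smul, ENNReal.mul_inv_cancel hl0 ENNReal.ofReal_ne_top, one_smul, hsub]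
    · exact ⟨P, inferInstance, fun h' => absurd h' h⟩
  choose R hRp hRQ using hR
  have := hRp
  set B : Fin n → Measure Bool := fun i => bernoulliMeasure true false (lam i)
  -- At low rates the adversary returns the clean point, which makes corruption there invisible.
  set φ : ((Fin n → Z) × (Fin n → Bool)) × (Fin n → Z) → (Fin n → Z) :=
    fun q i => if lam i ≤ t then q.1.1 i else q.2 i with hφ
  have hφm : Measurable φ := by
    refine measurable_pi_lambda _ fun i => ?_
    by_cases h : lam i ≤ t <;> simp only [hφ, h, if_true, if_false] <;> fun_prop
  let κ : Kernel ((Fin n → Z) × (Fin n → Bool)) (Fin n → Z) :=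
    (Kernel.id ×ₖ Kernel.const _ (Measure.pi R)).map φ
  have hκ : IsMarkovKernel κ := Kernel.IsMarkovKernel.map _ hφm
  have hκ_apply : ∀ (w) {s : Set (Fin n → Z)}, MeasurableSet s →
      κ w s = (Measure.pi R) {r | φ (w, r) ∈ s} := by
    intro w s hs
    rw [Kernel.map_apply' _ hφm _ hs, Kernel.prod_apply, Kernel.id_apply, Kernel.const_apply,
      Measure.prod_apply (hφm hs), lintegral_dirac' _ (measurable_measure_prodMk_left (hφm hs))]
    rfl
  refine ⟨⟨κ, hκ⟩, ?_⟩
  -- the coordinatewise description of the observed sample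
  set ψ : Fin n → (Z × Bool) × Z → Z := fun i q =>
    if lam i ≤ t then q.1.1 else if q.1.2 then q.2 else q.1.1 with hψ
  have hψm : ∀ i, Measurable (ψ i) := by
    intro i
    have hm : Measurable fun q : (Z × Bool) × Z => if q.1.2 then q.2 else q.1.1 := by
      refine Measurable.ite ?_ (by fun_prop) (by fun_prop)
      have h : Measurable fun q : (Z × Bool) × Z => q.1.2 := by fun_prop
      exact h (measurableSet_singleton true)
    by_cases h : lam i ≤ t
    · simp only [hψ, h, if_true]; fun_prop
    · simp only [hψ, h, if_false]; exact hm
  have hψmap : ∀ i, (((P.prod (B i)).prod (R i)).map (ψ i)) = if lam i ≤ t then P else Q := by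
    intro i
    by_cases h : lam i ≤ t
    · simp only [hψ, h, if_true]
      have e : (fun q : (Z × Bool) × Z => q.1.1) = Prod.fst ∘ Prod.fst := rfl
      rw [e, ← Measure.map_map measurable_fst measurable_fst]
      rw [show ((P.prod (B i)).prod (R i)).map Prod.fst = P.prod (B i) from Measure.fst_prod]
      exact Measure.fst_prod
    · simp only [hψ, h, if_false]
      rw [map_mixture, hRQ i (not_le.1 h)]
  have he1 := measurePreserving_arrowProdEquivProdArrow Z Bool (Fin n) (fun _ => P) B
  have he2 := measurePreserving_arrowProdEquivProdArrow (Z × Bool) Z (Fin n)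
    (fun i => P.prod (B i)) R
  have he := (he1.prod (MeasurePreserving.id (Measure.pi R))).comp he2
  have hpi : (Measure.pi fun i => (P.prod (B i)).prod (R i)).map (fun q i => ψ i (q i))
      = Measure.pi fun i => if lam i ≤ t then P else Q := by
    have hsf : ∀ i, SigmaFinite (((P.prod (B i)).prod (R i)).map (ψ i)) := fun i => by
      have := Measure.isProbabilityMeasure_map (μ := (P.prod (B i)).prod (R i))
        (hψm i).aemeasurable
      infer_instance
    rw [Measure.pi_map_pi fun i => (hψm i).aemeasurable]
    simp_rw [hψmap]
  rw [← hpi]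
  have hΨ : Measurable fun q : ((Fin n → Z) × (Fin n → Bool)) × (Fin n → Z) =>
      contaminate (q.1, φ q) :=
    measurable_contaminate.comp (measurable_fst.prodMk hφm)
  ext s hs
  rw [contaminatedLaw, Measure.map_apply measurable_contaminate hs,
    Measure.compProd_apply (measurable_contaminate hs)]
  have hstep : ∀ w, κ w (Prod.mk w ⁻¹' (contaminate ⁻¹' s))
      = (Measure.pi R) (Prod.mk w ⁻¹' ((fun q : ((Fin n → Z) × (Fin n → Bool)) × (Fin n → Z) =>
        contaminate (q.1, φ q)) ⁻¹' s)) := by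
    intro w
    rw [hκ_apply w (measurable_prodMk_left (measurable_contaminate hs))]
    rfl
  simp only
  simp_rw [hstep]
  have hψpi : Measurable fun (q : Fin n → (Z × Bool) × Z) i => ψ i (q i) :=
    measurable_pi_lambda _ fun i => (hψm i).comp (measurable_pi_apply i)
  rw [← Measure.prod_apply (hΨ hs), ← he.measure_preimage (hΨ hs).nullMeasurableSet,
    Measure.map_apply hψpi hs]
  congr 1
  have hfun : (fun q : ((Fin n → Z) × (Fin n → Bool)) × (Fin n → Z) => contaminate (q.1, φ q)) ∘
      (Prod.map (MeasurableEquiv.arrowProdEquivProdArrow Z Bool (Fin n)) id ∘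
        MeasurableEquiv.arrowProdEquivProdArrow (Z × Bool) Z (Fin n))
      = fun q i => ψ i (q i) := by
    ext q i
    change (if (q i).1.2 then (if lam i ≤ t then (q i).1.1 else (q i).2) else (q i).1.1)
      = if lam i ≤ t then (q i).1.1 else if (q i).1.2 then (q i).2 else (q i).1.1
    split_ifs <;> rfl
  rw [← hfun]
  rfl

end Adversary

end HeterogeneousRegression

namespace HeterogeneousRegression

/-! ### Hellinger affinity -/

lemma pi_withDensity {α : Type*} [MeasurableSpace α] {n : ℕ} (ν : Fin n → Measure α)
    [∀ i, SigmaFinite (ν i)] (p : Fin n → α → ℝ≥0∞) (hp : ∀ i, Measurable (p i))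
    [∀ i, SigmaFinite ((ν i).withDensity (p i))] :
    Measure.pi (fun i => (ν i).withDensity (p i))
      = (Measure.pi ν).withDensity fun x => ∏ i, p i (x i) := by
  classical
  refine Measure.pi_eq fun s hs => ?_
  have hsm : MeasurableSet (Set.univ.pi s) := MeasurableSet.univ_pi hs
  rw [withDensity_apply _ hsm, ← lintegral_indicator hsm]
  have e : ∀ x : Fin n → α, (Set.univ.pi s).indicator (fun x => ∏ i, p i (x i)) x
      = ∏ i, (s i).indicator (p i) (x i) := by
    intro x
    by_cases h : x ∈ Set.univ.pi s
    · rw [Set.indicator_of_mem h]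
      exact Finset.prod_congr rfl fun i _ => (Set.indicator_of_mem (h i (Set.mem_univ i)) _).symm
    · rw [Set.indicator_of_notMem h]
      simp only [Set.mem_pi, Set.mem_univ, true_imp_iff, not_forall] at h
      obtain ⟨i, hi⟩ := h
      exact (Finset.prod_eq_zero (Finset.mem_univ i) (Set.indicator_of_notMem hi _)).symm
  simp_rw [e]
  rw [lintegral_pi_prod ν _ fun i => (hp i).indicator (hs i)]
  refine Finset.prod_congr rfl fun i _ => ?_
  rw [lintegral_indicator (hs i), withDensity_apply _ (hs i)]

/-- The Hellinger affinity of two densities. -/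
noncomputable def affinity {α : Type*} [MeasurableSpace α] (ν : Measure α) (p q : α → ℝ≥0∞) :
    ℝ≥0∞ :=
  ∫⁻ x, (p x * q x) ^ (1 / 2 : ℝ) ∂ν

lemma affinity_pi {α : Type*} [MeasurableSpace α] {n : ℕ} (ν : Fin n → Measure α)
    [∀ i, SigmaFinite (ν i)] (p q : Fin n → α → ℝ≥0∞) (hp : ∀ i, Measurable (p i))
    (hq : ∀ i, Measurable (q i)) :
    affinity (Measure.pi ν) (fun x => ∏ i, p i (x i)) (fun x => ∏ i, q i (x i))
      = ∏ i, affinity (ν i) (p i) (q i) := by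
  unfold affinity
  rw [← lintegral_pi_prod ν (fun i a => (p i a * q i a) ^ (1 / 2 : ℝ))
    fun i => ((hp i).mul (hq i)).pow_const _]
  refine lintegral_congr fun x => ?_
  rw [← Finset.prod_mul_distrib, ENNReal.prod_rpow_of_nonneg (by norm_num)]

/-- The Cauchy–Schwarz inequality on A. -/
lemma setLIntegral_sqrt_le {α : Type*} [MeasurableSpace α] (ν : Measure α) {p q : α → ℝ≥0∞}
    (hp : Measurable p) (hq : Measurable q) {A : Set α} (hA : MeasurableSet A) :
    ∫⁻ x in A, (p x * q x) ^ (1 / 2 : ℝ) ∂ν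
      ≤ (ν.withDensity p A) ^ (1 / 2 : ℝ) * (ν.withDensity q A) ^ (1 / 2 : ℝ) := by
  have h := ENNReal.lintegral_mul_le_Lp_mul_Lq (ν.restrict A) Real.HolderConjugate.two_two
    (f := fun x => p x ^ (1 / 2 : ℝ)) (g := fun x => q x ^ (1 / 2 : ℝ))
    (hp.pow_const _).aemeasurable (hq.pow_const _).aemeasurable
  simp only [← ENNReal.rpow_mul] at h
  norm_num at h
  rw [withDensity_apply _ hA, withDensity_apply _ hA]
  refine le_trans (le_of_eq (lintegral_congr fun x => ?_)) h
  rw [ENNReal.mul_rpow_of_nonneg _ _ (by norm_num)]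

/-- Two hypotheses of large affinity cannot be tested reliably. -/
lemma affinity_sq_le {α : Type*} [MeasurableSpace α] (ν : Measure α) {p q : α → ℝ≥0∞}
    (hp : Measurable p) (hq : Measurable q) [IsProbabilityMeasure (ν.withDensity p)]
    [IsProbabilityMeasure (ν.withDensity q)] {A : Set α} (hA : MeasurableSet A) :
    (affinity ν p q).toReal ^ 2
      ≤ 2 * ((ν.withDensity p).real A + (ν.withDensity q).real Aᶜ) := by
  set μ := ν.withDensity p
  set μ' := ν.withDensity q
  -- Cauchy–Schwarz on A and on its complement, keeping one factor on each piece and bounding the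
  -- other by 1.
  have h1 : affinity ν p q ≤ (μ A) ^ (1 / 2 : ℝ) + (μ' Aᶜ) ^ (1 / 2 : ℝ) := by
    rw [affinity, ← lintegral_add_compl _ hA]
    refine add_le_add ((setLIntegral_sqrt_le ν hp hq hA).trans ?_)
      ((setLIntegral_sqrt_le ν hp hq hA.compl).trans ?_)
    · calc _ ≤ (μ A) ^ (1 / 2 : ℝ) * 1 := by
            gcongr
            exact ENNReal.rpow_le_one prob_le_one (by norm_num)
        _ = _ := mul_one _
    · calc _ ≤ 1 * (μ' Aᶜ) ^ (1 / 2 : ℝ) := by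
            gcongr
            exact ENNReal.rpow_le_one prob_le_one (by norm_num)
        _ = _ := one_mul _
  have h2 : (affinity ν p q).toReal ≤ √(μ.real A) + √(μ'.real Aᶜ) := by
    have h3 := ENNReal.toReal_mono (by finiteness) h1
    rw [ENNReal.toReal_add (by finiteness) (by finiteness), ← ENNReal.toReal_rpow,
      ← ENNReal.toReal_rpow, ← Real.sqrt_eq_rpow, ← Real.sqrt_eq_rpow] at h3
    exact h3
  have h4 := Real.sq_sqrt (measureReal_nonneg (μ := μ) (s := A))
  have h5 := Real.sq_sqrt (measureReal_nonneg (μ := μ') (s := Aᶜ))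
  calc (affinity ν p q).toReal ^ 2 ≤ (√(μ.real A) + √(μ'.real Aᶜ)) ^ 2 := by gcongr
    _ ≤ _ := by nlinarith [sq_nonneg (√(μ.real A) - √(μ'.real Aᶜ))]

/-! ### Densities of the regression model -/

variable {d n : ℕ}

/-- The reference measure for the densities of the clean laws. -/
noncomputable def refMeasure (S : Matrix (Fin d) (Fin d) ℝ) : Measure (Obs d) :=
  (multivariateGaussian 0 S).prod volume

instance (S : Matrix (Fin d) (Fin d) ℝ) : SigmaFinite (refMeasure S) := by
  unfold refMeasure; infer_instance

/-- The density of the clean law. -/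
noncomputable def cleanDensity (σ : ℝ≥0) (β : EuclideanSpace ℝ (Fin d)) (z : Obs d) : ℝ≥0∞ :=
  gaussianPDF (inner ℝ z.1 β) (σ ^ 2) z.2

lemma measurable_cleanDensity (σ : ℝ≥0) (β : EuclideanSpace ℝ (Fin d)) :
    Measurable (cleanDensity σ β) := by
  unfold cleanDensity
  exact measurable_uncurry_gaussianPDF.comp
    (f := fun z : Obs d => ((inner ℝ z.1 β : ℝ), σ ^ 2, z.2)) (by fun_prop)

lemma cleanLaw_eq_withDensity (S : Matrix (Fin d) (Fin d) ℝ) {σ : ℝ≥0} (hσ : 0 < σ)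
    (β : EuclideanSpace ℝ (Fin d)) :
    cleanLaw S σ β = (refMeasure S).withDensity (cleanDensity σ β) := by
  ext s hs
  rw [cleanLaw, Measure.compProd_apply hs, withDensity_apply _ hs, ← lintegral_indicator hs,
    refMeasure, lintegral_prod _ ((measurable_cleanDensity σ β).indicator hs).aemeasurable]
  refine lintegral_congr fun x => ?_
  change gaussianReal _ _ _ = _
  rw [gaussianReal_apply _ (by positivity), ← lintegral_indicator (measurable_prodMk_left hs)]
  rfl

lemma multivariateGaussian_map_inner (S : Matrix (Fin d) (Fin d) ℝ)
    (v : EuclideanSpace ℝ (Fin d)) :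
    (multivariateGaussian 0 S).map (fun x => inner ℝ x v)
      = gaussianReal 0 (‖sqrtCov S v‖₊ ^ 2) := by
  have hG : multivariateGaussian 0 S
      = (stdGaussian (EuclideanSpace ℝ (Fin d))).map (sqrtCov S) := by
    rw [multivariateGaussian]; simp only [zero_add]; rfl
  rw [hG, Measure.map_map (by fun_prop) (by fun_prop), ← stdGaussian_map_inner]
  congr 1
  ext g
  rw [Function.comp_apply, inner_sqrtCov, real_inner_comm]

lemma integrable_sq_gaussianReal (v : ℝ≥0) :
    Integrable (fun x : ℝ => x ^ 2) (gaussianReal 0 v) :=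
  (memLp_id_gaussianReal 2).integrable_sq

lemma integral_sq_gaussianReal (v : ℝ≥0) : ∫ x, x ^ 2 ∂(gaussianReal 0 v) = v := by
  have h := variance_id_gaussianReal (μ := 0) (v := v)
  rw [variance_eq_integral aemeasurable_id] at h
  simpa using h

/-- Completing the square: (y-a)² + (y-b)² = 2(y - (a+b)/2)² + (a-b)²/2. -/
lemma sqrt_mul_gaussianPDF {σ : ℝ≥0} (hσ : 0 < σ) (a b y : ℝ) :
    (gaussianPDF a (σ ^ 2) y * gaussianPDF b (σ ^ 2) y) ^ (1 / 2 : ℝ)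
      = ENNReal.ofReal (Real.exp (-(a - b) ^ 2 / (8 * σ ^ 2)))
        * gaussianPDF ((a + b) / 2) (σ ^ 2) y := by
  have hσ' : (0 : ℝ) < σ := by exact_mod_cast hσ
  have key : gaussianPDFReal a (σ ^ 2) y * gaussianPDFReal b (σ ^ 2) y
      = (Real.exp (-(a - b) ^ 2 / (8 * σ ^ 2)) * gaussianPDFReal ((a + b) / 2) (σ ^ 2) y) ^ 2 := by
    simp only [gaussianPDFReal]
    push_cast
    set C := (√(2 * Real.pi * (σ : ℝ) ^ 2))⁻¹
    have e : ∀ u v w z : ℝ, u + v = 2 * w + 2 * z →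
        C * Real.exp u * (C * Real.exp v) = (Real.exp w * (C * Real.exp z)) ^ 2 := by
      intro u v w z h
      have h1 : Real.exp u * Real.exp v = (Real.exp w * Real.exp z) ^ 2 := by
        rw [← Real.exp_add, ← Real.exp_add, ← Real.exp_nat_mul]
        congr 1; push_cast; linarith
      calc _ = C ^ 2 * (Real.exp u * Real.exp v) := by ring
        _ = _ := by rw [h1]; ring
    apply e
    field_simp
    ring
  rw [gaussianPDF, gaussianPDF, gaussianPDF, ← ENNReal.ofReal_mul (gaussianPDFReal_nonneg _ _ _),
    key, ← ENNReal.ofReal_mul (Real.exp_pos _).le,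
    ENNReal.ofReal_rpow_of_nonneg (sq_nonneg _) (by norm_num), ← Real.sqrt_eq_rpow,
    Real.sqrt_sq (mul_nonneg (Real.exp_pos _).le (gaussianPDFReal_nonneg _ _ _))]

/-- Given the covariate x, the affinity is exp(-⟨x,β-β'⟩²/(8σ²)) ≥ 1 - ⟨x,β-β'⟩²/(8σ²). The mean of
⟨x,β-β'⟩² is ‖Σ^{1/2}(β-β')‖². -/
lemma le_affinity_cleanDensity (S : Matrix (Fin d) (Fin d) ℝ) {σ : ℝ≥0} (hσ : 0 < σ)
    (β β' : EuclideanSpace ℝ (Fin d)) :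
    ENNReal.ofReal (1 - ‖sqrtCov S (β - β')‖ ^ 2 / (8 * σ ^ 2))
      ≤ affinity (refMeasure S) (cleanDensity σ β) (cleanDensity σ β') := by
  have hm : Measurable fun z => (cleanDensity σ β z * cleanDensity σ β' z) ^ (1 / 2 : ℝ) :=
    ((measurable_cleanDensity σ β).mul (measurable_cleanDensity σ β')).pow_const _
  rw [affinity, refMeasure, lintegral_prod _ hm.aemeasurable]
  simp only [cleanDensity, sqrt_mul_gaussianPDF hσ]
  have hσ2 : σ ^ 2 ≠ 0 := by positivity
  have h1 : ∀ x : EuclideanSpace ℝ (Fin d), ∫⁻ y, ENNReal.ofReal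
      (Real.exp (-((inner ℝ x β : ℝ) - inner ℝ x β') ^ 2 / (8 * σ ^ 2)))
        * gaussianPDF (((inner ℝ x β : ℝ) + inner ℝ x β') / 2) (σ ^ 2) y
      = ENNReal.ofReal (Real.exp (-((inner ℝ x (β - β') : ℝ)) ^ 2 / (8 * σ ^ 2))) := by
    intro x
    rw [lintegral_const_mul _ (measurable_gaussianPDF _ _), lintegral_gaussianPDF_eq_one _ hσ2,
      mul_one, inner_sub_right]
  simp_rw [h1]
  have h2 : ∫⁻ x, ENNReal.ofReal (Real.exp (-((inner ℝ x (β - β') : ℝ)) ^ 2 / (8 * σ ^ 2)))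
        ∂(multivariateGaussian 0 S)
      = ∫⁻ r, ENNReal.ofReal (Real.exp (-r ^ 2 / (8 * σ ^ 2)))
        ∂(gaussianReal 0 (‖sqrtCov S (β - β')‖₊ ^ 2)) := by
    rw [← multivariateGaussian_map_inner, lintegral_map (by fun_prop) (by fun_prop)]
  rw [h2]
  set v : ℝ≥0 := ‖sqrtCov S (β - β')‖₊ ^ 2 with hv
  have hint : Integrable (fun r : ℝ => Real.exp (-r ^ 2 / (8 * σ ^ 2))) (gaussianReal 0 v) := by
    refine Integrable.of_bound (by fun_prop) 1 (Filter.Eventually.of_forall fun r => ?_)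
    rw [Real.norm_eq_abs, abs_of_pos (Real.exp_pos _), Real.exp_le_one_iff, neg_div]
    have : 0 ≤ r ^ 2 / (8 * (σ : ℝ) ^ 2) := by positivity
    linarith
  rw [← ofReal_integral_eq_lintegral_ofReal hint (Filter.Eventually.of_forall fun r =>
    (Real.exp_pos _).le)]
  refine ENNReal.ofReal_le_ofReal ?_
  have hI2 := (integrable_sq_gaussianReal v).div_const (8 * (σ : ℝ) ^ 2)
  have e : 1 - ‖sqrtCov S (β - β')‖ ^ 2 / (8 * (σ : ℝ) ^ 2)
      = ∫ r, (1 - r ^ 2 / (8 * (σ : ℝ) ^ 2)) ∂(gaussianReal 0 v) := by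
    rw [integral_sub (integrable_const _) hI2, integral_div, integral_sq_gaussianReal]
    simp [hv]
  rw [e]
  refine integral_mono ((integrable_const _).sub hI2) hint fun r => ?_
  have := Real.add_one_le_exp (-r ^ 2 / (8 * (σ : ℝ) ^ 2))
  rw [neg_div] at this ⊢
  simp only
  linarith

end HeterogeneousRegression

namespace HeterogeneousRegression

/-! ### Assouad's lemma -/

/-- Flip one coordinate of a vertex of the hypercube. -/
def flipAt {k : ℕ} (j : Fin k) (ω : Fin k → Bool) : Fin k → Bool := Function.update ω j (!ω j)

lemma flipAt_involutive {k : ℕ} (j : Fin k) : Function.Involutive (flipAt j) := by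
  intro ω
  ext i
  by_cases h : i = j
  · subst h; simp [flipAt]
  · simp [flipAt, h]

/-- Double counting of wrong coordinates. At each vertex the expected number is at most ck + ka by
`hfail`; pairing ω with its flip in coordinate j shows that the error probability at j averages at
least ρ/2 over the vertices. -/
lemma assouad {α : Type*} [MeasurableSpace α] {k : ℕ} (hk : 1 ≤ k)
    (μ : (Fin k → Bool) → Measure α) [∀ ω, IsProbabilityMeasure (μ ω)]
    (T : α → Fin k → Bool) (hT : ∀ j, Measurable fun z => T z j) {ρ c a : ℝ} (hc : 0 ≤ c)
    (htest : ∀ ω j (A : Set α), MeasurableSet A → ρ ≤ (μ ω).real A + (μ (flipAt j ω)).real Aᶜ)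
    (hfail : ∀ ω, (μ ω).real
      {z | c * k < ((Finset.univ.filter fun j => T z j ≠ ω j).card : ℝ)} ≤ a) :
    ρ / 2 ≤ c + a := by
  have hk0 : (0 : ℝ) < k := by exact_mod_cast hk
  set D : (Fin k → Bool) → Fin k → Set α := fun ω j => {z | T z j ≠ ω j}
  have hD : ∀ ω j, MeasurableSet (D ω j) := fun ω j =>
    hT j (MeasurableSet.of_discrete (s := {b | b ≠ ω j}))
  have hrow : ∀ ω, ∑ j, (μ ω).real (D ω j) ≤ c * k + k * a := by
    intro ω
    set F : Set α := {z | c * k < ((Finset.univ.filter fun j => T z j ≠ ω j).card : ℝ)} with hFdef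
    have hcard : ∀ z, ((Finset.univ.filter fun j => T z j ≠ ω j).card : ℝ)
        = ∑ j, (D ω j).indicator 1 z := by
      intro z
      rw [Finset.card_filter]
      push_cast
      refine Finset.sum_congr rfl fun j _ => ?_
      by_cases h : T z j = ω j <;> simp [D, h]
    have hsm : Measurable fun z => ∑ j, (D ω j).indicator (1 : α → ℝ) z :=
      Finset.measurable_sum _ fun j _ => measurable_one.indicator (hD ω j)
    have hF : MeasurableSet F := by
      rw [hFdef]
      simp_rw [hcard]
      exact measurableSet_lt measurable_const hsm
    have hint : ∀ j, Integrable ((D ω j).indicator (1 : α → ℝ)) (μ ω) := fun j =>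
      (integrable_const (1 : ℝ)).indicator (hD ω j)
    have h1 : ∑ j, (μ ω).real (D ω j) = ∫ z, ∑ j, (D ω j).indicator (1 : α → ℝ) z ∂(μ ω) := by
      rw [integral_finsetSum _ fun j _ => hint j]
      exact Finset.sum_congr rfl fun j _ => (integral_indicator_one (hD ω j)).symm
    have hFint : Integrable (F.indicator (1 : α → ℝ)) (μ ω) :=
      (integrable_const (1 : ℝ)).indicator hF
    have h2 : ∫ z, ∑ j, (D ω j).indicator (1 : α → ℝ) z ∂(μ ω)
        ≤ ∫ z, (c * k + k * F.indicator (1 : α → ℝ) z) ∂(μ ω) := by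
      refine integral_mono (integrable_finsetSum _ fun j _ => hint j)
        ((integrable_const _).add (hFint.const_mul _)) fun z => ?_
      simp only
      rw [← hcard]
      by_cases hz : z ∈ F
      · rw [Set.indicator_of_mem hz]
        have : ((Finset.univ.filter fun j => T z j ≠ ω j).card : ℝ) ≤ k := by
          exact_mod_cast (Finset.card_le_univ _).trans_eq (Fintype.card_fin k)
        have : 0 ≤ c * k := by positivity
        simp only [Pi.one_apply]
        linarith
      · rw [Set.indicator_of_notMem hz]
        have := not_lt.1 (show ¬ (c * k < _) from hz)
        linarith
    rw [h1]
    refine h2.trans ?_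
    rw [integral_add (integrable_const _) (hFint.const_mul _), integral_const_mul (k : ℝ),
      integral_indicator_one hF, integral_const, probReal_univ, one_smul]
    have := hfail ω
    gcongr
  have hcol : ∀ j, (Fintype.card (Fin k → Bool) : ℝ) * ρ ≤ 2 * ∑ ω, (μ ω).real (D ω j) := by
    intro j
    have hperm : ∑ ω, (μ (flipAt j ω)).real (D (flipAt j ω) j) = ∑ ω, (μ ω).real (D ω j) :=
      Equiv.sum_comp (flipAt_involutive j).toPerm fun ω => (μ ω).real (D ω j)
    -- A Boolean guess is wrong for the flipped vertex exactly when it is right for ω, so the errors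
    -- of a pair are those of one test.
    have hcompl : ∀ ω, D (flipAt j ω) j = (D ω j)ᶜ := by
      intro ω
      ext z
      simp only [D, flipAt, Function.update_self, Set.mem_ofPred_eq, Set.mem_compl_iff, ne_eq,
        not_not]
      cases T z j <;> cases ω j <;> simp
    calc (Fintype.card (Fin k → Bool) : ℝ) * ρ = ∑ _ω : Fin k → Bool, ρ := by
          rw [Finset.sum_const, nsmul_eq_mul]; rfl
      _ ≤ ∑ ω, ((μ ω).real (D ω j) + (μ (flipAt j ω)).real (D (flipAt j ω) j)) := by
          refine Finset.sum_le_sum fun ω _ => ?_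
          rw [hcompl]
          exact htest ω j _ (hD ω j)
      _ = _ := by rw [Finset.sum_add_distrib, hperm]; ring
  have hC : (0 : ℝ) < Fintype.card (Fin k → Bool) := by exact_mod_cast Fintype.card_pos
  have h1 : (k : ℝ) * (Fintype.card (Fin k → Bool) * ρ)
      ≤ 2 * (Fintype.card (Fin k → Bool) * (c * k + k * a)) := by
    calc (k : ℝ) * (Fintype.card (Fin k → Bool) * ρ)
        = ∑ _j : Fin k, (Fintype.card (Fin k → Bool) : ℝ) * ρ := by
          rw [Finset.sum_const, nsmul_eq_mul, Finset.card_univ, Fintype.card_fin]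
      _ ≤ ∑ j, 2 * ∑ ω, (μ ω).real (D ω j) := Finset.sum_le_sum fun j _ => hcol j
      _ = 2 * ∑ ω, ∑ j, (μ ω).real (D ω j) := by rw [← Finset.mul_sum, Finset.sum_comm]
      _ ≤ 2 * ∑ _ω : Fin k → Bool, (c * k + k * a) := by
          gcongr with ω
          exact hrow ω
      _ = _ := by rw [Finset.sum_const, nsmul_eq_mul]; rfl
  have h2 : (k * Fintype.card (Fin k → Bool) : ℝ) * ρ
      ≤ (k * Fintype.card (Fin k → Bool)) * (2 * (c + a)) := by nlinarith
  have := le_of_mul_le_mul_left h2 (by positivity)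
  linarith

/-! ### A law that dominates all hypotheses -/

variable {d n : ℕ}

/-- An upper envelope of the Gaussian densities of variance `v` and mean in `[-a, a]`. -/
noncomputable def envelope (v : ℝ≥0) (a y : ℝ) : ℝ≥0∞ := gaussianPDF 0 v (max (|y| - a) 0)

lemma gaussianPDF_le_envelope (v : ℝ≥0) {m a : ℝ} (h : |m| ≤ a) (y : ℝ) :
    gaussianPDF m v y ≤ envelope v a y := by
  refine ENNReal.ofReal_le_ofReal ?_
  simp only [gaussianPDFReal]
  rw [sub_zero]
  have h1 : max (|y| - a) 0 ≤ |y - m| := by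
    refine max_le ?_ (abs_nonneg _)
    have := abs_sub_abs_le_abs_sub y m
    linarith
  have h2 : max (|y| - a) 0 ^ 2 ≤ (y - m) ^ 2 :=
    sq_le_sq.2 (by rwa [abs_of_nonneg (le_max_right _ _)])
  gcongr

/-- The envelope consists of the two Gaussian halves moved apart by 2a, of total mass 1, and a
plateau on [-a,a] of height 1/√(2πσ²) ≤ 1/(2σ), of mass at most a/σ. -/
lemma lintegral_envelope_le {σ : ℝ≥0} (hσ : 0 < σ) {a : ℝ} (ha : 0 ≤ a) :
    ∫⁻ y, envelope (σ ^ 2) a y ≤ 1 + ENNReal.ofReal (a / σ) := by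
  have hσ' : (0 : ℝ) < σ := by exact_mod_cast hσ
  have hσ2 : σ ^ 2 ≠ 0 := by positivity
  set g : ℝ → ℝ≥0∞ := gaussianPDF 0 (σ ^ 2)
  have hg : Measurable g := measurable_gaussianPDF _ _
  have hpos : Measurable ((Set.Ioi (0 : ℝ)).indicator g) := hg.indicator measurableSet_Ioi
  have hneg : Measurable ((Set.Iio (0 : ℝ)).indicator g) := hg.indicator measurableSet_Iio
  have hcen : Measurable ((Set.Icc (-a) a).indicator fun _ : ℝ => ENNReal.ofReal (1 / (2 * σ))) :=
    measurable_const.indicator measurableSet_Icc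
  have hpt : ∀ y, envelope (σ ^ 2) a y ≤ (Set.Icc (-a) a).indicator
      (fun _ => ENNReal.ofReal (1 / (2 * σ))) y
      + ((Set.Ioi (0 : ℝ)).indicator g (y - a) + (Set.Iio (0 : ℝ)).indicator g (y + a)) := by
    intro y
    by_cases h1 : y ∈ Set.Icc (-a) a
    · rw [Set.indicator_of_mem h1]
      refine le_add_right ?_
      refine ENNReal.ofReal_le_ofReal ?_
      have h2 : max (|y| - a) 0 = 0 := max_eq_right (by have := abs_le.2 h1; linarith)
      rw [h2]
      simp only [gaussianPDFReal]
      push_cast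
      have h3 : 2 * (σ : ℝ) ≤ √(2 * Real.pi * σ ^ 2) := by
        refine Real.le_sqrt_of_sq_le ?_
        have := Real.pi_gt_three
        nlinarith [sq_nonneg (σ : ℝ)]
      rw [one_div]
      simp only [sub_self, ne_eq, OfNat.ofNat_ne_zero, not_false_eq_true, zero_pow, neg_zero,
        zero_div, Real.exp_zero, mul_one]
      exact inv_anti₀ (by positivity) h3
    · rcases lt_or_ge a y with h2 | h2
      · have e : max (|y| - a) 0 = y - a := by
          rw [abs_of_pos (by linarith)]; exact max_eq_left (by linarith)
        rw [envelope, e, Set.indicator_of_mem (show y - a ∈ Set.Ioi (0 : ℝ) from sub_pos.2 h2)]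
        exact le_add_left (le_add_right le_rfl)
      · have h3 : y < -a := by
          by_contra h; exact h1 ⟨not_lt.1 h, h2⟩
        have e : max (|y| - a) 0 = -(y + a) := by
          rw [abs_of_neg (by linarith)]
          rw [max_eq_left (by linarith)]; ring
        have e2 : gaussianPDF 0 (σ ^ 2) (-(y + a)) = g (y + a) := by
          simp only [g, gaussianPDF, gaussianPDFReal, sub_zero, neg_sq]
        rw [envelope, e, e2, Set.indicator_of_mem (show y + a ∈ Set.Iio (0 : ℝ) by
          simp only [Set.mem_Iio]; linarith)]
        exact le_add_left (le_add_left le_rfl)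
  refine (lintegral_mono hpt).trans ?_
  rw [lintegral_add_left hcen, lintegral_add_left (show Measurable fun y =>
      (Set.Ioi (0 : ℝ)).indicator g (y - a) from hpos.comp (measurable_id.sub_const a)),
    lintegral_sub_right_eq_self (fun y => (Set.Ioi (0 : ℝ)).indicator g y) a,
    lintegral_add_right_eq_self (fun y => (Set.Iio (0 : ℝ)).indicator g y) a,
    ← lintegral_add_left hpos, lintegral_indicator_const measurableSet_Icc, Real.volume_Icc, add_comm]
  refine add_le_add ?_ (le_of_eq ?_)
  · rw [← lintegral_gaussianPDF_eq_one 0 hσ2]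
    refine lintegral_mono fun y => ?_
    rcases lt_trichotomy y 0 with h | h | h
    · simp [h, h.le, g]
    · simp [h]
    · simp [h, h.le, g]
  · rw [← ENNReal.ofReal_mul (by positivity)]
    congr 1
    field_simp
    ring

/-- A single law that dominates a fraction `1 - t` of every clean law whose regression function is
bounded by `a`. -/
lemma exists_dominating_law (S : Matrix (Fin d) (Fin d) ℝ) {σ : ℝ≥0} (hσ : 0 < σ) {t : ℝ}
    (ht : 0 ≤ t) {a : EuclideanSpace ℝ (Fin d) → ℝ} (ham : Measurable a) (ha : ∀ x, 0 ≤ a x)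
    (hat : ∫⁻ x, ENNReal.ofReal (a x / σ) ∂(multivariateGaussian 0 S) ≤ ENNReal.ofReal t) :
    ∃ Q : Measure (Obs d), IsProbabilityMeasure Q ∧
      ∀ β : EuclideanSpace ℝ (Fin d), (∀ x, |(inner ℝ x β : ℝ)| ≤ a x) → ∀ l : ℝ, t ≤ l →
        ENNReal.ofReal (1 - l) • cleanLaw S σ β ≤ Q := by
  set g : Obs d → ℝ≥0∞ := fun z => envelope (σ ^ 2) (a z.1) z.2 with hg
  have hgm : Measurable g := by
    refine (measurable_gaussianPDF 0 (σ ^ 2)).comp ?_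
    have h1 : Measurable fun z : Obs d => a z.1 := ham.comp measurable_fst
    have h2 : Measurable fun z : Obs d => |z.2| := by fun_prop
    exact (h2.sub h1).max measurable_const
  have hle : ∀ β : EuclideanSpace ℝ (Fin d), (∀ x, |(inner ℝ x β : ℝ)| ≤ a x) →
      ∀ z, cleanDensity σ β z ≤ g z := fun β hβ z => gaussianPDF_le_envelope _ (hβ z.1) _
  set m : ℝ≥0∞ := (refMeasure S).withDensity g Set.univ with hm
  have hmono : ∀ β : EuclideanSpace ℝ (Fin d), (∀ x, |(inner ℝ x β : ℝ)| ≤ a x) →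
      cleanLaw S σ β ≤ (refMeasure S).withDensity g := fun β hβ => by
    rw [cleanLaw_eq_withDensity S hσ]
    exact withDensity_mono (Filter.Eventually.of_forall (hle β hβ))
  have hm1 : 1 ≤ m := by
    have h := hmono 0 (fun x => by simpa using ha x) Set.univ
    rwa [measure_univ] at h
  have hmt : m ≤ ENNReal.ofReal (1 + t) := by
    rw [hm, withDensity_apply _ MeasurableSet.univ, Measure.restrict_univ, refMeasure,
      lintegral_prod _ hgm.aemeasurable]
    calc _ ≤ ∫⁻ x, (1 + ENNReal.ofReal (a x / σ)) ∂(multivariateGaussian 0 S) :=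
          lintegral_mono fun x => lintegral_envelope_le hσ (ha x)
      _ = 1 + ∫⁻ x, ENNReal.ofReal (a x / σ) ∂(multivariateGaussian 0 S) := by
          rw [lintegral_add_left measurable_const]; simp
      _ ≤ 1 + ENNReal.ofReal t := by gcongr
      _ = _ := by rw [ENNReal.ofReal_add zero_le_one ht, ENNReal.ofReal_one]
  have hm0 : m ≠ 0 := (lt_of_lt_of_le zero_lt_one hm1).ne'
  have hmtop : m ≠ ⊤ := (lt_of_le_of_lt hmt ENNReal.ofReal_lt_top).ne
  refine ⟨m⁻¹ • (refMeasure S).withDensity g, ⟨?_⟩, fun β hβ l hl => ?_⟩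
  · rw [Measure.smul_apply, smul_eq_mul, ← hm, ENNReal.inv_mul_cancel hm0 hmtop]
  -- The envelope has mass m ≤ 1 + t, and (1 - t)(1 + t) ≤ 1.
  · have hlm : ENNReal.ofReal (1 - l) ≤ m⁻¹ := by
      rw [ENNReal.le_inv_iff_mul_le]
      calc ENNReal.ofReal (1 - l) * m ≤ ENNReal.ofReal (1 - t) * ENNReal.ofReal (1 + t) := by
            gcongr
        _ = ENNReal.ofReal ((1 - t) * (1 + t)) := (ENNReal.ofReal_mul' (by linarith)).symm
        _ ≤ 1 := by
            rw [← ENNReal.ofReal_one]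
            exact ENNReal.ofReal_le_ofReal (by nlinarith [sq_nonneg t])
    intro s
    simp only [Measure.smul_apply, smul_eq_mul]
    exact mul_le_mul' hlm (hmono β hβ s)

end HeterogeneousRegression

namespace HeterogeneousRegression

/-! ### The lower bound -/

variable {d n k : ℕ}

/-- The `j`-th whitened coordinate direction. -/
noncomputable def whitenedDir {S : Matrix (Fin d) (Fin d) ℝ} (hS : S.PosDef) (hk : k ≤ d)
    (j : Fin k) : EuclideanSpace ℝ (Fin d) :=
  (sqrtCovEquiv hS).symm (EuclideanSpace.single (Fin.castLE hk j) 1)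

lemma sqrtCov_whitenedDir {S : Matrix (Fin d) (Fin d) ℝ} (hS : S.PosDef) (hk : k ≤ d) (j : Fin k) :
    sqrtCov S (whitenedDir hS hk j) = EuclideanSpace.single (Fin.castLE hk j) 1 := by
  rw [← sqrtCovEquiv_apply hS, whitenedDir, ContinuousLinearEquiv.apply_symm_apply]

/-- The coefficient vectors of the hypotheses in the lower bound. -/
noncomputable def vertexCoef {S : Matrix (Fin d) (Fin d) ℝ} (hS : S.PosDef) (hk : k ≤ d) (δ : ℝ)
    (ω : Fin k → Bool) : EuclideanSpace ℝ (Fin d) :=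
  ∑ j, (if ω j then δ else -δ) • whitenedDir hS hk j

lemma sqrtCov_vertexCoef_apply {S : Matrix (Fin d) (Fin d) ℝ} (hS : S.PosDef) (hk : k ≤ d) (δ : ℝ)
    (ω : Fin k → Bool) (j : Fin k) :
    sqrtCov S (vertexCoef hS hk δ ω) (Fin.castLE hk j) = if ω j then δ else -δ := by
  rw [vertexCoef, map_sum]
  simp only [map_smul, sqrtCov_whitenedDir]
  rw [WithLp.ofLp_sum, Finset.sum_apply, Finset.sum_eq_single j]
  · rw [WithLp.ofLp_smul, Pi.smul_apply, smul_eq_mul, PiLp.single_apply, if_pos rfl, mul_one]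
  · intro i _ hij
    have : Fin.castLE hk j ≠ Fin.castLE hk i := fun h => hij (Fin.castLE_injective hk h).symm
    rw [WithLp.ofLp_smul, Pi.smul_apply, smul_eq_mul, PiLp.single_apply, if_neg this, mul_zero]
  · simp

lemma vertexCoef_sub_flipAt {S : Matrix (Fin d) (Fin d) ℝ} (hS : S.PosDef) (hk : k ≤ d) (δ : ℝ)
    (ω : Fin k → Bool) (j : Fin k) :
    ‖sqrtCov S (vertexCoef hS hk δ ω - vertexCoef hS hk δ (flipAt j ω))‖ ^ 2 = 4 * δ ^ 2 := by
  have e : vertexCoef hS hk δ ω - vertexCoef hS hk δ (flipAt j ω)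
      = (if ω j then 2 * δ else -(2 * δ)) • whitenedDir hS hk j := by
    rw [vertexCoef, vertexCoef, ← Finset.sum_sub_distrib, Finset.sum_eq_single j]
    · rw [← sub_smul]
      congr 1
      cases h : ω j <;> simp [flipAt, h] <;> ring
    · intro i _ hij
      simp [flipAt, hij]
    · simp
  rw [e, map_smul, sqrtCov_whitenedDir, norm_smul, mul_pow, PiLp.norm_single,
    norm_one, Real.norm_eq_abs, sq_abs]
  split_ifs <;> ring

lemma abs_inner_vertexCoef_le {S : Matrix (Fin d) (Fin d) ℝ} (hS : S.PosDef) (hk : k ≤ d) {δ : ℝ}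
    (hδ : 0 ≤ δ) (ω : Fin k → Bool) (x : EuclideanSpace ℝ (Fin d)) :
    |(inner ℝ x (vertexCoef hS hk δ ω) : ℝ)| ≤ ∑ j, δ * |(inner ℝ x (whitenedDir hS hk j) : ℝ)| := by
  rw [vertexCoef, inner_sum]
  refine (Finset.abs_sum_le_sum_abs _ _).trans (Finset.sum_le_sum fun j _ => ?_)
  rw [real_inner_smul_right, abs_mul]
  gcongr
  split_ifs
  · rw [abs_of_nonneg hδ]
  · rw [abs_neg, abs_of_nonneg hδ]

lemma lintegral_abs_gaussianReal_le :
    ∫⁻ x, ENNReal.ofReal |x| ∂(gaussianReal 0 1) ≤ 1 := by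
  have hI := (integrable_sq_gaussianReal 1)
  have h1 : Integrable (fun x : ℝ => (1 + x ^ 2) / 2) (gaussianReal 0 1) :=
    ((integrable_const _).add hI).div_const 2
  calc _ ≤ ∫⁻ x : ℝ, ENNReal.ofReal ((1 + x ^ 2) / 2) ∂(gaussianReal 0 1) := by
        refine lintegral_mono fun x => ENNReal.ofReal_le_ofReal ?_
        nlinarith [sq_nonneg (|x| - 1), sq_abs x]
    _ = ENNReal.ofReal (∫ x : ℝ, (1 + x ^ 2) / 2 ∂(gaussianReal 0 1)) :=
        (ofReal_integral_eq_lintegral_ofReal h1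
          (Filter.Eventually.of_forall fun x => by positivity)).symm
    _ = 1 := by
        rw [integral_div, integral_add (integrable_const _) hI, integral_sq_gaussianReal]
        norm_num

/-- Each ⟨x, `whitenedDir hS hk j`⟩ is standard Gaussian, with mean absolute value at most 1. The
result is the hiding cost, linear in k. -/
lemma lintegral_sum_abs_inner_le {S : Matrix (Fin d) (Fin d) ℝ} (hS : S.PosDef) (hk : k ≤ d)
    {δ : ℝ} (hδ : 0 ≤ δ) {σ : ℝ≥0} (hσ : 0 < σ) :
    ∫⁻ x, ENNReal.ofReal ((∑ j, δ * |(inner ℝ x (whitenedDir hS hk j) : ℝ)|) / σ)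
      ∂(multivariateGaussian 0 S) ≤ ENNReal.ofReal (δ * k / σ) := by
  have hσ' : (0 : ℝ) < σ := by exact_mod_cast hσ
  have e : ∀ x : EuclideanSpace ℝ (Fin d),
      ENNReal.ofReal ((∑ j, δ * |(inner ℝ x (whitenedDir hS hk j) : ℝ)|) / σ)
      = ∑ j, ENNReal.ofReal (δ / σ) * ENNReal.ofReal |(inner ℝ x (whitenedDir hS hk j) : ℝ)| := by
    intro x
    rw [Finset.sum_div, ENNReal.ofReal_sum_of_nonneg fun j _ => by positivity]
    refine Finset.sum_congr rfl fun j _ => ?_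
    rw [← ENNReal.ofReal_mul (by positivity)]
    congr 1; ring
  simp_rw [e]
  rw [lintegral_finsetSum _ fun j _ => by fun_prop]
  calc _ ≤ ∑ _j : Fin k, ENNReal.ofReal (δ / σ) := by
        refine Finset.sum_le_sum fun j _ => ?_
        rw [lintegral_const_mul _ (by fun_prop)]
        have h1 : ∫⁻ x, ENNReal.ofReal |(inner ℝ x (whitenedDir hS hk j) : ℝ)|
            ∂(multivariateGaussian 0 S) ≤ 1 := by
          have h2 := multivariateGaussian_map_inner S (whitenedDir hS hk j)
          rw [sqrtCov_whitenedDir] at h2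
          have h3 : ‖(EuclideanSpace.single (Fin.castLE hk j) (1 : ℝ)
              : EuclideanSpace ℝ (Fin d))‖₊ ^ 2 = 1 := by simp
          rw [h3] at h2
          have h4 := lintegral_abs_gaussianReal_le
          rwa [← h2, lintegral_map (by fun_prop) (by fun_prop)] at h4
        calc _ ≤ ENNReal.ofReal (δ / σ) * 1 := by gcongr
          _ = _ := mul_one _
    _ = _ := by
        rw [Finset.sum_const, nsmul_eq_mul, Finset.card_univ, Fintype.card_fin,
          ← ENNReal.ofReal_natCast, ← ENNReal.ofReal_mul (by positivity)]
        congr 1; ring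

lemma affinity_ne_top {α : Type*} [MeasurableSpace α] (ν : Measure α) {p q : α → ℝ≥0∞}
    (hp : Measurable p) (hq : Measurable q) [IsProbabilityMeasure (ν.withDensity p)]
    [IsProbabilityMeasure (ν.withDensity q)] : affinity ν p q ≠ ⊤ := by
  have h := setLIntegral_sqrt_le ν hp hq MeasurableSet.univ
  rw [Measure.restrict_univ, measure_univ, measure_univ, ENNReal.one_rpow, one_mul] at h
  exact (lt_of_le_of_lt h ENNReal.one_lt_top).ne

/-- Testing two hypotheses of which only `N(t)` observations are informative. -/
lemma testing_lower_bound (lam : Fin n → unitInterval) (t : unitInterval)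
    (S : Matrix (Fin d) (Fin d) ℝ) {σ : ℝ≥0} (hσ : 0 < σ) (Q : Measure (Obs d))
    [IsProbabilityMeasure Q] (β β' : EuclideanSpace ℝ (Fin d)) {e : ℝ} (he1 : e ≤ 1)
    (he : ‖sqrtCov S (β - β')‖ ^ 2 / (8 * σ ^ 2) = e)
    {A : Set (Dataset d n)} (hA : MeasurableSet A) (hpos : 0 ≤ 1 - countLE lam t * e) :
    (1 - countLE lam t * e) ^ 2 / 2
      ≤ (Measure.pi fun i => if lam i ≤ t then cleanLaw S σ β else Q).real A
        + (Measure.pi fun i => if lam i ≤ t then cleanLaw S σ β' else Q).real Aᶜ := by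
  classical
  set ν : Fin n → Measure (Obs d) := fun i => if lam i ≤ t then refMeasure S else Q with hν
  set p : EuclideanSpace ℝ (Fin d) → Fin n → Obs d → ℝ≥0∞ := fun b i =>
    if lam i ≤ t then cleanDensity σ b else 1 with hp
  have hνs : ∀ i, SigmaFinite (ν i) := fun i => by
    by_cases h : lam i ≤ t <;> simp only [hν, h, if_true, if_false] <;> infer_instance
  have hpm : ∀ b i, Measurable (p b i) := fun b i => by
    by_cases h : lam i ≤ t <;> simp only [hp, h, if_true, if_false]
    · exact measurable_cleanDensity σ b
    · exact measurable_one
  have hlaw : ∀ b i, (ν i).withDensity (p b i) = if lam i ≤ t then cleanLaw S σ b else Q := by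
    intro b i
    by_cases h : lam i ≤ t <;> simp only [hν, hp, h, if_true, if_false]
    · exact (cleanLaw_eq_withDensity S hσ b).symm
    · exact withDensity_one
  have hprob : ∀ b i, IsProbabilityMeasure ((ν i).withDensity (p b i)) := fun b i => by
    rw [hlaw]; split_ifs <;> infer_instance
  have hpi : ∀ b, (Measure.pi fun i => if lam i ≤ t then cleanLaw S σ b else Q)
      = (Measure.pi ν).withDensity fun x => ∏ i, p b i (x i) := by
    intro b
    rw [← pi_withDensity ν (p b) (hpm b)]
    simp_rw [hlaw]
  have hprob' : ∀ b, IsProbabilityMeasure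
      ((Measure.pi ν).withDensity fun x => ∏ i, p b i (x i)) := fun b => by
    rw [← pi_withDensity ν (p b) (hpm b)]; infer_instance
  have hprodm : ∀ b, Measurable fun x : Dataset d n => ∏ i, p b i (x i) := fun b =>
    Finset.measurable_prod _ fun i _ => (hpm b i).comp (measurable_pi_apply i)
  have haff : ENNReal.ofReal ((1 - e) ^ countLE lam t) ≤ affinity (Measure.pi ν)
      (fun x => ∏ i, p β i (x i)) (fun x => ∏ i, p β' i (x i)) := by
    rw [affinity_pi ν _ _ (hpm β) (hpm β'), ENNReal.ofReal_pow (by linarith)]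
    have h1 : ∀ i, (if lam i ≤ t then ENNReal.ofReal (1 - e) else 1)
        ≤ affinity (ν i) (p β i) (p β' i) := by
      intro i
      -- A hidden coordinate has the law Q under both hypotheses, so its affinity is 1.
      by_cases h : lam i ≤ t <;> simp only [hν, hp, h, if_true, if_false]
      · rw [← he]; exact le_affinity_cleanDensity S hσ β β'
      · simp [affinity]
    refine le_trans (le_of_eq ?_) (Finset.prod_le_prod' fun i _ => h1 i)
    rw [Finset.prod_ite, Finset.prod_const_one, mul_one, Finset.prod_const, countLE]
  have h2 : 1 - countLE lam t * e ≤ (affinity (Measure.pi ν)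
      (fun x => ∏ i, p β i (x i)) (fun x => ∏ i, p β' i (x i))).toReal := by
    have h3 := ENNReal.toReal_mono (affinity_ne_top (Measure.pi ν) (hprodm β) (hprodm β')) haff
    have h4 : (0 : ℝ) ≤ (1 - e) ^ countLE lam t := pow_nonneg (by linarith) _
    rw [ENNReal.toReal_ofReal h4] at h3
    -- Bernoulli's inequality, (1 - e)ᴺ ≥ 1 - Ne.
    have h5 := one_add_mul_le_pow (a := -e) (by linarith) (countLE lam t)
    rw [← sub_eq_add_neg] at h5
    linarith
  have h6 := affinity_sq_le (Measure.pi ν) (hprodm β) (hprodm β') hA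
  rw [hpi, hpi]
  have h7 : (1 - countLE lam t * e) ^ 2 ≤ (affinity (Measure.pi ν)
      (fun x => ∏ i, p β i (x i)) (fun x => ∏ i, p β' i (x i))).toReal ^ 2 := by gcongr
  linarith

/-- No estimator beats the radius `δ² k / 100` when only the observations of corruption rate at most
`t` are informative. -/
theorem le_worstFailure (hk1 : 1 ≤ k) (hk : k ≤ d) (lam : Fin n → unitInterval) (t : unitInterval)
    {S : Matrix (Fin d) (Fin d) ℝ} (hS : S.PosDef) {σ : ℝ≥0} (hσ : 0 < σ) {δ : ℝ} (hδ : 0 < δ)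
    (hδt : δ * k / σ ≤ t) (hN : countLE lam t * (δ ^ 2 / (2 * σ ^ 2)) ≤ 1 / 28)
    (hδσ : δ ^ 2 / (2 * σ ^ 2) ≤ 1)
    {M : Dataset d n → EuclideanSpace ℝ (Fin d)} (hM : Measurable M) {r : ℝ≥0∞}
    (hr : r ≤ ENNReal.ofReal (δ ^ 2 * k / 100)) :
    ENNReal.ofReal (21 / 100) ≤ worstFailure lam S σ M r := by
  by_contra hcon
  push Not at hcon
  have hσ' : (0 : ℝ) < σ := by exact_mod_cast hσ
  obtain ⟨Q, hQp, hQ⟩ := exists_dominating_law S hσ t.2.1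
    (a := fun x => ∑ j, δ * |(inner ℝ x (whitenedDir hS hk j) : ℝ)|) (by fun_prop)
    (fun x => Finset.sum_nonneg fun j _ => by positivity)
    ((lintegral_sum_abs_inner_le hS hk hδ.le hσ).trans (ENNReal.ofReal_le_ofReal hδt))
  set b : (Fin k → Bool) → EuclideanSpace ℝ (Fin d) := vertexCoef hS hk δ
  have hκ : ∀ ω, ∃ κ : Adversary (Obs d) n, contaminatedLaw lam (cleanLaw S σ (b ω)) κ
      = Measure.pi fun i => if lam i ≤ t then cleanLaw S σ (b ω) else Q := fun ω =>
    exists_adversary_hiding lam t _ Q fun i hi =>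
      hQ (b ω) (abs_inner_vertexCoef_le hS hk hδ.le ω) (lam i) (le_of_lt hi)
  choose κ hκ using hκ
  -- The estimator is read as a guess of the signs of the coordinates. With Ne ≤ 1/28 the test error
  -- ρ is (27/28)²/2, and ρ/2 ≈ 0.232 exceeds 1/100 + 21/100, a contradiction.
  have hassouad := assouad hk1 (fun ω => contaminatedLaw lam (cleanLaw S σ (b ω)) (κ ω))
    (fun z j => decide (0 < sqrtCov S (M z) (Fin.castLE hk j))) (fun j => ?_)
    (ρ := (27 / 28) ^ 2 / 2) (c := 1 / 100) (a := 21 / 100) (by norm_num) (fun ω j A hA => ?_)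
    fun ω => ?_
  · norm_num at hassouad
  · have hm : Measurable fun z => sqrtCov S (M z) (Fin.castLE hk j) := by fun_prop
    refine measurable_to_bool ?_
    simpa [Set.preimage] using measurableSet_lt measurable_const hm
  · rw [hκ, hκ]
    have he : ‖sqrtCov S (b ω - b (flipAt j ω))‖ ^ 2 / (8 * (σ : ℝ) ^ 2)
        = δ ^ 2 / (2 * σ ^ 2) := by
      rw [vertexCoef_sub_flipAt]; field_simp; ring
    refine le_trans ?_ (testing_lower_bound lam t S hσ Q (b ω) (b (flipAt j ω)) hδσ he hA
      (by linarith))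
    gcongr
    linarith
  · refine ENNReal.toReal_le_of_le_ofReal (by norm_num) (le_trans (measure_mono ?_)
      ((le_iSup₂ (f := fun β κ => contaminatedLaw lam (cleanLaw S σ β) κ
        {z | r < ENNReal.ofReal (sqError S (M z) β)}) (b ω) (κ ω)).trans hcon.le))
    intro z hz
    refine lt_of_le_of_lt hr ?_
    have hzc : 1 / 100 * (k : ℝ) < ((Finset.univ.filter fun j =>
        decide (0 < sqrtCov S (M z) (Fin.castLE hk j)) ≠ ω j).card : ℝ) := hz
    -- A coordinate whose sign is guessed wrongly is off by at least δ.
    have hlow : δ ^ 2 * ((Finset.univ.filter fun j =>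
        decide (0 < sqrtCov S (M z) (Fin.castLE hk j)) ≠ ω j).card : ℝ) ≤ sqError S (M z) (b ω) := by
      rw [sqError_eq hS, map_sub, EuclideanSpace.real_norm_sq_eq]
      set v := sqrtCov S (M z) - sqrtCov S (b ω)
      calc _ = ∑ _j ∈ Finset.univ.filter (fun j =>
              decide (0 < sqrtCov S (M z) (Fin.castLE hk j)) ≠ ω j), δ ^ 2 := by
            rw [Finset.sum_const, nsmul_eq_mul, mul_comm]
        _ ≤ ∑ j ∈ Finset.univ.filter (fun j =>
              decide (0 < sqrtCov S (M z) (Fin.castLE hk j)) ≠ ω j), v (Fin.castLE hk j) ^ 2 := by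
            refine Finset.sum_le_sum fun j hj => ?_
            have hj' := (Finset.mem_filter.1 hj).2
            have e : v (Fin.castLE hk j) = sqrtCov S (M z) (Fin.castLE hk j)
                - if ω j then δ else -δ := by
              rw [← sqrtCov_vertexCoef_apply hS hk δ ω j]; rfl
            rw [e]
            cases hω : ω j
            · rw [hω] at hj'
              have : 0 < sqrtCov S (M z) (Fin.castLE hk j) := by simpa using hj'
              simp only [Bool.false_eq_true, if_false]
              nlinarith
            · rw [hω] at hj'
              have : sqrtCov S (M z) (Fin.castLE hk j) ≤ 0 := by simpa using hj'
              simp only [if_true]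
              nlinarith
        _ ≤ ∑ j : Fin k, v (Fin.castLE hk j) ^ 2 :=
            Finset.sum_le_sum_of_subset_of_nonneg (Finset.filter_subset _ _)
              fun j _ _ => sq_nonneg _
        _ = ∑ i ∈ Finset.univ.map (Fin.castLEEmb hk), v i ^ 2 := by rw [Finset.sum_map]; rfl
        _ ≤ ∑ i, v i ^ 2 := Finset.sum_le_sum_of_subset_of_nonneg (Finset.subset_univ _)
              fun j _ _ => sq_nonneg _
    have hlt : δ ^ 2 * k / 100 < sqError S (M z) (b ω) := by
      have : 0 < δ ^ 2 := by positivity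
      nlinarith
    exact (ENNReal.ofReal_lt_ofReal_iff (lt_of_le_of_lt (by positivity) hlt)).2 hlt

/-- The lower bound on the minimax rate. -/
theorem le_minimaxPACRate (hd : 1 ≤ d) {lam : Fin n → unitInterval}
    {S : Matrix (Fin d) (Fin d) ℝ} (hS : S.PosDef) {σ : ℝ≥0} (hσ : 0 < σ) {f : ℝ} (hf : 0 < f)
    (hf1 : f ≤ 1) (hfe : effectiveError lam d = ENNReal.ofReal f) :
    ENNReal.ofReal (σ ^ 2 * f / (3000 * √d)) ≤ minimaxPACRate lam S σ (1 / 5) := by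
  refine le_sInf fun r hr => ?_
  by_contra hcon
  push Not at hcon
  have hσ' : (0 : ℝ) < σ := by exact_mod_cast hσ
  have hd0 : (1 : ℝ) ≤ d := by exact_mod_cast hd
  have hsd1 : 1 ≤ √(d : ℝ) := Real.one_le_sqrt.2 hd0
  have hsd : √(d : ℝ) ^ 2 = d := Real.sq_sqrt (by linarith)
  have hlt : (1 / 5 : ℝ≥0∞) < ENNReal.ofReal (21 / 100) := by
    have : (1 / 5 : ℝ≥0∞) = ENNReal.ofReal (1 / 5) := by
      rw [ENNReal.ofReal_div_of_pos (by norm_num)]; simp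
    rw [this]
    exact (ENNReal.ofReal_lt_ofReal_iff (by norm_num)).2 (by norm_num)
  -- The infimum over estimators need not be attained; the room between 1/5 and 21/100 yields an
  -- actual M.
  obtain ⟨⟨M, hM⟩, hMr⟩ := iInf_lt_iff.1 (lt_of_le_of_lt hr hlt)
  -- The smallest k with k² ≥ d: testing needs dδ² ≲ σ²f while δ = στ/k is the largest separation
  -- that can be hidden.
  set k : ℕ := ⌈√(d : ℝ)⌉₊ with hkdef
  have hk0 : √(d : ℝ) ≤ k := Nat.le_ceil _
  have hk2 : (k : ℝ) ≤ 2 * √d := by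
    have := Nat.ceil_lt_add_one (Real.sqrt_nonneg (d : ℝ))
    linarith
  have hk1 : 1 ≤ k := by
    have : (1 : ℝ) ≤ k := hsd1.trans hk0
    exact_mod_cast this
  have hkd : k ≤ d := by
    refine Nat.ceil_le.2 ?_
    nlinarith
  have hkpos : (0 : ℝ) < k := by linarith
  set τ : ℝ := √(f / 15) with hτ
  have hτ0 : 0 < τ := Real.sqrt_pos.2 (by positivity)
  have hτ2 : τ ^ 2 = f / 15 := Real.sq_sqrt (by positivity)
  have hτ1 : τ ≤ 1 := by nlinarith
  set t : unitInterval := ⟨τ, hτ0.le, hτ1⟩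
  set δ : ℝ := σ * τ / k with hδdef
  have hδ : 0 < δ := by positivity
  have hδ2 : δ ^ 2 / (2 * (σ : ℝ) ^ 2) = τ ^ 2 / (2 * k ^ 2) := by
    rw [hδdef]; field_simp
  have hkd2 : (d : ℝ) ≤ (k : ℝ) ^ 2 := by rw [← hsd]; gcongr
  -- Minimality gives f ≤ d/N(τ) + f/15. Hence Nδ²/(2σ²) = Nf/(30k²) ≤ d/(28k²) ≤ 1/28.
  have hNf : (countLE lam t : ℝ) * f ≤ 15 / 14 * d := by
    rcases Nat.eq_zero_or_pos (countLE lam t) with h0 | hpos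
    · rw [h0]; simp
    · have h1 : ENNReal.ofReal f ≤ thresholdError lam d t := hfe ▸ iInf_le _ t
      rw [thresholdError_eq_ofReal hpos] at h1
      have h2 := (ENNReal.ofReal_le_ofReal_iff (by positivity)).1 h1
      change f ≤ d / countLE lam t + τ ^ 2 at h2
      rw [hτ2] at h2
      have hNpos : (0 : ℝ) < countLE lam t := by exact_mod_cast hpos
      have h3 : 14 / 15 * f ≤ d / countLE lam t := by linarith
      rw [le_div_iff₀ hNpos] at h3
      linarith
  have hbound : ENNReal.ofReal (21 / 100) ≤ worstFailure lam S σ M r := by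
    refine le_worstFailure hk1 hkd lam t hS hσ hδ ?_ ?_ ?_ hM (hcon.le.trans ?_)
    · change δ * k / σ ≤ τ
      rw [hδdef]
      field_simp
      exact le_rfl
    · rw [hδ2, hτ2, mul_div_assoc', div_le_iff₀ (by positivity)]
      nlinarith
    · rw [hδ2, hτ2, div_le_one (by positivity)]
      nlinarith
    · refine ENNReal.ofReal_le_ofReal ?_
      rw [hδdef, div_pow, mul_pow, hτ2]
      rw [div_le_div_iff₀ (by positivity) (by norm_num)]
      have e : (σ : ℝ) ^ 2 * (f / 15) / k ^ 2 * k * (3000 * √d) = σ ^ 2 * f * 200 * (√d / k) := by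
        field_simp; ring
      rw [e]
      have h1 : (1 / 2 : ℝ) ≤ √d / k := by
        rw [le_div_iff₀ hkpos]; linarith
      have h2 : 0 < (σ : ℝ) ^ 2 * f := by positivity
      nlinarith
  exact absurd hMr (not_lt.2 hbound)

end HeterogeneousRegression

/-! ### Assembly of the two bounds -/

namespace HeterogeneousRegression

lemma thresholdWeight_nonneg {n : ℕ} (lam : Fin n → unitInterval) (t : unitInterval) (i : Fin n) :
    0 ≤ thresholdWeight lam t i := by
  unfold thresholdWeight
  split_ifs <;> positivity

/-- At an optimal threshold the effective error is a positive real number below any finite bound. -/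
lemma exists_effectiveError_eq_ofReal {d n : ℕ} (hd : 1 ≤ d) {lam : Fin n → unitInterval}
    {t : unitInterval} (ht : IsOptimalThreshold lam d t) {c : ℝ≥0} (hc : effectiveError lam d ≤ c) :
    ∃ f : ℝ, 0 < countLE lam t ∧ f = d / countLE lam t + (t : ℝ) ^ 2 ∧ 0 < f ∧ f ≤ c ∧
      effectiveError lam d = ENNReal.ofReal f := by
  have he := effectiveError_eq ht
  have hN : 0 < countLE lam t := countLE_pos_of_thresholdError_ne_top hd
    (he ▸ (lt_of_le_of_lt hc ENNReal.coe_lt_top).ne)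
  have he' := he.trans (thresholdError_eq_ofReal hN)
  have hf : (0 : ℝ) < d / countLE lam t + (t : ℝ) ^ 2 := by
    have : (0 : ℝ) < d := by exact_mod_cast hd
    have : (0 : ℝ) < countLE lam t := by exact_mod_cast hN
    positivity
  refine ⟨_, hN, rfl, hf, ?_, he'⟩
  rw [he', ← ENNReal.ofReal_coe_nnreal] at hc
  exact (ENNReal.ofReal_le_ofReal_iff c.2).1 hc

end HeterogeneousRegression

theorem theorem3 :
    ∃ c C₁ C₂ : ℝ≥0, 0 < c ∧ 0 < C₁ ∧ 0 < C₂ ∧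
      ∀ (d n : ℕ), 1 ≤ d →
      ∀ (lam : Fin n → unitInterval) (S : Matrix (Fin d) (Fin d) ℝ) (σ : ℝ≥0), S.PosDef → 0 < σ →
      effectiveError lam d ≤ (c : ℝ≥0∞) →
        ((C₁ * (σ ^ 2 / NNReal.sqrt (d : ℝ≥0)) : ℝ≥0) : ℝ≥0∞) * effectiveError lam d
            ≤ minimaxPACRate lam S σ (1 / 5) ∧
        minimaxPACRate lam S σ (1 / 5)
            ≤ ((C₂ * σ ^ 2 : ℝ≥0) : ℝ≥0∞) * effectiveError lam d ∧
        (∃ t : unitInterval, IsOptimalThreshold lam d t) ∧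
        ∀ t : unitInterval, IsOptimalThreshold lam d t →
          (∃ M : Dataset d n → EuclideanSpace ℝ (Fin d),
            Measurable M ∧ IsTukeyRegression (thresholdWeight lam t) M) ∧
          ∀ M : Dataset d n → EuclideanSpace ℝ (Fin d),
            IsTukeyRegression (thresholdWeight lam t) M →
              worstFailure lam S σ M (((C₂ * σ ^ 2 : ℝ≥0) : ℝ≥0∞) * effectiveError lam d)
                ≤ 1 / 5 := by
  -- The choice c = 1/C₂ ensures that the tilt s = 1660000√f is at most 1, the range of
  -- `tiltProb_le`, and that d ≤ N(t).
  refine ⟨1 / 1660000 ^ 2, 1 / 3000, 1660000 ^ 2, by positivity, by positivity, by positivity, ?_⟩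
  intro d n hd lam S σ hS hσ hc
  have upper : ∀ t : unitInterval, IsOptimalThreshold lam d t →
      ∀ M : Dataset d n → EuclideanSpace ℝ (Fin d), IsTukeyRegression (thresholdWeight lam t) M →
        worstFailure lam S σ M
          (((1660000 ^ 2 * σ ^ 2 : ℝ≥0) : ℝ≥0∞) * effectiveError lam d) ≤ 1 / 5 := by
    intro t ht M hM
    obtain ⟨f, hN, hf, hf0, hfc, he⟩ := exists_effectiveError_eq_ofReal hd ht hc
    have h := worstFailure_tukey_le hd hS hσ hN hf (by push_cast at hfc; linarith) hM
    rwa [he, ← ENNReal.ofReal_coe_nnreal, ← ENNReal.ofReal_mul (NNReal.coe_nonneg _),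
      NNReal.coe_mul, NNReal.coe_pow, NNReal.coe_pow, NNReal.coe_ofNat]
  obtain ⟨t₀, ht₀⟩ := exists_isOptimalThreshold hd lam
  refine ⟨?_, ?_, ⟨t₀, ht₀⟩, fun t ht =>
    ⟨exists_measurable_isTukeyRegression hd (thresholdWeight_nonneg lam t), upper t ht⟩⟩
  · obtain ⟨f, -, -, hf0, hfc, he⟩ := exists_effectiveError_eq_ofReal hd ht₀ hc
    have hf1 : f ≤ 1 := hfc.trans (by norm_num)
    refine le_of_eq_of_le ?_ (le_minimaxPACRate hd hS hσ hf0 hf1 he)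
    rw [he, ← ENNReal.ofReal_coe_nnreal, ← ENNReal.ofReal_mul (NNReal.coe_nonneg _)]
    congr 1
    push_cast
    have : (0 : ℝ) < √(d : ℝ) := Real.sqrt_pos.2 (by exact_mod_cast hd)
    field_simp
  · obtain ⟨M, hMm, hM⟩ := exists_measurable_isTukeyRegression hd (thresholdWeight_nonneg lam t₀)
    refine sInf_le ?_
    rw [Set.mem_ofPred_eq]
    exact iInf_le_of_le ⟨M, hMm⟩ (upper t₀ ht₀ M hM)
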